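/- A \emph{strict coboundary category} is a strict monoidal category $(C,\otimes,I)$ with a natural isomorphism $\sigma_{x,y}\colon x\otimes y\to y\otimes x$ (the \emph{commutor}) such that $\sigma_{y,x}\sigma_{x,y}=\mathrm{id}$, $\sigma_{x,z\otimes y}\circ(\mathrm{id}_x\otimes\sigma_{y,z})=\sigma_{y\otimes x,z}\circ(\sigma_{x,y}\otimes\mathrm{id}_z)$ and $\sigma_{I,I}=\mathrm{id}$. A \emph{strict coboundary functor} preserves $I$, $\otimes$ and $\sigma$ on the nose; the 2-cells between such functors are the monoidal transformations. The \emph{cactus group} $J_n$ is generated by $s_{p,q}$, $1\le p<q\le n$, subject to: $s_{p,q}^2=e$; $s_{p,q}s_{k,l}=s_{k,l}s_{p,q}$ if $q<k$ or $l<p$; and $s_{p,q}s_{k,l}=s_{p+q-l,\,p+q-k}\,s_{p,q}$ if $p\le k<l\le q$. Put $s_{p,q}=e$ when $p\ge q$. The homomorphism $\pi_n\colon J_n\to\Sigma_n$ sends $s_{p,q}$ to the permutation reversing $p,\dots,q$. For $h_i\in J_{k_i}$ let $\beta(h_1,\dots,h_n)\in J_{k_1+\cdots+k_n}$ be the product of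 the images of the $h_i$ under $s_{p,q}\mapsto s_{p+r_i,q+r_i}$, where $r_i=k_1+\cdots+k_{i-1}$. Let $BJ=\coprod_n BJ_n$ be the category with objects the natural numbers, $BJ(n,n)=J_n$, no morphisms $m\to n$ for $m\neq n$, and composition given by multiplication. An \emph{action operad} $\mathbf\Lambda$ is an operad of sets $(\Lambda(n))_n$ with multiplication $\mu$, in which each $\Lambda(n)$ is a group, with a map of operads $\pi\colon\Lambda\to\Sigma$ that is a homomorphism in each degree, such that $\mu(g;f_1,\dots,f_n)\,\mu(g';f'_1,\dots,f'_n)=\mu(gg';f_{\pi(g')(1)}f'_1,\dots,f_{\pi(g')(n)}f'_n)$. It determines a 2-monad $E\Lambda$ on $\mathbf{Cat}$, $E\Lambda(X)=\coprod_n E\Lambda(n)\times_{\Lambda(n)}X^n$: objects are finite strings of objects of $X$; a morphism $(x_1,\dots,x_n)\to(y_1,\dots,y_n)$ is a $g\in\Lambda(n)$ with morphisms $x_i\to y_{\pi(g)(i)}$; the unit is given by strings of length one and the multiplication by concatenation of strings and $\mu$. The maps $\pi_n$ induce a map of 2-monads $\tilde\pi\colon E\Lambda\Rightarrow E\Sigma$.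 \textbf{Theorem.} With addition as tensor product on objects, $\beta$ as tensor product of morphisms, and commutor $$\sigma_{m,n}=s_{1,m+n}\,s_{1,m}\,s_{m+1,m+n},$$ $BJ$ is a strict coboundary category, and it is the free strict coboundary category on one object: for every strict coboundary category $D$, evaluation at $1$ is a bijection from strict coboundary functors $BJ\to D$ to objects of $D$, and for strict coboundary functors $F,G\colon BJ\to D$ it is a bijection from monoidal transformations $F\Rightarrow G$ to morphisms $F(1)\to G(1)$. \textbf{Corollary.} The groups $J_n$ with the maps $\pi_n$ carry an action operad structure $\mathbf J$ with $\mu(e;h_1,\dots,h_n)=\beta(h_1,\dots,h_n)$ and $$\mu(s_{p,q};e_{k_1},\dots,e_{k_n})=s_{k_1+\cdots+k_{p-1}+1,\;k_1+\cdots+k_q}\cdot\beta(e_{k_1},\dots,e_{k_{p-1}},s_{1,k_p},\dots,s_{1,k_q},e_{k_{q+1}},\dots,e_{k_n}),$$ and the 2-monad for strict coboundary categories is $EJ$, with $\tilde\pi\colon EJ\Rightarrow E\Sigma$ as its structure of a club. Explicitly, let $EJ(X)$ and $E\Sigma(X)$ have the strict coboundary structures given by concatenation of strings, block sums, and the elements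 $\sigma_{m,n}$, respectively the block transpositions. Then: $EJ(X)$ is the free strict coboundary category on $X$ via the unit $X\to EJ(X)$, for strict coboundary functors and for monoidal transformations; $EJ(H)$ is the strict coboundary functor, and $EJ(\alpha)$ the monoidal transformation, induced by a functor $H$ and by a natural transformation $\alpha$; the multiplication $EJ(EJ(X))\to EJ(X)$ is the strict coboundary functor extending the identity; every strict $EJ$-algebra $a\colon EJ(D)\to D$ is a strict coboundary functor for exactly one strict coboundary structure on $D$; $\tilde\pi_X\colon EJ(X)\to E\Sigma(X)$ is the strict coboundary functor extending the unit $X\to E\Sigma(X)$; and for every functor $H\colon X\to Y$ the naturality square of $\tilde\pi$ at $H$ is a pullback in $\mathbf{Cat}$. -/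

import Mathlib

open CategoryTheory MonoidalCategory

/-! ### Coboundary categories -/

/-- A monoidal category is strict if its associators and unitors are identities. -/
class IsStrictMonoidal (C : Type*) [Category C] [MonoidalCategory C] : Prop where
  tensor_assoc : ∀ x y z : C, (x ⊗ y) ⊗ z = x ⊗ (y ⊗ z)
  unit_tensor : ∀ x : C, 𝟙_ C ⊗ x = x
  tensor_unit : ∀ x : C, x ⊗ 𝟙_ C = x
  associator_hom : ∀ x y z : C, (α_ x y z).hom = eqToHom (tensor_assoc x y z)
  leftUnitor_hom : ∀ x : C, (λ_ x).hom = eqToHom (unit_tensor x)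
  rightUnitor_hom : ∀ x : C, (ρ_ x).hom = eqToHom (tensor_unit x)

/-- A coboundary category: a monoidal category with a natural involutive commutor satisfying the
cactus axiom, normalised on the unit object. -/
class CoboundaryCategory (C : Type*) [Category C] [MonoidalCategory C] where
  commutor : ∀ x y : C, x ⊗ y ≅ y ⊗ x
  commutor_naturality : ∀ {x x' y y' : C} (f : x ⟶ x') (g : y ⟶ y'),
    (f ⊗ₘ g) ≫ (commutor x' y').hom = (commutor x y).hom ≫ (g ⊗ₘ f)
  commutor_symmetry : ∀ x y : C, (commutor x y).hom ≫ (commutor y x).hom = 𝟙 (x ⊗ y)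
  cactus : ∀ x y z : C,
    (α_ x y z).hom ≫ (x ◁ (commutor y z).hom) ≫ (commutor x (z ⊗ y)).hom =
      ((commutor x y).hom ▷ z) ≫ (commutor (y ⊗ x) z).hom ≫ (α_ z y x).inv
  commutor_unit : (commutor (𝟙_ C) (𝟙_ C)).hom = 𝟙 (𝟙_ C ⊗ 𝟙_ C)

/-- A strict coboundary category: a coboundary category whose monoidal structure is strict. -/
class StrictCoboundaryCategory (C : Type*) [Category C] extends
  MonoidalCategory C, IsStrictMonoidal C, CoboundaryCategory C

/-- A strict coboundary functor preserves unit, tensor product and commutor on the nose. -/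
structure IsStrictCoboundaryFunctor {C D : Type*} [Category C] [Category D]
    [StrictCoboundaryCategory C] [StrictCoboundaryCategory D] (F : C ⥤ D) : Prop where
  obj_unit : F.obj (𝟙_ C) = 𝟙_ D
  obj_tensor : ∀ x y : C, F.obj (x ⊗ y) = F.obj x ⊗ F.obj y
  map_tensor : ∀ {x x' y y' : C} (f : x ⟶ x') (g : y ⟶ y'),
    F.map (f ⊗ₘ g) =
      eqToHom (obj_tensor x y) ≫ (F.map f ⊗ₘ F.map g) ≫ eqToHom (obj_tensor x' y').symm
  map_commutor : ∀ x y : C,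
    F.map (CoboundaryCategory.commutor x y).hom =
      eqToHom (obj_tensor x y) ≫ (CoboundaryCategory.commutor (F.obj x) (F.obj y)).hom ≫
        eqToHom (obj_tensor y x).symm

/-- Monoidal transformations between strict coboundary functors. -/
structure IsMonoidalTransformation {C D : Type*} [Category C] [Category D]
    [StrictCoboundaryCategory C] [StrictCoboundaryCategory D] {F G : C ⥤ D}
    (hF : IsStrictCoboundaryFunctor F) (hG : IsStrictCoboundaryFunctor G) (θ : F ⟶ G) : Prop where
  app_unit : θ.app (𝟙_ C) = eqToHom (hF.obj_unit.trans hG.obj_unit.symm)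
  app_tensor : ∀ x y : C, θ.app (x ⊗ y) =
    eqToHom (hF.obj_tensor x y) ≫ (θ.app x ⊗ₘ θ.app y) ≫ eqToHom (hG.obj_tensor x y).symm

/-! ### Families of groups over the symmetric groups -/

/-- Transport along an equality of indices. -/
def gcast {Λ : ℕ → Type} [∀ n, Group (Λ n)] {m n : ℕ} (h : m = n) : Λ m ≃* Λ n := by
  subst h; exact MulEquiv.refl _

section gcast
variable {Λ : ℕ → Type} [∀ n, Group (Λ n)]

@[simp] theorem gcast_rfl {m : ℕ} (h : m = m) (g : Λ m) : gcast h g = g := rfl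

@[simp] theorem gcast_gcast {m n p : ℕ} (h : m = n) (h' : n = p) (g : Λ m) :
    gcast h' (gcast h g) = gcast (h.trans h') g := by subst h; subst h'; rfl

theorem eq_gcast_iff {m n : ℕ} (h : m = n) {x : Λ n} {y : Λ m} :
    x = gcast h y ↔ gcast h.symm x = y := by subst h; rfl

theorem gcast_perm_apply {m n : ℕ} (h : m = n) (π : ∀ n, Λ n →* Equiv.Perm (Fin n)) (g : Λ m)
    (i : Fin n) : π n (gcast h g) i = Fin.cast h (π m g (Fin.cast h.symm i)) := by
  subst h; rfl

end gcast

theorem sum_finSigmaFinEquiv_symm {n : ℕ} {k : Fin n → ℕ} (p : ∀ i, Fin (k i) → ℕ) :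
    ∑ a, p (finSigmaFinEquiv.symm a).1 (finSigmaFinEquiv.symm a).2 = ∑ i, ∑ j, p i j := by
  rw [← Equiv.sum_comp finSigmaFinEquiv, Fintype.sum_sigma]
  exact Finset.sum_congr rfl fun i _ => Finset.sum_congr rfl fun j _ => by
    rw [Equiv.symm_apply_apply]

/-- An action operad with underlying groups `Λ n` and underlying permutations given by `π`. Here `μ g f` is the operadic composite
`μ(g; f₁, …, fₙ)`, and permutations are composed as functions. -/
structure ActionOperad {Λ : ℕ → Type} [∀ n, Group (Λ n)]
    (π : ∀ n, Λ n →* Equiv.Perm (Fin n)) where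
  μ : ∀ {n : ℕ} {k : Fin n → ℕ}, Λ n → (∀ i, Λ (k i)) → Λ (∑ i, k i)
  one : Λ 1
  one_μ : ∀ {m : ℕ} (g : Λ m), gcast (by simp) (μ (k := fun _ => m) one fun _ => g) = g
  μ_one : ∀ {n : ℕ} (g : Λ n), gcast (by simp) (μ (k := fun _ => 1) g fun _ => one) = g
  assoc : ∀ {n : ℕ} {k : Fin n → ℕ} {p : ∀ i, Fin (k i) → ℕ} (f : Λ n) (g : ∀ i, Λ (k i))
    (h : ∀ i j, Λ (p i j)),
    gcast (sum_finSigmaFinEquiv_symm p)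
      (μ (k := fun a => p (finSigmaFinEquiv.symm a).1 (finSigmaFinEquiv.symm a).2) (μ f g)
        fun a => h (finSigmaFinEquiv.symm a).1 (finSigmaFinEquiv.symm a).2) =
      μ f fun i => μ (g i) (h i)
  π_μ : ∀ {n : ℕ} {k : Fin n → ℕ} (g : Λ n) (f : ∀ i, Λ (k i)) (i : Fin n) (j : Fin (k i)),
    π _ (μ g f) (finSigmaFinEquiv ⟨i, j⟩) =
      Fin.cast (Equiv.sum_comp (π n g)⁻¹ k)
        (finSigmaFinEquiv (n := fun i' => k ((π n g)⁻¹ i'))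
          ⟨π n g i, Fin.cast (by simp) (π _ (f i) j)⟩)
  μ_mul_μ : ∀ {n : ℕ} {k : Fin n → ℕ} (g g' : Λ n) (f : ∀ i, Λ (k ((π n g')⁻¹ i)))
    (f' : ∀ i, Λ (k i)),
    gcast (Equiv.sum_comp (π n g')⁻¹ k) (μ g f) * μ g' f' =
      μ (g * g') fun i => gcast (by simp) (f (π n g' i)) * f' i

/-- Groups `Λ n` over the symmetric groups, with a block sum `β` and elements `c m n` lying over the
transposition of a block of length `m` past a block of length `n`, satisfying the identities that
make the commutor with components `c m n` a coboundary structure for `β`. -/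
class CoboundaryGroups {Λ : ℕ → Type} [∀ n, Group (Λ n)]
    (π : ∀ n, Λ n →* Equiv.Perm (Fin n)) where
  β : ∀ {m n : ℕ}, Λ m → Λ n → Λ (m + n)
  c : ∀ m n : ℕ, Λ (m + n)
  β_one_one : ∀ m n : ℕ, β (1 : Λ m) (1 : Λ n) = 1
  β_mul : ∀ {m n : ℕ} (f f' : Λ m) (g g' : Λ n), β (f * f') (g * g') = β f g * β f' g'
  β_assoc : ∀ {m n p : ℕ} (f : Λ m) (g : Λ n) (h : Λ p),
    gcast (Nat.add_assoc m n p) (β (β f g) h) = β f (β g h)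
  one_β : ∀ {n : ℕ} (g : Λ n), gcast (Nat.zero_add n) (β (1 : Λ 0) g) = g
  β_one : ∀ {n : ℕ} (g : Λ n), gcast (Nat.add_zero n) (β g (1 : Λ 0)) = g
  π_β_left : ∀ {m n : ℕ} (f : Λ m) (g : Λ n) (i : Fin m),
    π _ (β f g) (Fin.castAdd n i) = Fin.castAdd n (π m f i)
  π_β_right : ∀ {m n : ℕ} (f : Λ m) (g : Λ n) (j : Fin n),
    π _ (β f g) (Fin.natAdd m j) = Fin.natAdd m (π n g j)
  π_c_left : ∀ (m n : ℕ) (i : Fin m),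
    π _ (c m n) (Fin.castAdd n i) = Fin.cast (Nat.add_comm n m) (Fin.natAdd n i)
  π_c_right : ∀ (m n : ℕ) (j : Fin n),
    π _ (c m n) (Fin.natAdd m j) = Fin.cast (Nat.add_comm n m) (Fin.castAdd m j)
  c_natural : ∀ {m n : ℕ} (f : Λ m) (g : Λ n),
    c m n * β f g = gcast (Nat.add_comm n m) (β g f) * c m n
  c_symm : ∀ m n : ℕ, gcast (Nat.add_comm n m) (c n m) * c m n = 1
  c_cactus : ∀ m n p : ℕ,
    gcast (by omega) (c m (p + n)) * gcast (by omega) (β (1 : Λ m) (c n p)) =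
      gcast (by omega) (c (n + m) p) * β (c m n) (1 : Λ p)
  c_zero : c 0 0 = 1

/-! ### The category `BΛ = ∐ BΛ(n)` -/

/-- The objects of `BΛ` are the natural numbers. -/
structure BObj {Λ : ℕ → Type} [∀ n, Group (Λ n)] (π : ∀ n, Λ n →* Equiv.Perm (Fin n)) where
  n : ℕ

namespace BObj

variable {Λ : ℕ → Type} [∀ n, Group (Λ n)] {π : ∀ n, Λ n →* Equiv.Perm (Fin n)}

/-- A morphism `m ⟶ n` exists only if `m = n`, and is then an element of `Λ(m) = Λ(n)`. -/
@[ext] structure Hom (a b : BObj π) where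
  len : a.n = b.n
  g : Λ a.n

/-- Composition is multiplication in the groups. -/
instance : Category (BObj π) where
  Hom := Hom
  id a := ⟨rfl, 1⟩
  comp F F' := ⟨F.len.trans F'.len, gcast F.len.symm F'.g * F.g⟩
  id_comp F := by ext; simp
  comp_id F := by ext; simp
  assoc F F' F'' := by ext; simp [mul_assoc]

@[ext] theorem hom_ext {a b : BObj π} {F F' : a ⟶ b} (h : F.g = F'.g) : F = F' := Hom.ext h

@[simp] theorem id_g (a : BObj π) : (𝟙 a : a ⟶ a).g = 1 := rfl

@[simp] theorem comp_g {a b d : BObj π} (F : a ⟶ b) (F' : b ⟶ d) :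
    (F ≫ F').g = gcast F.len.symm F'.g * F.g := rfl

@[simp] theorem eqToHom_g {a b : BObj π} (h : a = b) : (eqToHom h).g = 1 := by subst h; rfl

theorem ext_n {a b : BObj π} (h : a.n = b.n) : a = b := by
  cases a; cases b; cases h; rfl

variable [G : CoboundaryGroups π]

theorem β_gcast {m m' n n' : ℕ} (h : m = m') (h' : n = n') (f : Λ m) (g : Λ n) :
    G.β (gcast h f) (gcast h' g) = gcast (by rw [h, h']) (G.β f g) := by subst h; subst h'; rfl

theorem c_gcast {m m' n n' : ℕ} (h : m = m') (h' : n = n') :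
    G.c m' n' = gcast (by rw [h, h']) (G.c m n) := by subst h; subst h'; rfl

instance : MonoidalCategoryStruct (BObj π) where
  tensorObj a b := ⟨a.n + b.n⟩
  tensorHom F F' := ⟨by rw [F.len, F'.len], G.β F.g F'.g⟩
  whiskerLeft a _ _ F := ⟨by rw [F.len], G.β (1 : Λ a.n) F.g⟩
  whiskerRight F b := ⟨by rw [F.len], G.β F.g (1 : Λ b.n)⟩
  tensorUnit := ⟨0⟩
  associator a b d := eqToIso (ext_n (Nat.add_assoc _ _ _))
  leftUnitor a := eqToIso (ext_n (Nat.zero_add _))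
  rightUnitor a := eqToIso (ext_n (Nat.add_zero _))

theorem tensor_assoc (a b d : BObj π) : (a ⊗ b) ⊗ d = a ⊗ (b ⊗ d) := ext_n (Nat.add_assoc _ _ _)
theorem unit_tensor (a : BObj π) : 𝟙_ (BObj π) ⊗ a = a := ext_n (Nat.zero_add _)
theorem tensor_unit (a : BObj π) : a ⊗ 𝟙_ (BObj π) = a := ext_n (Nat.add_zero _)

@[simp] theorem tensorHom_g {a b a' b' : BObj π} (F : a ⟶ b) (F' : a' ⟶ b') :
    (F ⊗ₘ F').g = G.β F.g F'.g := rfl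
@[simp] theorem whiskerLeft_g {a b : BObj π} (d : BObj π) (F : a ⟶ b) :
    (d ◁ F).g = G.β (1 : Λ d.n) F.g := rfl
@[simp] theorem whiskerRight_g {a b : BObj π} (F : a ⟶ b) (d : BObj π) :
    (F ▷ d).g = G.β F.g (1 : Λ d.n) := rfl
@[simp] theorem associator_hom_g (a b d : BObj π) : (α_ a b d).hom.g = 1 :=
  eqToHom_g (π := π) (tensor_assoc a b d)
@[simp] theorem associator_inv_g (a b d : BObj π) : (α_ a b d).inv.g = 1 :=
  eqToHom_g (π := π) (tensor_assoc a b d).symm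
@[simp] theorem leftUnitor_hom_g (a : BObj π) : (λ_ a).hom.g = 1 :=
  eqToHom_g (π := π) (unit_tensor a)
@[simp] theorem rightUnitor_hom_g (a : BObj π) : (ρ_ a).hom.g = 1 :=
  eqToHom_g (π := π) (tensor_unit a)

instance : MonoidalCategory (BObj π) := .ofTensorHom
  (id_tensorHom_id := fun _ _ => by ext; exact G.β_one_one _ _)
  (id_tensorHom := fun _ _ _ _ => rfl)
  (tensorHom_id := fun _ _ => rfl)
  (tensorHom_comp_tensorHom := fun F₁ F₂ F₁' F₂' => by
    ext
    simp [G.β_mul, β_gcast])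
  (associator_naturality := fun F₁ F₂ F₃ => by
    ext
    simp [← G.β_assoc])
  (leftUnitor_naturality := fun F => by
    ext
    rw [comp_g, comp_g, tensorHom_g, leftUnitor_hom_g, leftUnitor_hom_g]
    simp only [map_one, one_mul, mul_one, id_g]
    exact (eq_gcast_iff _).2 (G.one_β F.g))
  (rightUnitor_naturality := fun F => by
    ext
    rw [comp_g, comp_g, tensorHom_g, rightUnitor_hom_g, rightUnitor_hom_g]
    simp only [map_one, one_mul, mul_one, id_g]
    exact G.β_one F.g)
  (pentagon := fun a b d e => by ext; simp [G.β_one_one])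
  (triangle := fun a b => by ext; simp [G.β_one_one])

/-- The commutor of `BΛ` has components `c m n`. -/
instance : StrictCoboundaryCategory (BObj π) where
  tensor_assoc := tensor_assoc
  unit_tensor := unit_tensor
  tensor_unit := tensor_unit
  associator_hom a b d := rfl
  leftUnitor_hom a := rfl
  rightUnitor_hom a := rfl
  commutor a b :=
    { hom := ⟨Nat.add_comm _ _, G.c a.n b.n⟩
      inv := ⟨Nat.add_comm _ _, G.c b.n a.n⟩
      hom_inv_id := by ext; exact G.c_symm _ _
      inv_hom_id := by ext; exact G.c_symm _ _ }
  commutor_naturality F F' := by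
    ext
    simp only [comp_g, tensorHom_g]
    rw [← G.c_natural, ← c_gcast F.len.symm F'.len.symm]
  commutor_symmetry a b := by ext; exact G.c_symm _ _
  cactus a b d := by
    ext
    simp only [comp_g, whiskerLeft_g, whiskerRight_g, associator_hom_g, associator_inv_g, map_one,
      map_mul, mul_one, one_mul, gcast_gcast]
    exact G.c_cactus a.n b.n d.n
  commutor_unit := by ext; exact G.c_zero

end BObj

/-! ### The cactus groups -/

/-- A generator `s_{p,q}` of the `n`-fruit cactus group: a pair `1 ≤ p < q ≤ n`. -/
structure CactusGen (n : ℕ) where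
  p : ℕ
  q : ℕ
  one_le : 1 ≤ p
  lt : p < q
  le : q ≤ n

/-- The function `ŝ_{p,q}` on natural numbers, reversing the interval from `p` to `q`. -/
def reverse (p q i : ℕ) : ℕ := if p ≤ i ∧ i ≤ q then p + q - i else i

/-- The relators of the cactus group. -/
inductive CactusRel (n : ℕ) : FreeGroup (CactusGen n) → Prop
  | square (a : CactusGen n) : CactusRel n (.of a * .of a)
  | disjoint (a b : CactusGen n) (h : a.q < b.p ∨ b.q < a.p) :
      CactusRel n ((.of a * .of b) * (.of b * .of a)⁻¹)
  | contains (a b d : CactusGen n) (h : a.p ≤ b.p ∧ b.q ≤ a.q)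
      (hp : d.p = reverse a.p a.q b.q) (hq : d.q = reverse a.p a.q b.p) :
      CactusRel n ((.of a * .of b) * (.of d * .of a)⁻¹)

/-- The `n`-fruit cactus group `J_n`. -/
abbrev Cactus (n : ℕ) : Type := PresentedGroup {r | CactusRel n r}

namespace Cactus

/-- The element `s_{p,q}` of `J_n`, with the convention `s_{p,q} = e` unless `1 ≤ p < q ≤ n`. -/
def s (n p q : ℕ) : Cactus n :=
  if h : 1 ≤ p ∧ p < q ∧ q ≤ n then PresentedGroup.of ⟨p, q, h.1, h.2.1, h.2.2⟩ else 1

theorem s_gen {n : ℕ} (a : CactusGen n) : s n a.p a.q = PresentedGroup.of a := by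
  rw [s, dif_pos ⟨a.one_le, a.lt, a.le⟩]

theorem s_of_not {n p q : ℕ} (h : ¬(1 ≤ p ∧ p < q ∧ q ≤ n)) : s n p q = 1 := dif_neg h

theorem s_of_ge {n p q : ℕ} (h : q ≤ p) : s n p q = 1 := s_of_not (by omega)

theorem s_mul_self (n p q : ℕ) : s n p q * s n p q = 1 := by
  by_cases h : 1 ≤ p ∧ p < q ∧ q ≤ n
  · have := PresentedGroup.one_of_mem (rels := {r | CactusRel n r})
      (CactusRel.square ⟨p, q, h.1, h.2.1, h.2.2⟩)
    simpa [s, h, PresentedGroup.of] using this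
  · simp [s_of_not h]

theorem s_mul_s_cancel (n p q : ℕ) (x : Cactus n) : s n p q * (s n p q * x) = x := by
  rw [← mul_assoc, s_mul_self, one_mul]

theorem s_comm {n p q k l : ℕ} (h : q < k ∨ l < p) : s n p q * s n k l = s n k l * s n p q := by
  by_cases h₁ : 1 ≤ p ∧ p < q ∧ q ≤ n
  · by_cases h₂ : 1 ≤ k ∧ k < l ∧ l ≤ n
    · have := PresentedGroup.mk_eq_mk_of_mul_inv_mem (rels := {r | CactusRel n r})
        (CactusRel.disjoint ⟨p, q, h₁.1, h₁.2.1, h₁.2.2⟩ ⟨k, l, h₂.1, h₂.2.1, h₂.2.2⟩ h)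
      simpa [s, h₁, h₂, PresentedGroup.of] using this
    · simp [s_of_not h₂]
  · simp [s_of_not h₁]

theorem s_contains {n p q k l : ℕ} (hp : 1 ≤ p) (hq : q ≤ n) (hk : p ≤ k) (hl : l ≤ q) :
    s n p q * s n k l = s n (p + q - l) (p + q - k) * s n p q := by
  by_cases h₂ : k < l
  · have := PresentedGroup.mk_eq_mk_of_mul_inv_mem (rels := {r | CactusRel n r})
      (CactusRel.contains ⟨p, q, hp, by omega, hq⟩ ⟨k, l, by omega, h₂, by omega⟩
        ⟨p + q - l, p + q - k, by omega, by omega, by omega⟩ ⟨hk, hl⟩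
        (by simp [reverse]; omega) (by simp [reverse]; omega))
    rw [s, dif_pos ⟨hp, by omega, hq⟩, s, dif_pos ⟨by omega, h₂, by omega⟩, s,
      dif_pos ⟨by omega, by omega, by omega⟩]
    simpa [PresentedGroup.of] using this
  · rw [s_of_ge (p := k) (by omega), s_of_ge (p := p + q - l) (by omega)]
    simp

/-- Homomorphisms out of the cactus groups. -/
def lift {n : ℕ} {H : Type*} [Group H] (t : ℕ → ℕ → H)
    (h₁ : ∀ p q, 1 ≤ p → p < q → q ≤ n → t p q * t p q = 1)
    (h₂ : ∀ p q k l, 1 ≤ p → p < q → q < k → k < l → l ≤ n → t p q * t k l = t k l * t p q)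
    (h₃ : ∀ p q k l, 1 ≤ p → p ≤ k → k < l → l ≤ q → q ≤ n →
      t p q * t k l = t (p + q - l) (p + q - k) * t p q) : Cactus n →* H :=
  PresentedGroup.toGroup (f := fun a => t a.p a.q) (by
    rintro r (⟨a⟩ | ⟨a, b, h⟩ | ⟨a, b, d, ⟨ha, hb⟩, hp, hq⟩)
    · simpa using h₁ a.p a.q a.one_le a.lt a.le
    · have : t a.p a.q * t b.p b.q = t b.p b.q * t a.p a.q := by
        rcases h with h | h
        · exact h₂ _ _ _ _ a.one_le a.lt h b.lt b.le
        · exact (h₂ _ _ _ _ b.one_le b.lt h a.lt a.le).symm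
      simp only [map_mul, map_inv, FreeGroup.lift_apply_of, this]
      group
    · have h := h₃ a.p a.q b.p b.q a.one_le ha b.lt hb a.le
      have e₁ : a.p + a.q - b.q = d.p := by
        have := b.lt; rw [hp, reverse, if_pos ⟨by omega, by omega⟩]
      have e₂ : a.p + a.q - b.p = d.q := by
        have := b.lt; rw [hq, reverse, if_pos ⟨by omega, by omega⟩]
      rw [e₁, e₂] at h
      simp only [map_mul, map_inv, FreeGroup.lift_apply_of, h]
      group)

theorem lift_s {n : ℕ} {H : Type*} [Group H] (t : ℕ → ℕ → H) (h₁) (h₂) (h₃) {p q : ℕ}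
    (hp : 1 ≤ p) (hpq : p < q) (hq : q ≤ n) : lift (n := n) t h₁ h₂ h₃ (s n p q) = t p q := by
  rw [s, dif_pos ⟨hp, hpq, hq⟩, lift, PresentedGroup.toGroup.of]

theorem hom_ext {n : ℕ} {H : Type*} [Group H] {φ ψ : Cactus n →* H}
    (h : ∀ p q, 1 ≤ p → p < q → q ≤ n → φ (s n p q) = ψ (s n p q)) : φ = ψ := by
  ext a
  rw [← s_gen]
  exact h _ _ a.one_le a.lt a.le

theorem intertwine {n : ℕ} {H : Type*} [Group H] {φ ψ : Cactus n →* H} {x : H}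
    (h : ∀ p q, 1 ≤ p → p < q → q ≤ n → x * φ (s n p q) = ψ (s n p q) * x) (f : Cactus n) :
    x * φ f = ψ f * x := by
  have : (MulAut.conj x).toMonoidHom.comp φ = ψ := hom_ext fun p q h₁ h₂ h₃ => by
    simp [h p q h₁ h₂ h₃]
  have := DFunLike.congr_fun this f
  simp only [MonoidHom.comp_apply, MulEquiv.coe_toMonoidHom, MulAut.conj_apply] at this
  exact mul_inv_eq_iff_eq_mul.1 this

theorem mem_of_s {n : ℕ} (H : Subgroup (Cactus n))
    (h : ∀ p q, 1 ≤ p → p < q → q ≤ n → s n p q ∈ H) (f : Cactus n) : f ∈ H :=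
  PresentedGroup.generated_by _ H (fun a => s_gen a ▸ h _ _ a.one_le a.lt a.le) f

/-- The permutation `ŝ_{p,q}` of `{1, …, n}`; the element `i : Fin n` stands for `i + 1`. -/
def sHat (n p q : ℕ) : Equiv.Perm (Fin n) :=
  if h : 1 ≤ p ∧ q ≤ n then
    Function.Involutive.toPerm
      (fun i => ⟨reverse p q (i + 1) - 1, by have := i.2; unfold reverse; split_ifs <;> omega⟩)
      (fun i => by ext; simp only [reverse]; split_ifs <;> omega)
  else 1

theorem sHat_val {n p q : ℕ} (hp : 1 ≤ p) (hq : q ≤ n) (i : Fin n) :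
    (sHat n p q i : ℕ) = reverse p q (i + 1) - 1 := by
  rw [sHat, dif_pos ⟨hp, hq⟩]; rfl

/-- The homomorphism `J_n → Σ_n` sending `s_{p,q}` to `ŝ_{p,q}`. -/
def π (n : ℕ) : Cactus n →* Equiv.Perm (Fin n) :=
  lift (sHat n)
    (fun p q hp hpq hq => by
      ext i
      simp only [Equiv.Perm.mul_apply, sHat_val hp hq, Equiv.Perm.one_apply, reverse]
      split_ifs <;> omega)
    (fun p q k l hp hpq hqk hkl hl => by
      ext i
      simp only [Equiv.Perm.mul_apply, sHat_val hp (show q ≤ n by omega),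
        sHat_val (show 1 ≤ k by omega) hl, reverse]
      split_ifs <;> omega)
    (fun p q k l hp hpk hkl hlq hq => by
      ext i
      simp only [Equiv.Perm.mul_apply, sHat_val hp hq,
        sHat_val (show 1 ≤ k by omega) (show l ≤ n by omega),
        sHat_val (show 1 ≤ p + q - l by omega) (show p + q - k ≤ n by omega), reverse]
      split_ifs <;> omega)

theorem π_s_val {n p q : ℕ} (hp : 1 ≤ p) (hq : q ≤ n) (i : Fin n) :
    (π n (s n p q) i : ℕ) = reverse p q (i + 1) - 1 := by
  by_cases h : p < q
  · rw [π, lift_s _ _ _ _ hp h hq, sHat_val hp hq]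
  · rw [s_of_ge (by omega), map_one, Equiv.Perm.one_apply, reverse]
    split_ifs <;> omega

/-- The homomorphism `J_m → J_n` sending `s_{p,q}` to `s_{p+r,q+r}`, for `r + m ≤ n`. -/
def shift (r : ℕ) {m n : ℕ} (h : r + m ≤ n) : Cactus m →* Cactus n :=
  lift (fun p q => s n (p + r) (q + r))
    (fun p q _ _ _ => s_mul_self _ _ _)
    (fun p q k l _ _ _ _ _ => s_comm (by omega))
    (fun p q k l hp hk hkl hl hq => by
      rw [s_contains (by omega) (by omega) (by omega) (by omega)]
      congr 2 <;> omega)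

theorem shift_s (r : ℕ) {m n : ℕ} (h : r + m ≤ n) {p q : ℕ} (hp : 1 ≤ p) (hq : q ≤ m) :
    shift r h (s m p q) = s n (p + r) (q + r) := by
  by_cases hpq : p < q
  · rw [shift, lift_s _ _ _ _ hp hpq hq]
  · rw [s_of_ge (by omega), s_of_ge (by omega), map_one]

theorem shift_comm {r r' m m' n : ℕ} (h : r + m ≤ n) (h' : r' + m' ≤ n) (hr : r + m ≤ r')
    (f : Cactus m) (g : Cactus m') : shift r h f * shift r' h' g = shift r' h' g * shift r h f := by
  refine intertwine (fun p q hp hpq hq => (intertwine (fun k l hk hkl hl => ?_) f).symm) g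
  rw [shift_s _ _ hp hq, shift_s _ _ hk hl]
  exact s_comm (by omega)

theorem shift_shift {r r' m n p : ℕ} (h : r + m ≤ n) (h' : r' + n ≤ p) (f : Cactus m) :
    shift r' h' (shift r h f) = shift (r + r') (by omega) f := by
  have : (shift r' h').comp (shift r h) = shift (r + r') (by omega) :=
    hom_ext fun k l hk hkl hl => by
      rw [MonoidHom.comp_apply, shift_s _ _ hk hl, shift_s _ _ (by omega) (by omega),
        shift_s _ _ hk hl, Nat.add_assoc, Nat.add_assoc]
  exact DFunLike.congr_fun this f

theorem shift_zero {n : ℕ} (h : 0 + n ≤ n) (f : Cactus n) : shift 0 h f = f := by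
  have : shift 0 h = MonoidHom.id _ := hom_ext fun k l hk hkl hl => shift_s _ _ hk hl
  exact DFunLike.congr_fun this f

theorem gcast_s {m n : ℕ} (h : m = n) (p q : ℕ) : gcast h (s m p q) = s n p q := by
  subst h; rfl

theorem gcast_shift {r k m n : ℕ} (h : m = n) (hm : r + k ≤ m) (f : Cactus k) :
    gcast h (shift r hm f) = shift r (h ▸ hm) f := by
  subst h; rfl

theorem shift_congr {r r' m n : ℕ} (e : r = r') (h : r + m ≤ n) (f : Cactus m) :
    shift r h f = shift r' (e ▸ h) f := by subst e; rfl

theorem π_shift_of_lt {r m n : ℕ} (h : r + m ≤ n) (f : Cactus m) (i : Fin n) (hi : (i : ℕ) < r) :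
    π n (shift r h f) i = i := by
  refine mem_of_s ((MulAction.stabilizer (Equiv.Perm (Fin n)) i).comap
    ((π n).comp (shift r h))) (fun p q hp hpq hq => ?_) f
  ext
  rw [MonoidHom.comp_apply, shift_s r h hp hq, Equiv.Perm.smul_def,
    π_s_val (by omega) (by omega), reverse]
  split_ifs <;> omega

theorem π_shift_of_ge {r m n : ℕ} (h : r + m ≤ n) (f : Cactus m) (i : Fin n)
    (hi : r + m ≤ (i : ℕ)) : π n (shift r h f) i = i := by
  refine mem_of_s ((MulAction.stabilizer (Equiv.Perm (Fin n)) i).comap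
    ((π n).comp (shift r h))) (fun p q hp hpq hq => ?_) f
  ext
  rw [MonoidHom.comp_apply, shift_s r h hp hq, Equiv.Perm.smul_def,
    π_s_val (by omega) (by omega), reverse]
  split_ifs <;> omega

theorem π_shift {r m n : ℕ} (h : r + m ≤ n) (f : Cactus m) (i : Fin m) (i' : Fin n)
    (hi : (i' : ℕ) = r + i) : (π n (shift r h f) i' : ℕ) = r + π m f i := by
  let H : Subgroup (Cactus m) :=
    { carrier := {f | ∀ (i : Fin m) (i' : Fin n), (i' : ℕ) = r + i →
        (π n (shift r h f) i' : ℕ) = r + π m f i}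
      one_mem' := fun i i' hi => by simpa using hi
      mul_mem' := fun {a b} ha hb i i' hi => by
        simp only [map_mul, Equiv.Perm.mul_apply]
        exact ha _ _ (hb _ _ hi)
      inv_mem' := fun {a} ha i i' hi => by
        have h₁ := ha ((π m a)⁻¹ i) ⟨r + (π m a)⁻¹ i, by omega⟩ rfl
        rw [show π m a ((π m a)⁻¹ i) = i from (π m a).apply_symm_apply i, ← hi] at h₁
        have h₂ := (Equiv.Perm.inv_eq_iff_eq (f := π n (shift r h a))).2 (Fin.ext h₁).symm
        rw [map_inv, map_inv, map_inv, h₂] }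
  refine mem_of_s H (fun p q hp hpq hq i i' hi => ?_) f i i' hi
  have := i.2
  have := i'.2
  rw [shift_s r h hp hq, π_s_val (by omega) (by omega), π_s_val hp hq]
  simp only [reverse]
  split_ifs <;> omega

/-- The block sum `β : J_m × J_n → J_{m+n}`. -/
def β {m n : ℕ} (f : Cactus m) (g : Cactus n) : Cactus (m + n) :=
  shift 0 (show 0 + m ≤ m + n by omega) f * shift m le_rfl g

/-- The commutor `s_{1,m+n} s_{1,m} s_{m+1,m+n}` of `BJ`. -/
def c (m n : ℕ) : Cactus (m + n) :=
  s (m + n) 1 (m + n) * s (m + n) 1 m * s (m + n) (m + 1) (m + n)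

theorem c_mul_shift_left {m n : ℕ} (f : Cactus m) :
    c m n * shift 0 (show 0 + m ≤ m + n by omega) f =
      shift n (show n + m ≤ m + n by omega) f * c m n := by
  refine intertwine (fun p q hp hpq hq => ?_) f
  rw [shift_s _ _ hp hq, shift_s _ _ hp hq, c, mul_assoc, s_comm (p := m + 1) (by omega),
    ← mul_assoc, mul_assoc (s (m + n) 1 (m + n)),
    s_contains (p := 1) (q := m) (by omega) (by omega) (by omega) (by omega), ← mul_assoc,
    s_contains (p := 1) (q := m + n) (by omega) (by omega) (by omega) (by omega)]
  simp only [mul_assoc]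
  congr 2 <;> omega

theorem c_mul_shift_right {m n : ℕ} (g : Cactus n) :
    c m n * shift m le_rfl g =
      shift 0 (show 0 + n ≤ m + n by omega) g * c m n := by
  refine intertwine (fun p q hp hpq hq => ?_) g
  rw [shift_s _ _ hp hq, shift_s _ _ hp hq, c, mul_assoc,
    s_contains (p := m + 1) (q := m + n) (by omega) (by omega) (by omega) (by omega),
    ← mul_assoc, mul_assoc (s (m + n) 1 (m + n)),
    s_comm (p := 1) (q := m) (by omega), ← mul_assoc,
    s_contains (p := 1) (q := m + n) (by omega) (by omega) (by omega) (by omega)]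
  simp only [mul_assoc]
  congr 2 <;> omega

theorem π_c_val (m n : ℕ) (i : Fin (m + n)) :
    (π (m + n) (c m n) i : ℕ) = if (i : ℕ) < m then n + i else i - m := by
  have hi := i.2
  simp only [c, map_mul, Equiv.Perm.mul_apply]
  rw [π_s_val (by omega) (by omega), π_s_val (by omega) (by omega), π_s_val (by omega) (by omega)]
  simp only [reverse]
  split_ifs <;> omega

theorem gcast_c {m n N : ℕ} (h : m + n = N) : gcast h (c m n) =
    s N 1 N * s N 1 m * s N (m + 1) N := by
  subst h; rfl

/-- The cactus groups, with `β` and the commutor elements `s_{1,m+n} s_{1,m} s_{m+1,m+n}`. -/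
instance : CoboundaryGroups π where
  β := β
  c := c
  β_one_one m n := by simp [β]
  β_mul {m n} f f' g g' := by
    simp only [β, map_mul, mul_assoc]
    congr 1
    rw [← mul_assoc, ← mul_assoc, shift_comm (r := 0) (r' := m) _ _ (Nat.zero_add m).le f' g]
  β_assoc {m n p} f g h := by
    simp only [β, map_mul, gcast_shift, shift_shift, mul_assoc]
    rw [shift_congr (Nat.zero_add m) _ g, shift_congr (Nat.add_comm n m) _ h]
    rfl
  one_β g := by
    simp only [β, map_one, one_mul, gcast_shift, shift_zero]
  β_one g := by
    simp only [β, map_one, mul_one, shift_zero, gcast_rfl]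
  π_β_left {m n} f g i := by
    ext
    rw [β, map_mul, Equiv.Perm.mul_apply, π_shift_of_lt _ g _ (by simp),
      π_shift _ f i _ (by simp)]
    simp
  π_β_right {m n} f g j := by
    ext
    rw [β, shift_comm (r := 0) (r' := m) _ _ (Nat.zero_add m).le, map_mul,
      Equiv.Perm.mul_apply, π_shift_of_ge _ f _ (by simp), π_shift _ g j _ (by simp)]
    simp
  π_c_left m n i := by
    ext; rw [π_c_val]; simp [Nat.add_comm]
  π_c_right m n j := by
    ext; rw [π_c_val]; simp
  c_natural {m n} f g := by
    simp only [β, map_mul, gcast_shift]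
    rw [← mul_assoc, c_mul_shift_left, mul_assoc, c_mul_shift_right, ← mul_assoc,
      shift_comm (r := 0) (r' := n) _ _ (Nat.zero_add n).le]
  c_symm m n := by
    have h₁ := s_contains (n := m + n) (p := 1) (q := m + n) (k := 1) (l := m)
      le_rfl le_rfl le_rfl (by omega)
    have h₂ := s_contains (n := m + n) (p := 1) (q := m + n) (k := m + 1) (l := m + n)
      le_rfl le_rfl (by omega) le_rfl
    rw [show 1 + (m + n) - m = n + 1 by omega, show 1 + (m + n) - 1 = m + n by omega] at h₁
    rw [show 1 + (m + n) - (m + n) = 1 by omega, show 1 + (m + n) - (m + 1) = n by omega] at h₂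
    rw [gcast_c, c, mul_assoc (s _ 1 (m + n) * s _ 1 n), ← mul_assoc (s _ (n + 1) _),
      ← mul_assoc (s _ (n + 1) _), ← h₁, mul_assoc (s _ 1 (m + n)) (s _ 1 m), s_mul_self, mul_one,
      h₂]
    simp only [mul_assoc, s_mul_s_cancel, s_mul_self]
  c_cactus m n p := by
    rw [gcast_c, gcast_c]
    simp only [β, map_one, one_mul, mul_one, gcast_shift]
    have e₁ : ∀ (N : ℕ) (h : m + (n + p) ≤ N), shift m h (c n p) =
        s N (m + 1) (m + n + p) * s N (m + 1) (m + n) * s N (m + n + 1) (m + n + p) := by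
      intro N h
      simp only [c, map_mul]
      rw [shift_s _ _ le_rfl le_rfl, shift_s _ _ le_rfl (by omega), shift_s _ _ (by omega) le_rfl,
        show 1 + m = m + 1 by omega, show n + p + m = m + n + p by omega,
        show n + m = m + n by omega, show n + 1 + m = m + n + 1 by omega]
    have e₂ : shift 0 (show 0 + (m + n) ≤ m + n + p by omega) (c m n) =
        s _ 1 (m + n) * s _ 1 m * s _ (m + 1) (m + n) := by
      simp only [c, map_mul]
      rw [shift_s _ _ le_rfl le_rfl, shift_s _ _ le_rfl (by omega), shift_s _ _ (by omega) le_rfl]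
      rfl
    rw [e₁, e₂, show n + m = m + n by omega]
    simp only [mul_assoc, s_mul_s_cancel]
    rw [← mul_assoc (s _ (m + n + 1) _) (s _ 1 (m + n)), s_comm (p := m + n + 1) (k := 1) (by omega),
      mul_assoc (s _ 1 (m + n)), s_mul_s_cancel, s_comm (p := m + 1) (by omega),
      ← mul_assoc (s _ 1 m), s_comm (p := 1) (k := m + n + 1) (by omega), mul_assoc]
  c_zero := by simp [c, s_of_not]

end Cactus

/-! ### The construction `EΛ` -/

universe v u v' u'

/-- The objects of `EΛ(X)`: the class `[e; x₁, …, xₙ]` is represented by the string `x₁, …, xₙ`. -/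
structure EObj {Λ : ℕ → Type} [∀ n, Group (Λ n)] (π : ∀ n, Λ n →* Equiv.Perm (Fin n))
    (X : Type u) where
  n : ℕ
  x : Fin n → X

namespace EObj

variable {Λ : ℕ → Type} [∀ n, Group (Λ n)] {π : ∀ n, Λ n →* Equiv.Perm (Fin n)}

section Cat

variable {X : Type u}

theorem ext_obj {a b : EObj π X} (h : a.n = b.n) (hx : ∀ i, a.x i = b.x (Fin.cast h i)) :
    a = b := by
  obtain ⟨n, x⟩ := a
  obtain ⟨m, y⟩ := b
  obtain rfl : n = m := h
  congr 1
  funext i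
  exact hx i

/-- The tensor product of objects is concatenation of strings. -/
abbrev tensor (a b : EObj π X) : EObj π X := ⟨a.n + b.n, Fin.append a.x b.x⟩

theorem tensor_assoc (a b d : EObj π X) : tensor (tensor a b) d = tensor a (tensor b d) :=
  ext_obj (Nat.add_assoc _ _ _) fun i => by
    simp only [tensor, Fin.append_assoc]; rfl

theorem unit_tensor (a : EObj π X) : tensor ⟨0, Fin.elim0⟩ a = a :=
  ext_obj (Nat.zero_add _) fun i => by
    simp only [Fin.elim0_append]; rfl

theorem tensor_unit (a : EObj π X) : tensor a ⟨0, Fin.elim0⟩ = a :=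
  ext_obj (Nat.add_zero _) fun i => by
    simp only [Fin.append_elim0]; rfl

variable [Category.{v} X]

/-- A morphism from `x₁, …, xₙ` to `y₁, …, yₙ` is an element `g ∈ Λ(n)` together with morphisms
`xᵢ ⟶ y_{π(g)(i)}` of `X`; there are no morphisms between strings of different lengths. -/
structure Hom (a b : EObj π X) where
  len : a.n = b.n
  g : Λ a.n
  f : ∀ i : Fin a.n, a.x i ⟶ b.x (Fin.cast len (π a.n g i))

/-- The component `xᵢ ⟶ yⱼ` of a morphism, for `j = π(g)(i)`. -/
def Hom.at {a b : EObj π X} (F : Hom a b) (i : Fin a.n) (j : Fin b.n)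
    (h : Fin.cast F.len (π a.n F.g i) = j) : a.x i ⟶ b.x j :=
  F.f i ≫ eqToHom (by rw [h])

theorem Hom.ext_at {a b : EObj π X} {F F' : Hom a b} (hg : F.g = F'.g)
    (hf : ∀ i j h h', F.at i j h = F'.at i j h') : F = F' := by
  obtain ⟨len, g, f⟩ := F
  obtain ⟨len', g', f'⟩ := F'
  obtain rfl : g = g' := hg
  congr 1
  funext i
  simpa [Hom.at] using hf i _ rfl rfl

/-- The identity morphism. -/
def Hom.id (a : EObj π X) : Hom a a := ⟨rfl, 1, fun i => eqToHom (by simp)⟩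

/-- Composition: `(g'; f') ∘ (g; f) = (g'g; f'_{π(g)(i)} ∘ f_i)`. -/
def Hom.comp {a b d : EObj π X} (F : Hom a b) (F' : Hom b d) : Hom a d where
  len := F.len.trans F'.len
  g := gcast F.len.symm F'.g * F.g
  f i := F.f i ≫ F'.f _ ≫ eqToHom (by
    rw [map_mul, Equiv.Perm.mul_apply, gcast_perm_apply]; rfl)

theorem Hom.id_at (a : EObj π X) (i : Fin a.n) (h) : (Hom.id a).at i i h = 𝟙 (a.x i) := by
  simp only [Hom.id, Hom.at]
  erw [eqToHom_trans, eqToHom_refl]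

theorem Hom.comp_at {a b d : EObj π X} (F : Hom a b) (F' : Hom b d) (i : Fin a.n) (j : Fin b.n)
    (k : Fin d.n) (h₁ : Fin.cast F.len (π a.n F.g i) = j)
    (h₂ : Fin.cast F'.len (π b.n F'.g j) = k) (h) :
    (F.comp F').at i k h = F.at i j h₁ ≫ F'.at j k h₂ := by
  subst h₁; subst h₂
  simp only [Hom.comp, Hom.at, Category.assoc, eqToHom_refl, Category.comp_id]
  erw [eqToHom_trans, eqToHom_refl, Category.comp_id]

theorem Hom.comp_index {a b d : EObj π X} (F : Hom a b) (F' : Hom b d) (i : Fin a.n) :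
    Fin.cast (F.comp F').len (π a.n (F.comp F').g i) =
      Fin.cast F'.len (π b.n F'.g (Fin.cast F.len (π a.n F.g i))) := by
  simp only [Hom.comp, map_mul, Equiv.Perm.mul_apply, gcast_perm_apply]
  rfl

theorem Hom.at_congr {a b : EObj π X} {F F' : Hom a b} (e : F = F') (i j h) :
    F.at i j h = F'.at i j (e ▸ h) := by subst e; rfl

instance : Category (EObj π X) where
  Hom := Hom
  id := Hom.id
  comp := Hom.comp
  id_comp {a b} F := by
    refine Hom.ext_at (by simp [Hom.comp, Hom.id]) fun i j h h' => ?_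
    rw [Hom.comp_at _ _ i i j (by simp [Hom.id]) h', Hom.id_at, Category.id_comp]
  comp_id {a b} F := by
    refine Hom.ext_at (by simp [Hom.comp, Hom.id]) fun i j h h' => ?_
    rw [Hom.comp_at _ _ i j j h' (by simp [Hom.id]), Hom.id_at, Category.comp_id]
  assoc {a b d e} F F' F'' := by
    refine Hom.ext_at (by simp [Hom.comp, mul_assoc]) fun i l h h' => ?_
    have h₁ := Hom.comp_index F F' i
    have h₂ := Hom.comp_index F' F'' (Fin.cast F.len (π a.n F.g i))
    have h₃ := Hom.comp_index (F.comp F') F'' i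
    rw [h₁] at h₃
    have h₄ := h₃.symm.trans h
    rw [Hom.comp_at (F.comp F') F'' i _ l h₁ h₄, Hom.comp_at F F' i _ _ rfl rfl,
      Hom.comp_at F (F'.comp F'') i _ l rfl (h₂.trans h₄), Hom.comp_at F' F'' _ _ l rfl h₄,
      Category.assoc]

theorem Hom.ext_at' {a b : EObj π X} {F F' : a ⟶ b} (hg : Hom.g F = Hom.g F')
    (hf : ∀ i, ∃ j h h', Hom.at F i j h = Hom.at F' i j h') : F = F' := by
  refine Hom.ext_at hg fun i j h h' => ?_
  obtain ⟨j', h₁, h₂, e⟩ := hf i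
  obtain rfl : j = j' := h.symm.trans h₁
  exact e

@[simp] theorem id_g (a : EObj π X) : Hom.g (𝟙 a) = 1 := rfl

@[simp] theorem comp_g {a b d : EObj π X} (F : a ⟶ b) (F' : b ⟶ d) :
    Hom.g (F ≫ F') = gcast (Hom.len F).symm (Hom.g F') * Hom.g F := rfl

@[simp] theorem eqToHom_g {a b : EObj π X} (h : a = b) : Hom.g (eqToHom h) = 1 := by
  subst h; rfl

theorem id_at (a : EObj π X) (i j : Fin a.n) (h : i = j) :
    Hom.at (𝟙 a) i j (by subst h; exact congrArg (fun σ => σ i) (map_one (π a.n))) =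
      eqToHom (by rw [h]) := by
  subst h; exact Hom.id_at a i _

theorem comp_at {a b d : EObj π X} (F : a ⟶ b) (F' : b ⟶ d) (i : Fin a.n) (j : Fin b.n)
    (k : Fin d.n) (h₁ : Fin.cast (Hom.len F) (π a.n (Hom.g F) i) = j)
    (h₂ : Fin.cast (Hom.len F') (π b.n (Hom.g F') j) = k) (h) :
    Hom.at (F ≫ F') i k h = Hom.at F i j h₁ ≫ Hom.at F' j k h₂ :=
  Hom.comp_at F F' i j k h₁ h₂ h

theorem comp_index {a b d : EObj π X} (F : a ⟶ b) (F' : b ⟶ d) {i : Fin a.n} {j : Fin b.n}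
    {k : Fin d.n} (h₁ : Fin.cast (Hom.len F) (π a.n (Hom.g F) i) = j)
    (h₂ : Fin.cast (Hom.len F') (π b.n (Hom.g F') j) = k) :
    Fin.cast (Hom.len (F ≫ F')) (π a.n (Hom.g (F ≫ F')) i) = k := by
  subst h₁; subst h₂; exact Hom.comp_index F F' i

theorem eqToHom_at {a b : EObj π X} (e : a = b) (i : Fin a.n) (j : Fin b.n)
    (h : (i : ℕ) = j) : ∃ h₁ h₂, Hom.at (eqToHom e) i j h₁ = eqToHom h₂ := by
  subst e
  obtain rfl : i = j := Fin.ext h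
  exact ⟨_, rfl, id_at a i i rfl⟩

/-- `F.Comp i j φ` says that `F` has component `φ : xᵢ ⟶ yⱼ`. -/
def Hom.Comp {a b : EObj π X} (F : a ⟶ b) (i : Fin a.n) (j : Fin b.n) (φ : a.x i ⟶ b.x j) : Prop :=
  ∃ h, Hom.at F i j h = φ

theorem hom_ext {a b : EObj π X} {F F' : a ⟶ b} (hg : Hom.g F = Hom.g F')
    (hf : ∀ i, ∃ j φ, Hom.Comp F i j φ ∧ Hom.Comp F' i j φ) : F = F' :=
  Hom.ext_at' hg fun i => by
    obtain ⟨j, φ, ⟨h, e⟩, ⟨h', e'⟩⟩ := hf i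
    exact ⟨j, h, h', e.trans e'.symm⟩

theorem comp_self {a b : EObj π X} (F : a ⟶ b) (i : Fin a.n) : ∃ j φ, Hom.Comp F i j φ :=
  ⟨_, _, rfl, rfl⟩

theorem Hom.Comp.comp {a b d : EObj π X} {F : a ⟶ b} {F' : b ⟶ d} {i j k φ ψ}
    (h : Hom.Comp F i j φ) (h' : Hom.Comp F' j k ψ) : Hom.Comp (F ≫ F') i k (φ ≫ ψ) := by
  obtain ⟨h, rfl⟩ := h
  obtain ⟨h', rfl⟩ := h'
  exact ⟨EObj.comp_index F F' h h', EObj.comp_at F F' i j k h h' _⟩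

theorem comp_id' (a : EObj π X) (i : Fin a.n) : Hom.Comp (𝟙 a) i i (𝟙 _) :=
  ⟨_, id_at a i i rfl⟩

theorem comp_eqToHom {a b : EObj π X} (e : a = b) (i : Fin a.n) (j : Fin b.n)
    (h : (i : ℕ) = j) : ∃ h', Hom.Comp (eqToHom e) i j (eqToHom h') := by
  obtain ⟨h₁, h₂, h₃⟩ := eqToHom_at e i j h
  exact ⟨h₂, h₁, h₃⟩

theorem Hom.Comp.congr {a b : EObj π X} {F : a ⟶ b} {i j φ ψ} (h : Hom.Comp F i j φ)
    (e : φ = ψ) : Hom.Comp F i j ψ := e ▸ h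

variable [G : CoboundaryGroups π]

theorem tensor_index_left {a b a' b' : EObj π X} (F : a ⟶ b) (F' : a' ⟶ b')
    (h : a.n + a'.n = b.n + b'.n) (i : Fin a.n) :
    Fin.cast h (π _ (G.β (Hom.g F) (Hom.g F')) (Fin.castAdd a'.n i)) =
      Fin.castAdd b'.n (Fin.cast (Hom.len F) (π a.n (Hom.g F) i)) := by
  rw [G.π_β_left]; rfl

theorem tensor_index_right {a b a' b' : EObj π X} (F : a ⟶ b) (F' : a' ⟶ b')
    (h : a.n + a'.n = b.n + b'.n) (i : Fin a'.n) :
    Fin.cast h (π _ (G.β (Hom.g F) (Hom.g F')) (Fin.natAdd a.n i)) =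
      Fin.natAdd b.n (Fin.cast (Hom.len F') (π a'.n (Hom.g F') i)) := by
  rw [G.π_β_right]; ext; simp [Hom.len F]

/-- The tensor product of morphisms is given by the block sum in the groups. -/
def tensorMap {a b a' b' : EObj π X} (F : a ⟶ b) (F' : a' ⟶ b') : tensor a a' ⟶ tensor b b' :=
  have len : a.n + a'.n = b.n + b'.n := congrArg₂ (· + ·) (Hom.len F) (Hom.len F')
  { len := len
    g := G.β (Hom.g F) (Hom.g F')
    f := Fin.addCases
      (motive := fun i => Fin.append a.x a'.x i ⟶
        Fin.append b.x b'.x (Fin.cast len (π _ (G.β (Hom.g F) (Hom.g F')) i)))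
      (fun i => eqToHom (Fin.append_left a.x a'.x i) ≫ Hom.f F i ≫ eqToHom (by
        rw [tensor_index_left, Fin.append_left]))
      (fun i => eqToHom (Fin.append_right a.x a'.x i) ≫ Hom.f F' i ≫ eqToHom (by
        rw [tensor_index_right, Fin.append_right])) : Hom _ _ }

@[simp] theorem tensorMap_g {a b a' b' : EObj π X} (F : a ⟶ b) (F' : a' ⟶ b') :
    Hom.g (tensorMap F F') = G.β (Hom.g F) (Hom.g F') := rfl

theorem tensorMap_at_left {a b a' b' : EObj π X} (F : a ⟶ b) (F' : a' ⟶ b') (i : Fin a.n)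
    (j : Fin b.n) (h : Fin.cast (Hom.len F) (π a.n (Hom.g F) i) = j) :
    ∃ h', Hom.at (tensorMap F F') (Fin.castAdd a'.n i) (Fin.castAdd b'.n j) h' =
      eqToHom (Fin.append_left a.x a'.x i) ≫ Hom.at F i j h ≫
        eqToHom (Fin.append_left b.x b'.x j).symm := by
  subst h
  refine ⟨tensor_index_left F F' _ i, ?_⟩
  simp only [Hom.at, tensorMap, eqToHom_refl, Category.comp_id]
  erw [Fin.addCases_left, Category.assoc, Category.assoc]
  exact congrArg (fun t => _ ≫ Hom.f F i ≫ t) (eqToHom_trans _ _)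

theorem tensorMap_at_right {a b a' b' : EObj π X} (F : a ⟶ b) (F' : a' ⟶ b') (i : Fin a'.n)
    (j : Fin b'.n) (h : Fin.cast (Hom.len F') (π a'.n (Hom.g F') i) = j) :
    ∃ h', Hom.at (tensorMap F F') (Fin.natAdd a.n i) (Fin.natAdd b.n j) h' =
      eqToHom (Fin.append_right a.x a'.x i) ≫ Hom.at F' i j h ≫
        eqToHom (Fin.append_right b.x b'.x j).symm := by
  subst h
  refine ⟨tensor_index_right F F' _ i, ?_⟩
  simp only [Hom.at, tensorMap, eqToHom_refl, Category.comp_id]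
  erw [Fin.addCases_right, Category.assoc, Category.assoc]
  exact congrArg (fun t => _ ≫ Hom.f F' i ≫ t) (eqToHom_trans _ _)

/-- The commutor is the element `c m n` of the group together with identities. -/
def swap (a b : EObj π X) : tensor a b ⟶ tensor b a :=
  { len := Nat.add_comm a.n b.n
    g := G.c a.n b.n
    f := Fin.addCases
      (motive := fun i => Fin.append a.x b.x i ⟶
        Fin.append b.x a.x (Fin.cast (Nat.add_comm a.n b.n) (π _ (G.c a.n b.n) i)))
      (fun i => eqToHom (by
        rw [G.π_c_left, Fin.append_left]; exact (Fin.append_right b.x a.x i).symm))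
      (fun i => eqToHom (by
        rw [G.π_c_right, Fin.append_right]; exact (Fin.append_left b.x a.x i).symm)) : Hom _ _ }

@[simp] theorem swap_g (a b : EObj π X) : Hom.g (swap a b) = G.c a.n b.n := rfl

theorem swap_at_left (a b : EObj π X) (i : Fin a.n) :
    ∃ h h', Hom.at (swap a b) (Fin.castAdd b.n i) (Fin.natAdd b.n i) h = eqToHom h' := by
  refine ⟨by show Fin.cast _ (π _ (G.c a.n b.n) (Fin.castAdd b.n i)) = _; rw [G.π_c_left]; rfl,
    by simp, ?_⟩
  simp only [Hom.at, swap]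
  erw [Fin.addCases_left, eqToHom_trans]

theorem swap_at_right (a b : EObj π X) (i : Fin b.n) :
    ∃ h h', Hom.at (swap a b) (Fin.natAdd a.n i) (Fin.castAdd a.n i) h = eqToHom h' := by
  refine ⟨by show Fin.cast _ (π _ (G.c a.n b.n) (Fin.natAdd a.n i)) = _; rw [G.π_c_right]; rfl,
    by simp, ?_⟩
  simp only [Hom.at, swap]
  erw [Fin.addCases_right, eqToHom_trans]

instance : MonoidalCategoryStruct (EObj π X) where
  tensorObj := tensor
  tensorHom := tensorMap
  whiskerLeft a _ _ F := tensorMap (𝟙 a) F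
  whiskerRight F b := tensorMap F (𝟙 b)
  tensorUnit := ⟨0, Fin.elim0⟩
  associator a b d := eqToIso (tensor_assoc a b d)
  leftUnitor a := eqToIso (unit_tensor a)
  rightUnitor a := eqToIso (tensor_unit a)

theorem Hom.Comp.tensor_left {a b a' b' : EObj π X} {F : a ⟶ b} (F' : a' ⟶ b') {i j φ}
    (h : Hom.Comp F i j φ) : Hom.Comp (tensorMap F F') (Fin.castAdd _ i) (Fin.castAdd _ j)
      (eqToHom (Fin.append_left a.x a'.x i) ≫ φ ≫ eqToHom (Fin.append_left b.x b'.x j).symm) := by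
  obtain ⟨h, rfl⟩ := h
  exact tensorMap_at_left F F' i j h

theorem Hom.Comp.tensor_right {a b a' b' : EObj π X} (F : a ⟶ b) {F' : a' ⟶ b'} {i j φ}
    (h : Hom.Comp F' i j φ) : Hom.Comp (tensorMap F F') (Fin.natAdd _ i) (Fin.natAdd _ j)
      (eqToHom (Fin.append_right a.x a'.x i) ≫ φ ≫ eqToHom (Fin.append_right b.x b'.x j).symm) := by
  obtain ⟨h, rfl⟩ := h
  exact tensorMap_at_right F F' i j h

theorem swap_left (a b : EObj π X) (i : Fin a.n) :
    ∃ h, Hom.Comp (swap a b) (Fin.castAdd b.n i) (Fin.natAdd b.n i) (eqToHom h) := by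
  obtain ⟨h₁, h₂, h₃⟩ := swap_at_left a b i
  exact ⟨h₂, h₁, h₃⟩

theorem swap_right (a b : EObj π X) (i : Fin b.n) :
    ∃ h, Hom.Comp (swap a b) (Fin.natAdd a.n i) (Fin.castAdd a.n i) (eqToHom h) := by
  obtain ⟨h₁, h₂, h₃⟩ := swap_at_right a b i
  exact ⟨h₂, h₁, h₃⟩

theorem tensorMap_id (a b : EObj π X) : tensorMap (𝟙 a) (𝟙 b) = 𝟙 (tensor a b) := by
  refine hom_ext (G.β_one_one _ _) fun i => ?_
  induction i using Fin.addCases with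
  | left i =>
    exact ⟨_, _, (comp_id' a i).tensor_left (𝟙 b), (comp_id' _ _).congr (by simp)⟩
  | right i =>
    exact ⟨_, _, (comp_id' b i).tensor_right (𝟙 a), (comp_id' _ _).congr (by simp)⟩

theorem tensorMap_eqToHom {a a' b b' : EObj π X} (h : a = a') (h' : b = b') :
    tensorMap (eqToHom h) (eqToHom h') = eqToHom (by rw [h, h']) := by
  subst h; subst h'; exact tensorMap_id _ _

theorem β_gcast {m m' n n' : ℕ} (h : m = m') (h' : n = n') (f : Λ m) (g : Λ n) :
    G.β (gcast h f) (gcast h' g) = gcast (by rw [h, h']) (G.β f g) := by subst h; subst h'; rfl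

theorem c_gcast {m m' n n' : ℕ} (h : m = m') (h' : n = n') :
    G.c m' n' = gcast (by rw [h, h']) (G.c m n) := by subst h; subst h'; rfl

theorem swap_swap (a b : EObj π X) : swap a b ≫ swap b a = 𝟙 (tensor a b) := by
  refine hom_ext (G.c_symm _ _) fun i => ?_
  induction i using Fin.addCases with
  | left i =>
    obtain ⟨h₁, h₂⟩ := swap_left a b i
    obtain ⟨h₃, h₄⟩ := swap_right b a i
    exact ⟨_, _, h₂.comp h₄, (comp_id' _ _).congr (by simp)⟩
  | right i =>
    obtain ⟨h₁, h₂⟩ := swap_right a b i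
    obtain ⟨h₃, h₄⟩ := swap_left b a i
    exact ⟨_, _, h₂.comp h₄, (comp_id' _ _).congr (by simp)⟩

instance : MonoidalCategory (EObj π X) := .ofTensorHom
  (id_tensorHom_id := fun _ _ => tensorMap_id _ _)
  (id_tensorHom := fun _ _ _ _ => rfl)
  (tensorHom_id := fun _ _ => rfl)
  (tensorHom_comp_tensorHom := fun {a₁ b₁ d₁ a₂ b₂ d₂} F₁ F₂ F₁' F₂' => by
    refine hom_ext (F := tensorMap F₁ F₂ ≫ tensorMap F₁' F₂')
      (F' := tensorMap (F₁ ≫ F₁') (F₂ ≫ F₂')) (by simp [G.β_mul, β_gcast]) fun i => ?_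
    induction i using Fin.addCases (m := a₁.n) (n := a₂.n) with
    | left i =>
      obtain ⟨j, φ, h⟩ := comp_self F₁ i
      obtain ⟨k, ψ, h'⟩ := comp_self F₁' j
      exact ⟨_, _, (h.tensor_left F₂).comp (h'.tensor_left F₂'),
        ((h.comp h').tensor_left _).congr (by simp)⟩
    | right i =>
      obtain ⟨j, φ, h⟩ := comp_self F₂ i
      obtain ⟨k, ψ, h'⟩ := comp_self F₂' j
      exact ⟨_, _, (h.tensor_right F₁).comp (h'.tensor_right F₁'),
        ((h.comp h').tensor_right _).congr (by simp)⟩)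
  (associator_naturality := fun {a₁ a₂ a₃ b₁ b₂ b₃} F₁ F₂ F₃ => by
    refine hom_ext (F := tensorMap (tensorMap F₁ F₂) F₃ ≫ eqToHom (tensor_assoc b₁ b₂ b₃))
      (F' := eqToHom (tensor_assoc a₁ a₂ a₃) ≫ tensorMap F₁ (tensorMap F₂ F₃))
      (by simp [← G.β_assoc]) fun i => ?_
    induction i using Fin.addCases (m := a₁.n + a₂.n) (n := a₃.n) with
    | left i =>
      induction i using Fin.addCases (m := a₁.n) (n := a₂.n) with
      | left i =>
        obtain ⟨j, φ, h⟩ := comp_self F₁ i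
        obtain ⟨h₁, h₂⟩ := comp_eqToHom (tensor_assoc b₁ b₂ b₃)
          (Fin.castAdd _ (Fin.castAdd _ j)) (Fin.castAdd _ j) rfl
        obtain ⟨h₃, h₄⟩ := comp_eqToHom (tensor_assoc a₁ a₂ a₃)
          (Fin.castAdd _ (Fin.castAdd _ i)) (Fin.castAdd _ i) rfl
        exact ⟨_, _, ((h.tensor_left F₂).tensor_left F₃).comp h₂,
          (h₄.comp (h.tensor_left (tensorMap F₂ F₃))).congr (by simp)⟩
      | right i =>
        obtain ⟨j, φ, h⟩ := comp_self F₂ i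
        obtain ⟨h₁, h₂⟩ := comp_eqToHom (tensor_assoc b₁ b₂ b₃)
          (Fin.castAdd _ (Fin.natAdd _ j)) (Fin.natAdd _ (Fin.castAdd _ j)) rfl
        obtain ⟨h₃, h₄⟩ := comp_eqToHom (tensor_assoc a₁ a₂ a₃)
          (Fin.castAdd _ (Fin.natAdd _ i)) (Fin.natAdd _ (Fin.castAdd _ i)) rfl
        exact ⟨_, _, ((h.tensor_right F₁).tensor_left F₃).comp h₂,
          (h₄.comp ((h.tensor_left F₃).tensor_right F₁)).congr (by simp)⟩
    | right i =>
      obtain ⟨j, φ, h⟩ := comp_self F₃ i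
      obtain ⟨h₁, h₂⟩ := comp_eqToHom (tensor_assoc b₁ b₂ b₃)
        (Fin.natAdd _ j) (Fin.natAdd _ (Fin.natAdd _ j)) (Nat.add_assoc _ _ _)
      obtain ⟨h₃, h₄⟩ := comp_eqToHom (tensor_assoc a₁ a₂ a₃)
        (Fin.natAdd _ i) (Fin.natAdd _ (Fin.natAdd _ i)) (Nat.add_assoc _ _ _)
      exact ⟨_, _, (h.tensor_right (tensorMap F₁ F₂)).comp h₂,
        (h₄.comp ((h.tensor_right F₂).tensor_right F₁)).congr (by simp)⟩)
  (leftUnitor_naturality := fun {a b} F => by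
    refine hom_ext (F := tensorMap (𝟙 _) F ≫ eqToHom (unit_tensor b))
      (F' := eqToHom (unit_tensor a) ≫ F)
      (by simp; exact (eq_gcast_iff _).2 (G.one_β _)) fun i => ?_
    induction i using Fin.addCases (m := 0) (n := a.n) with
    | left i => exact i.elim0
    | right i =>
      obtain ⟨j, φ, h⟩ := comp_self F i
      obtain ⟨h₁, h₂⟩ := comp_eqToHom (unit_tensor b) (Fin.natAdd _ j) j (Nat.zero_add _)
      obtain ⟨h₃, h₄⟩ := comp_eqToHom (unit_tensor a) (Fin.natAdd _ i) i (Nat.zero_add _)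
      exact ⟨_, _, (h.tensor_right (𝟙 _)).comp h₂, (h₄.comp h).congr (by simp)⟩)
  (rightUnitor_naturality := fun {a b} F => by
    refine hom_ext (F := tensorMap F (𝟙 _) ≫ eqToHom (tensor_unit b))
      (F' := eqToHom (tensor_unit a) ≫ F) (by simp; exact G.β_one (Hom.g F)) fun i => ?_
    induction i using Fin.addCases (m := a.n) (n := 0) with
    | left i =>
      obtain ⟨j, φ, h⟩ := comp_self F i
      obtain ⟨h₁, h₂⟩ := comp_eqToHom (tensor_unit b) (Fin.castAdd _ j) j rfl
      obtain ⟨h₃, h₄⟩ := comp_eqToHom (tensor_unit a) (Fin.castAdd _ i) i rfl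
      exact ⟨_, _, (h.tensor_left (𝟙 _)).comp h₂, (h₄.comp h).congr (by simp)⟩
    | right i => exact i.elim0)
  (pentagon := fun a b d e => by
    exact (congrArg₂ (fun s t => s ≫ eqToHom (tensor_assoc a (tensor b d) e) ≫ t)
      (tensorMap_eqToHom (tensor_assoc a b d) (rfl : e = e))
      (tensorMap_eqToHom (rfl : a = a) (tensor_assoc b d e))).trans
        ((by simp only [eqToHom_trans]) :
          _ = eqToHom (tensor_assoc (tensor a b) d e) ≫ eqToHom (tensor_assoc a b (tensor d e))))
  (triangle := fun a b => by
    exact (congrArg (fun t => eqToHom (tensor_assoc a ⟨0, Fin.elim0⟩ b) ≫ t)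
      (tensorMap_eqToHom (rfl : a = a) (unit_tensor b))).trans
        ((eqToHom_trans _ _).trans (tensorMap_eqToHom (tensor_unit a) (rfl : b = b)).symm))

instance : StrictCoboundaryCategory (EObj π X) where
  tensor_assoc := tensor_assoc
  unit_tensor := unit_tensor
  tensor_unit := tensor_unit
  associator_hom a b d := rfl
  leftUnitor_hom a := rfl
  rightUnitor_hom a := rfl
  commutor a b :=
    { hom := swap a b
      inv := swap b a
      hom_inv_id := swap_swap a b
      inv_hom_id := swap_swap b a }
  commutor_naturality {a a' b b'} F F' := by
    refine hom_ext (F := tensorMap F F' ≫ swap a' b') (F' := swap a b ≫ tensorMap F' F)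
      (by
        simp only [comp_g, tensorMap_g, swap_g]
        rw [← G.c_natural, ← c_gcast (Hom.len F).symm (Hom.len F').symm]) fun i => ?_
    induction i using Fin.addCases (m := a.n) (n := b.n) with
    | left i =>
      obtain ⟨j, φ, h⟩ := comp_self F i
      obtain ⟨h₁, h₂⟩ := swap_left a' b' j
      obtain ⟨h₃, h₄⟩ := swap_left a b i
      exact ⟨_, _, (h.tensor_left F').comp h₂, (h₄.comp (h.tensor_right F')).congr (by simp)⟩
    | right i =>
      obtain ⟨j, φ, h⟩ := comp_self F' i
      obtain ⟨h₁, h₂⟩ := swap_right a' b' j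
      obtain ⟨h₃, h₄⟩ := swap_right a b i
      exact ⟨_, _, (h.tensor_right F).comp h₂, (h₄.comp (h.tensor_left F)).congr (by simp)⟩
  commutor_symmetry := swap_swap
  cactus a b d := by
    refine hom_ext (F := eqToHom (tensor_assoc a b d) ≫ tensorMap (𝟙 a) (swap b d) ≫
        swap a (tensor d b))
      (F' := tensorMap (swap a b) (𝟙 d) ≫ swap (tensor b a) d ≫
        eqToHom (tensor_assoc d b a).symm) ?_ fun i => ?_
    · simp only [comp_g, tensorMap_g, swap_g, eqToHom_g, id_g, map_one,
        map_mul, mul_one, one_mul, gcast_gcast]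
      exact G.c_cactus a.n b.n d.n
    · induction i using Fin.addCases (m := a.n + b.n) (n := d.n) with
      | left i =>
        induction i using Fin.addCases (m := a.n) (n := b.n) with
        | left i =>
          obtain ⟨_, h₁⟩ := comp_eqToHom (tensor_assoc a b d)
            (Fin.castAdd _ (Fin.castAdd _ i)) (Fin.castAdd _ i) rfl
          obtain ⟨_, h₂⟩ := swap_left a (tensor d b) i
          obtain ⟨_, h₃⟩ := swap_left a b i
          obtain ⟨_, h₄⟩ := swap_left (tensor b a) d (Fin.natAdd _ i)
          obtain ⟨_, h₅⟩ := comp_eqToHom (tensor_assoc d b a).symm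
            (Fin.natAdd _ (Fin.natAdd _ i)) (Fin.natAdd _ i) (Nat.add_assoc _ _ _).symm
          exact ⟨_, _, h₁.comp (((comp_id' a i).tensor_left (swap b d)).comp h₂),
            ((h₃.tensor_left (𝟙 d)).comp (h₄.comp h₅)).congr (by simp)⟩
        | right i =>
          obtain ⟨_, h₁⟩ := comp_eqToHom (tensor_assoc a b d)
            (Fin.castAdd _ (Fin.natAdd _ i)) (Fin.natAdd _ (Fin.castAdd _ i)) rfl
          obtain ⟨_, h₀⟩ := swap_left b d i
          obtain ⟨_, h₂⟩ := swap_right a (tensor d b) (Fin.natAdd _ i)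
          obtain ⟨_, h₃⟩ := swap_right a b i
          obtain ⟨_, h₄⟩ := swap_left (tensor b a) d (Fin.castAdd _ i)
          obtain ⟨_, h₅⟩ := comp_eqToHom (tensor_assoc d b a).symm
            (Fin.natAdd _ (Fin.castAdd _ i)) (Fin.castAdd _ (Fin.natAdd _ i)) rfl
          exact ⟨_, _, h₁.comp ((h₀.tensor_right (𝟙 a)).comp h₂),
            ((h₃.tensor_left (𝟙 d)).comp (h₄.comp h₅)).congr (by simp)⟩
      | right i =>
        obtain ⟨_, h₁⟩ := comp_eqToHom (tensor_assoc a b d)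
          (Fin.natAdd _ i) (Fin.natAdd _ (Fin.natAdd _ i)) (Nat.add_assoc _ _ _)
        obtain ⟨_, h₀⟩ := swap_right b d i
        obtain ⟨_, h₂⟩ := swap_right a (tensor d b) (Fin.castAdd _ i)
        obtain ⟨_, h₄⟩ := swap_right (tensor b a) d i
        obtain ⟨_, h₅⟩ := comp_eqToHom (tensor_assoc d b a).symm
          (Fin.castAdd _ i) (Fin.castAdd _ (Fin.castAdd _ i)) rfl
        exact ⟨_, _, h₁.comp ((h₀.tensor_right (𝟙 a)).comp h₂),
          (((comp_id' d i).tensor_right (swap a b)).comp (h₄.comp h₅)).congr (by simp)⟩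
  commutor_unit := by
    exact hom_ext (F := swap _ _) (F' := 𝟙 _) G.c_zero fun i => i.elim0

end Cat
end EObj

/-! ### The symmetric groups -/

/-- The structure maps `Σ_n → Σ_n` of the symmetric groups, which are the identity. -/
def symmetricπ (n : ℕ) : Equiv.Perm (Fin n) →* Equiv.Perm (Fin n) := MonoidHom.id _

theorem gcast_perm {m n : ℕ} (h : m = n) (σ : Equiv.Perm (Fin m)) (i : Fin n) :
    gcast (Λ := fun n => Equiv.Perm (Fin n)) h σ i = Fin.cast h (σ (Fin.cast h.symm i)) := by
  subst h; rfl

/-- The block sum of permutations. -/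
def blockSum {m n : ℕ} (σ : Equiv.Perm (Fin m)) (τ : Equiv.Perm (Fin n)) :
    Equiv.Perm (Fin (m + n)) :=
  finSumFinEquiv.permCongr (Equiv.sumCongr σ τ)

theorem blockSum_castAdd {m n : ℕ} (σ : Equiv.Perm (Fin m)) (τ : Equiv.Perm (Fin n)) (i : Fin m) :
    blockSum σ τ (Fin.castAdd n i) = Fin.castAdd n (σ i) := by
  simp [blockSum, Equiv.permCongr_apply]

theorem blockSum_natAdd {m n : ℕ} (σ : Equiv.Perm (Fin m)) (τ : Equiv.Perm (Fin n)) (i : Fin n) :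
    blockSum σ τ (Fin.natAdd m i) = Fin.natAdd m (τ i) := by
  simp [blockSum, Equiv.permCongr_apply]

/-- The permutation moving the first `m` elements past the last `n` elements. -/
def blockSwap (m n : ℕ) : Equiv.Perm (Fin (m + n)) :=
  finAddFlip.trans (finCongr (Nat.add_comm n m))

theorem blockSwap_val (m n : ℕ) (i : Fin (m + n)) :
    (blockSwap m n i : ℕ) = if (i : ℕ) < m then n + i else i - m := by
  induction i using Fin.addCases <;> simp [blockSwap, Nat.add_comm]

theorem blockSwap_castAdd (m n : ℕ) (i : Fin m) : blockSwap m n (Fin.castAdd n i) =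
    Fin.cast (Nat.add_comm n m) (Fin.natAdd n i) := by simp [blockSwap]

theorem blockSwap_natAdd (m n : ℕ) (i : Fin n) : blockSwap m n (Fin.natAdd m i) =
    Fin.cast (Nat.add_comm n m) (Fin.castAdd m i) := by simp [blockSwap]

theorem blockSum_one_val {m n : ℕ} (τ : Equiv.Perm (Fin n)) (t : ℕ → ℕ)
    (ht : ∀ i, (τ i : ℕ) = t i) (i : Fin (m + n)) :
    (blockSum (1 : Equiv.Perm (Fin m)) τ i : ℕ) = if (i : ℕ) < m then (i : ℕ) else m + t (i - m) := by
  induction i using Fin.addCases with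
  | left i => simp [blockSum_castAdd]
  | right i => simp [blockSum_natAdd, ht]

theorem blockSum_val_one {m n : ℕ} (σ : Equiv.Perm (Fin m)) (t : ℕ → ℕ)
    (ht : ∀ i, (σ i : ℕ) = t i) (i : Fin (m + n)) :
    (blockSum σ (1 : Equiv.Perm (Fin n)) i : ℕ) = if (i : ℕ) < m then t i else i := by
  induction i using Fin.addCases with
  | left i => simp [blockSum_castAdd, ht]
  | right i => simp [blockSum_natAdd]

/-- Block sums and block transpositions of permutations. -/
instance : CoboundaryGroups symmetricπ where
  β := blockSum
  c := blockSwap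
  β_one_one m n := by
    ext i; induction i using Fin.addCases <;> simp [blockSum_castAdd, blockSum_natAdd]
  β_mul {m n} f f' g g' := by
    ext i; induction i using Fin.addCases <;> simp [blockSum_castAdd, blockSum_natAdd]
  β_assoc {m n p} f g h := by
    ext i
    rw [gcast_perm]
    induction i using Fin.addCases with
    | left i =>
      rw [show Fin.cast (Nat.add_assoc m n p).symm (Fin.castAdd (n + p) i) =
        Fin.castAdd p (Fin.castAdd n i) from rfl]
      simp only [blockSum_castAdd]; rfl
    | right i =>
      induction i using Fin.addCases with
      | left i =>
        rw [show Fin.cast (Nat.add_assoc m n p).symm (Fin.natAdd m (Fin.castAdd p i)) =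
          Fin.castAdd p (Fin.natAdd m i) from rfl]
        simp only [blockSum_castAdd, blockSum_natAdd]; rfl
      | right i =>
        rw [show Fin.cast (Nat.add_assoc m n p).symm (Fin.natAdd m (Fin.natAdd n i)) =
          Fin.natAdd (m + n) i from Fin.ext (Nat.add_assoc _ _ _).symm]
        simp only [blockSum_natAdd]; exact Nat.add_assoc _ _ _
  one_β {n} g := by
    ext i
    rw [gcast_perm, show Fin.cast (Nat.zero_add n).symm i = Fin.natAdd 0 i from
      Fin.ext (Nat.zero_add _).symm, blockSum_natAdd]
    exact Nat.zero_add _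
  β_one {n} g := by
    ext i
    rw [gcast_perm, show Fin.cast (Nat.add_zero n).symm i = Fin.castAdd 0 i from rfl,
      blockSum_castAdd]
    rfl
  π_β_left := blockSum_castAdd
  π_β_right := blockSum_natAdd
  π_c_left := blockSwap_castAdd
  π_c_right := blockSwap_natAdd
  c_natural {m n} f g := by
    ext i
    rw [Equiv.Perm.mul_apply, Equiv.Perm.mul_apply, gcast_perm]
    induction i using Fin.addCases <;>
      simp [blockSum_castAdd, blockSum_natAdd, blockSwap_castAdd, blockSwap_natAdd, -Fin.cast_natAdd]
  c_symm m n := by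
    ext i
    rw [Equiv.Perm.mul_apply, gcast_perm]
    induction i using Fin.addCases <;>
      simp [blockSwap_castAdd, blockSwap_natAdd, -Fin.cast_natAdd]
  c_cactus m n p := by
    ext i
    have hi := i.2
    have h₁ := fun i => blockSum_one_val (m := m) (blockSwap n p)
      (fun i => if i < n then p + i else i - n) (blockSwap_val n p) i
    have h₂ := fun i => blockSum_val_one (n := p) (blockSwap m n)
      (fun i => if i < m then n + i else i - m) (blockSwap_val m n) i
    simp only [Equiv.Perm.mul_apply, gcast_perm, Fin.val_cast, blockSwap_val, h₁, h₂]
    split_ifs <;> omega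
  c_zero := by ext i; exact i.elim0


namespace EObj

variable {Λ : ℕ → Type} [∀ n, Group (Λ n)] {π : ∀ n, Λ n →* Equiv.Perm (Fin n)}
variable {X : Type u} [Category.{v} X] {Y : Type u'} [Category.{v'} Y]

/-- The action of `EΛ(H)` on morphisms. -/
def mapHom (H : X ⥤ Y) {a b : EObj π X} (F : a ⟶ b) :
    (⟨a.n, fun i => H.obj (a.x i)⟩ : EObj π Y) ⟶ ⟨b.n, fun i => H.obj (b.x i)⟩ :=
  ({ len := Hom.len (a := a) (b := b) F
     g := Hom.g (a := a) (b := b) F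
     f := fun i => H.map (Hom.f (a := a) (b := b) F i) } :
    Hom (π := π) ⟨a.n, fun i => H.obj (a.x i)⟩ ⟨b.n, fun i => H.obj (b.x i)⟩)

theorem Hom.Comp.mapHom (H : X ⥤ Y) {a b : EObj π X} {F : a ⟶ b} {i j φ} (h : Hom.Comp F i j φ) :
    Hom.Comp (mapHom H F) i j (H.map φ) := by
  obtain ⟨h, rfl⟩ := h
  exact ⟨h, by subst h; simp [Hom.at, EObj.mapHom]⟩

/-- The functor `EΛ(H) : EΛ(X) ⥤ EΛ(Y)`. -/
def map (π : ∀ n, Λ n →* Equiv.Perm (Fin n)) (H : X ⥤ Y) : EObj π X ⥤ EObj π Y where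
  obj a := ⟨a.n, fun i => H.obj (a.x i)⟩
  map F := mapHom H F
  map_id a := hom_ext rfl fun i => ⟨i, _, (comp_id' a i).mapHom H, (comp_id' _ i).congr (by simp)⟩
  map_comp {a b d} F F' := by
    refine hom_ext rfl fun i => ?_
    obtain ⟨j, φ, h⟩ := comp_self F i
    obtain ⟨k, ψ, h'⟩ := comp_self F' j
    exact ⟨k, _, (h.comp h').mapHom H, ((h.mapHom H).comp (h'.mapHom H)).congr (by simp)⟩

/-- The component at `x₁, …, xₙ` of `EΛ(α)` consists of the identity of the group and the
morphisms `α_{xᵢ}`. -/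
def mapNatApp {H H' : X ⥤ Y} (α : H ⟶ H') (a : EObj π X) :
    (⟨a.n, fun i => H.obj (a.x i)⟩ : EObj π Y) ⟶ ⟨a.n, fun i => H'.obj (a.x i)⟩ :=
  ({ len := rfl
     g := 1
     f := fun i => α.app (a.x i) ≫ eqToHom (by simp) } :
    Hom (π := π) ⟨a.n, fun i => H.obj (a.x i)⟩ ⟨a.n, fun i => H'.obj (a.x i)⟩)

theorem mapNatApp_comp {H H' : X ⥤ Y} (α : H ⟶ H') (a : EObj π X) (i : Fin a.n) :
    Hom.Comp (mapNatApp α a) i i (α.app (a.x i)) :=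
  ⟨by simp [mapNatApp], by simp [mapNatApp, Hom.at]⟩

/-- The natural transformation `EΛ(α) : EΛ(H) ⟶ EΛ(H')`. -/
def mapNat (π : ∀ n, Λ n →* Equiv.Perm (Fin n)) {H H' : X ⥤ Y} (α : H ⟶ H') :
    map π H ⟶ map π H' where
  app a := mapNatApp α a
  naturality a b F := by
    refine hom_ext (F := mapHom H F ≫ mapNatApp α b) (F' := mapNatApp α a ≫ mapHom H' F)
      (by simp [mapNatApp, mapHom]) fun i => ?_
    obtain ⟨j, φ, h⟩ := comp_self F i
    exact ⟨j, _, (h.mapHom H).comp (mapNatApp_comp α b j),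
      ((mapNatApp_comp α a i).comp (h.mapHom H')).congr (by simp)⟩

/-- The string of length one. -/
abbrev single (π : ∀ n, Λ n →* Equiv.Perm (Fin n)) (x : X) : EObj π X := ⟨1, fun _ => x⟩

/-- The action of the unit on morphisms. -/
def singleMap (π : ∀ n, Λ n →* Equiv.Perm (Fin n)) {x y : X} (f : x ⟶ y) :
    single π x ⟶ single π y :=
  ({ len := rfl, g := 1, f := fun _ => f } : Hom (single π x) (single π y))

theorem singleMap_comp (π : ∀ n, Λ n →* Equiv.Perm (Fin n)) {x y : X} (f : x ⟶ y) (i j : Fin 1) :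
    Hom.Comp (singleMap π f) i j f :=
  ⟨Subsingleton.elim _ _, by simp [Hom.at, singleMap]⟩

/-- The unit `η_X : X ⥤ EΛ(X)`. -/
def unit (π : ∀ n, Λ n →* Equiv.Perm (Fin n)) (X : Type u) [Category.{v} X] : X ⥤ EObj π X where
  obj x := single π x
  map f := singleMap π f
  map_id x := hom_ext rfl fun i => ⟨i, _, singleMap_comp π _ i i, comp_id' _ i⟩
  map_comp f f' := hom_ext (by simp [singleMap]) fun i =>
    ⟨i, _, singleMap_comp π _ i i, (singleMap_comp π f i i).comp (singleMap_comp π f' i i)⟩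

/-- The action of `EΛ(X) ⥤ EΣ(X)` on morphisms. -/
def toSymmetricMap {a b : EObj π X} (F : a ⟶ b) :
    (⟨a.n, a.x⟩ : EObj symmetricπ X) ⟶ ⟨b.n, b.x⟩ :=
  ({ len := Hom.len (a := a) (b := b) F
     g := π _ (Hom.g (a := a) (b := b) F)
     f := fun i => Hom.f (a := a) (b := b) F i } :
    Hom (π := symmetricπ) ⟨a.n, a.x⟩ ⟨b.n, b.x⟩)

theorem Hom.Comp.toSymmetricMap {a b : EObj π X} {F : a ⟶ b} {i j φ} (h : Hom.Comp F i j φ) :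
    Hom.Comp (toSymmetricMap F) i j φ := by
  obtain ⟨h, rfl⟩ := h
  exact ⟨h, rfl⟩

/-- The functor `EΛ(X) ⥤ EΣ(X)` induced by the maps `π_n : Λ(n) → Σ_n`. -/
def toSymmetric (π : ∀ n, Λ n →* Equiv.Perm (Fin n)) (X : Type u) [Category.{v} X] :
    EObj π X ⥤ EObj symmetricπ X where
  obj a := ⟨a.n, a.x⟩
  map F := toSymmetricMap F
  map_id a := hom_ext (map_one (π a.n)) fun i =>
    ⟨i, _, (comp_id' a i).toSymmetricMap, comp_id' _ i⟩
  map_comp {a b d} F F' := by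
    refine hom_ext ?_ fun i => ?_
    · ext j
      simp only [toSymmetricMap, comp_g, map_mul, Equiv.Perm.mul_apply, gcast_perm_apply,
        gcast_perm]
    obtain ⟨j, φ, h⟩ := comp_self F i
    obtain ⟨k, ψ, h'⟩ := comp_self F' j
    exact ⟨k, _, (h.comp h').toSymmetricMap, h.toSymmetricMap.comp h'.toSymmetricMap⟩

/-! ### The multiplication of `EΛ` -/

theorem sigma_index {n n' : ℕ} (h : n = n') {k : Fin n → ℕ} {k' : Fin n' → ℕ}
    (hk : ∀ i, k i = k' (Fin.cast h i)) (hs : ∑ i, k i = ∑ i, k' i) (i : Fin n) (j : Fin (k i)) :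
    Fin.cast hs (finSigmaFinEquiv ⟨i, j⟩) = finSigmaFinEquiv ⟨Fin.cast h i, Fin.cast (hk i) j⟩ := by
  subst h
  obtain rfl : k = k' := funext hk
  rfl

theorem sum_len {n n' : ℕ} (h : n = n') (σ : Equiv.Perm (Fin n)) {k : Fin n → ℕ} {k' : Fin n' → ℕ}
    (hk : ∀ i, k i = k' (Fin.cast h (σ i))) : ∑ i, k i = ∑ i, k' i := by
  subst h
  rw [Finset.sum_congr rfl fun i _ => hk i]
  exact Equiv.sum_comp σ k'

theorem μ_gcast (O : ActionOperad π) {n n' : ℕ} (h : n = n') {k : Fin n → ℕ} {k' : Fin n' → ℕ}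
    (hk : ∀ i, k' i = k (Fin.cast h.symm i)) (g : Λ n) (f : ∀ i, Λ (k i)) (hs) :
    O.μ (gcast h g) (fun i => gcast (hk i).symm (f (Fin.cast h.symm i))) =
      gcast hs (O.μ g f) := by
  subst h
  obtain rfl : k' = k := funext hk
  rfl

variable (O : ActionOperad π)

/-- The concatenation of a string of strings. -/
abbrev join (a : EObj π (EObj π X)) : EObj π X :=
  ⟨∑ i, (a.x i).n, fun t => (a.x (finSigmaFinEquiv.symm t).1).x (finSigmaFinEquiv.symm t).2⟩

theorem join_x (b : EObj π (EObj π X)) (j : Fin b.n) (q : Fin (b.x j).n) :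
    (join b).x (finSigmaFinEquiv ⟨j, q⟩) = (b.x j).x q := by
  exact congrArg (fun t : (j : Fin b.n) × Fin (b.x j).n => (b.x t.1).x t.2)
    (Equiv.symm_apply_apply finSigmaFinEquiv ⟨j, q⟩)

theorem join_len {a b : EObj π (EObj π X)} (F : a ⟶ b) : (join a).n = (join b).n :=
  sum_len (Hom.len F) (π _ (Hom.g F)) fun i => Hom.len (Hom.f F i)

theorem join_index {a b : EObj π (EObj π X)} (F : a ⟶ b) (i : Fin a.n) (j : Fin (a.x i).n) :
    Fin.cast (join_len F) (π _ (O.μ (Hom.g F) fun i => Hom.g (Hom.f F i))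
      (finSigmaFinEquiv ⟨i, j⟩)) = finSigmaFinEquiv ⟨Fin.cast (Hom.len F) (π _ (Hom.g F) i),
        Fin.cast (Hom.len (Hom.f F i)) (π _ (Hom.g (Hom.f F i)) j)⟩ := by
  rw [O.π_μ, Fin.cast_cast, sigma_index (Hom.len F) (k' := fun i => (b.x i).n) (fun i' => by
    rw [Hom.len (Hom.f F _)]
    simp)]
  rfl

/-- The action of the multiplication on morphisms: the operadic composite in the groups together
with the components of the components. -/
def joinMap {a b : EObj π (EObj π X)} (F : a ⟶ b) : join a ⟶ join b :=
  ({ len := join_len F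
     g := O.μ (Hom.g F) fun i => Hom.g (Hom.f F i)
     f := fun t =>
      Hom.f (Hom.f F (finSigmaFinEquiv.symm t).1) (finSigmaFinEquiv.symm t).2 ≫ eqToHom (by
        have h := join_index O F (finSigmaFinEquiv.symm t).1 (finSigmaFinEquiv.symm t).2
        rw [Sigma.eta, Equiv.apply_symm_apply] at h
        exact (join_x b _ _).symm.trans (congrArg (join b).x h.symm)) } : Hom (join a) (join b))

theorem joinMap_f_aux {a b : EObj π (EObj π X)} (F : a ⟶ b) (i : Fin a.n) (p : Fin (a.x i).n)
    {y : X} (t : (i : Fin a.n) × Fin (a.x i).n) (h : t = ⟨i, p⟩) (h₁) (h₂) (h₃) :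
    Hom.f (Hom.f F t.1) t.2 ≫ eqToHom (Y := y) h₁ =
      eqToHom h₂ ≫ Hom.f (Hom.f F i) p ≫ eqToHom h₃ := by
  subst h
  simp

theorem Hom.Comp.joinMap {a b : EObj π (EObj π X)} {F : a ⟶ b} {i j} {Φ : a.x i ⟶ b.x j}
    (h : Hom.Comp F i j Φ) {p q φ} (h' : Hom.Comp Φ p q φ) :
    ∃ h₁ h₂, Hom.Comp (joinMap O F) (finSigmaFinEquiv ⟨i, p⟩) (finSigmaFinEquiv ⟨j, q⟩)
      (eqToHom h₁ ≫ φ ≫ eqToHom h₂) := by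
  obtain ⟨h, rfl⟩ := h
  obtain ⟨h', rfl⟩ := h'
  subst h
  have e : Hom.at F i _ rfl = Hom.f F i := Category.comp_id _
  have h'' : Fin.cast (Hom.len (Hom.f F i)) (π _ (Hom.g (Hom.f F i)) p) = q := by
    simpa only [e] using h'
  refine ⟨join_x a i p, (join_x b _ q).symm, ?_, ?_⟩
  · exact (join_index O F i p).trans (by subst h''; rfl)
  · rw [Hom.at_congr e p q h']
    subst h''
    simp only [Hom.at, EObj.joinMap, Category.assoc, eqToHom_refl, Category.id_comp]
    refine (congrArg (fun t => _ ≫ t) (eqToHom_trans _ _)).trans ?_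
    exact joinMap_f_aux F i p _ (Equiv.symm_apply_apply _ _) _ _ _

theorem μ_one_one {n : ℕ} (k : Fin n → ℕ) (f : ∀ i, Λ (k i)) (hf : ∀ i, f i = 1) :
    O.μ (1 : Λ n) f = 1 := by
  obtain rfl : f = fun _ => 1 := funext hf
  have h := O.μ_mul_μ (k := k) 1 1 (fun _ => 1) fun _ => 1
  simp only [map_one, mul_one] at h
  rw [mul_eq_right, MulEquiv.map_eq_one_iff] at h
  have h' : ∀ (k' : Fin n → ℕ) (_ : k' = k), O.μ (1 : Λ n) (fun i => (1 : Λ (k' i))) = 1 →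
    O.μ (1 : Λ n) (fun i => (1 : Λ (k i))) = 1 := by rintro _ rfl h; exact h
  exact h' _ (by simp) h

theorem joinMap_comp_g {a b d : EObj π (EObj π X)} (F : a ⟶ b) (F' : b ⟶ d) :
    O.μ (Hom.g (F ≫ F')) (fun i => Hom.g (Hom.f (F ≫ F') i)) =
      gcast (join_len F).symm (O.μ (Hom.g F') fun i => Hom.g (Hom.f F' i)) *
        O.μ (Hom.g F) fun i => Hom.g (Hom.f F i) := by
  have hk : ∀ i : Fin a.n, (a.x ((π _ (Hom.g F))⁻¹ i)).n = (b.x (Fin.cast (Hom.len F) i)).n :=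
    fun i => by rw [Hom.len (Hom.f F _)]; simp
  have h := O.μ_mul_μ (k := fun i => (a.x i).n) (gcast (Hom.len F).symm (Hom.g F')) (Hom.g F)
    (fun i => gcast (hk i).symm (Hom.g (Hom.f F' (Fin.cast (Hom.len F) i))))
    (fun i => Hom.g (Hom.f F i))
  rw [μ_gcast O (Hom.len F).symm (k := fun i => (b.x i).n) hk (Hom.g F')
    (fun i => Hom.g (Hom.f F' i)) (by
      rw [Equiv.sum_comp ((π _ (Hom.g F))⁻¹) fun i => (a.x i).n]; exact (join_len F).symm),
    gcast_gcast] at h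
  rw [h]
  refine congrArg (O.μ _) (funext fun i => ?_)
  rw [gcast_gcast]
  refine (comp_g (Hom.f F i) _).trans ?_
  congr 1
  refine congrArg _ ((comp_g _ _).trans ?_)
  rw [eqToHom_g]; simp

/-- The multiplication `μ_X : EΛ(EΛ(X)) ⥤ EΛ(X)`. -/
def mult (X : Type u) [Category.{v} X] : EObj π (EObj π X) ⥤ EObj π X where
  obj a := join a
  map F := joinMap O F
  map_id a := by
    refine hom_ext (μ_one_one O _ _ fun i => eqToHom_g (by simp))  fun t => ?_
    obtain ⟨⟨i, p⟩, rfl⟩ := finSigmaFinEquiv.surjective t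
    obtain ⟨h₁, h₂, h₃⟩ := (comp_id' a i).joinMap O (comp_id' (a.x i) p)
    exact ⟨_, _, h₃, (comp_id' _ _).congr (by simp)⟩
  map_comp {a b d} F F' := by
    refine hom_ext (joinMap_comp_g O F F') fun t => ?_
    obtain ⟨⟨i, p⟩, rfl⟩ := finSigmaFinEquiv.surjective t
    obtain ⟨j, Φ, h⟩ := comp_self F i
    obtain ⟨k, Ψ, h'⟩ := comp_self F' j
    obtain ⟨q, φ, e⟩ := comp_self Φ p
    obtain ⟨r, ψ, e'⟩ := comp_self Ψ q
    obtain ⟨h₁, h₂, h₃⟩ := (h.comp h').joinMap O (e.comp e')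
    obtain ⟨h₄, h₅, h₆⟩ := h.joinMap O e
    obtain ⟨h₇, h₈, h₉⟩ := h'.joinMap O e'
    exact ⟨_, _, h₃, (h₆.comp h₉).congr (by simp)⟩

end EObj

/-! ### The operad structure of the cactus groups -/

/-- The partial sum `k₁ + ⋯ + k_m`. -/
def partialSum {n : ℕ} (k : Fin n → ℕ) (m : ℕ) : ℕ := ∑ j : Fin n, if (j : ℕ) < m then k j else 0

theorem partialSum_add_le {n : ℕ} (k : Fin n → ℕ) (i : Fin n) :
    partialSum k i + k i ≤ ∑ j, k j := by
  have h : k i = ∑ j, if j = i then k j else 0 := by simp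
  rw [partialSum, h, ← Finset.sum_add_distrib]
  refine Finset.sum_le_sum fun j _ => ?_
  by_cases hj : j = i <;> simp [hj]
  split_ifs <;> simp

namespace Cactus

/-- The block sum `β(h₁, …, hₙ) ∈ J_{k₁ + ⋯ + kₙ}`: the generators of the `i`-th factor are
shifted by `k₁ + ⋯ + k_{i-1}`, and the results are multiplied in order. -/
def blocks {n : ℕ} {k : Fin n → ℕ} (h : ∀ i, Cactus (k i)) : Cactus (∑ i, k i) :=
  (List.ofFn fun i => shift (partialSum k i) (partialSum_add_le k i) (h i)).prod

/-- The operad structure of the cactus groups: `β(h₁, …, hₙ) = μ(e; h₁, …, hₙ)` is the block sum and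
`δ(s_{p,q}) = μ(s_{p,q}; e, …, e)` is the generator reversing the blocks with numbers `p, …, q` as a
whole, multiplied by the product of the generators reversing each of these blocks. -/
structure IsOperad (O : ActionOperad π) : Prop where
  μ_one_left : ∀ {n : ℕ} {k : Fin n → ℕ} (h : ∀ i, Cactus (k i)), O.μ (1 : Cactus n) h = blocks h
  μ_s : ∀ {n : ℕ} {k : Fin n → ℕ} (p q : ℕ), 1 ≤ p → p < q → q ≤ n →
    O.μ (s n p q) (fun i => (1 : Cactus (k i))) =
      s (∑ i, k i) (partialSum k (p - 1) + 1) (partialSum k q) *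
        blocks fun i => if p ≤ (i : ℕ) + 1 ∧ (i : ℕ) + 1 ≤ q then s (k i) 1 (k i) else 1

end Cactus

/-! ### Free strict coboundary categories -/

/-- The strict coboundary category `C` is free on the object `c`: strict coboundary functors out of
`C` correspond to objects, and monoidal transformations between them to morphisms. -/
structure IsFreeOnObject {C : Type u} [Category.{v} C] [StrictCoboundaryCategory C] (c : C) :
    Prop where
  functor : ∀ {D : Type u'} [Category.{v'} D] [StrictCoboundaryCategory D] (x : D),
    ∃! F : C ⥤ D, IsStrictCoboundaryFunctor F ∧ F.obj c = x
  transformation : ∀ {D : Type u'} [Category.{v'} D] [StrictCoboundaryCategory D] {F G : C ⥤ D}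
    (hF : IsStrictCoboundaryFunctor F) (hG : IsStrictCoboundaryFunctor G) (f : F.obj c ⟶ G.obj c),
    ∃! θ : F ⟶ G, IsMonoidalTransformation hF hG θ ∧ θ.app c = f

/-- The strict coboundary category `C` is free on the category `X` via `η`, in the 2-dimensional
sense. -/
structure IsFreeOnCategory {X : Type u} [Category.{v} X] {C : Type u} [Category.{v} C]
    [StrictCoboundaryCategory C] (η : X ⥤ C) : Prop where
  functor : ∀ {D : Type u'} [Category.{v'} D] [StrictCoboundaryCategory D] (K : X ⥤ D),
    ∃! F : C ⥤ D, IsStrictCoboundaryFunctor F ∧ η ⋙ F = K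
  transformation : ∀ {D : Type u'} [Category.{v'} D] [StrictCoboundaryCategory D] {F G : C ⥤ D}
    (hF : IsStrictCoboundaryFunctor F) (hG : IsStrictCoboundaryFunctor G) (θ : η ⋙ F ⟶ η ⋙ G),
    ∃! α : F ⟶ G, IsMonoidalTransformation hF hG α ∧ Functor.whiskerLeft η α = θ

namespace EObj

variable {Λ : ℕ → Type} [∀ n, Group (Λ n)] {π : ∀ n, Λ n →* Equiv.Perm (Fin n)}

/-- The 2-monad `EΛ` over `EΣ` is the 2-monad for strict coboundary categories: it is the 2-monad of
the free-forgetful 2-adjunction, its algebras are the strict coboundary categories, and the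
transformation `EΛ ⟶ EΣ` is the cartesian transformation which makes this 2-monad a club, given by
the symmetric strict monoidal categories `EΣ(X)` regarded as coboundary categories. -/
structure IsCoboundaryMonad [CoboundaryGroups π] (O : ActionOperad π) : Prop where
  free : ∀ (X : Type u) [Category.{v} X], IsFreeOnCategory.{v, u, v', u'} (unit π X)
  map_strict : ∀ {X Y : Type u} [Category.{v} X] [Category.{v} Y] (H : X ⥤ Y),
    IsStrictCoboundaryFunctor (map π H)
  unit_map : ∀ {X Y : Type u} [Category.{v} X] [Category.{v} Y] (H : X ⥤ Y),
    unit π X ⋙ map π H = H ⋙ unit π Y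
  mapNat_monoidal : ∀ {X Y : Type u} [Category.{v} X] [Category.{v} Y] {H H' : X ⥤ Y}
    (α : H ⟶ H'), IsMonoidalTransformation (map_strict H) (map_strict H') (mapNat π α)
  mapNat_single : ∀ {X Y : Type u} [Category.{v} X] [Category.{v} Y] {H H' : X ⥤ Y}
    (α : H ⟶ H') (x : X), (mapNat π α).app (single π x) = (unit π Y).map (α.app x)
  mult_strict : ∀ (X : Type u) [Category.{v} X], IsStrictCoboundaryFunctor (mult O X)
  unit_mult : ∀ (X : Type u) [Category.{v} X], unit π (EObj π X) ⋙ mult O X = 𝟭 (EObj π X)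
  algebra : ∀ (D : Type u) [Category.{v} D] (a : EObj π D ⥤ D), unit π D ⋙ a = 𝟭 D →
    mult O D ⋙ a = map π a ⋙ a → ∃! _S : StrictCoboundaryCategory D, IsStrictCoboundaryFunctor a
  toSymmetric_strict : ∀ (X : Type u) [Category.{v} X],
    IsStrictCoboundaryFunctor (toSymmetric π X)
  unit_toSymmetric : ∀ (X : Type u) [Category.{v} X],
    unit π X ⋙ toSymmetric π X = unit symmetricπ X
  toSymmetric_cartesian : ∀ {X Y : Type u} [Category.{v} X] [Category.{v} Y] (H : X ⥤ Y),
    IsPullback (map π H).toCatHom (toSymmetric π X).toCatHom (toSymmetric π Y).toCatHom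
      (map symmetricπ H).toCatHom

end EObj

/-!
In a strict coboundary category `D` the commutor can be iterated. The morphism `Arr.rev`,
`x₁ ⊗ ⋯ ⊗ xₙ ⟶ xₙ ⊗ ⋯ ⊗ x₁`, is defined by recursion: reverse `x₂, …, xₙ` and commute the result
past `x₁`. The cactus axiom gives `Arr.rev_append`, that the place where a string is cut does not
matter, and symmetry of the commutor then gives that `rev` is involutive (`Arr.rev_rev`) and
satisfies `Arr.rev_contains`. These are the defining relations of the cactus groups, if `s_{p,q}`
acts by reversing the factors with numbers `p, …, q` (`Arr.seg`). So `J_n` acts naturally on the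
tensor products of `n` objects of `D`: this is `Arr.act`, with `Arr.act_mul` and `Arr.act_natural`,
and strict coboundary functors preserve the action. Block sums act by tensor products
(`Arr.act_β`), and `σ_{m,n} = s_{1,m+n} s_{1,m} s_{m+1,m+n}` acts by the commutor (`Arr.act_c`).

In `BJ` itself `rev` of a string of numbers is the product of the `s_{1,k}` of the blocks, followed
by `s_{1,N}` (`BObj.rev_eq`). Hence `g ∈ J_n` acts on the `n`-th power of the object `1` by the
morphism `g` (`BObj.act_one_eq_ar`): all morphisms of `BJ` are built from commutors, which is the
uniqueness in the freeness of `BJ`, while existence is the action on powers of an object. For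
`EJ(X)` the argument is the same. A morphism is determined by its image in `BJ` and its list of
components in `X` (`EObj.arr_ext`), so `(g; f₁, …, fₙ)` is the tensor product of the `fᵢ` followed by
the action of `g` (`EObj.ar_eq_prod_comp_act`).

The operad structure comes from the action on `BJ`: `μ(g; f₁, …, fₙ)` is the morphism
`f₁ ⊗ ⋯ ⊗ fₙ` of `BJ` followed by the action of `g` on the objects `k₁, …, kₙ`. Its axioms are
functoriality and naturality of the action, and the value on `s_{p,q}` is the formula for `rev` in
`BJ`. The multiplication of `EJ` is then the strict coboundary functor extending the identity
(`Cactus.mult_eq_lift`). For an algebra `a : EJ(D) ⥤ D` the associativity law shows that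
`a (U ⊗ V)` depends only on `a U` and `a V`, so that the strict coboundary structure of `EJ(D)`
passes to `D` along `a`. Finally `EJ ⟶ EΣ` is cartesian, since it does not change the components in
`X` and `EJ(H)` does not change the elements of the groups.

Equations between morphisms of a strict monoidal category hold only up to equalities of sources and
targets. They are stated in the set `Arr D` of all morphisms of `D`, a monoid under the tensor
product, in which no transport is needed.
-/

universe v'' u''

noncomputable section

/-! ### The morphisms of a strict coboundary category as a monoid -/

/-- The set of all morphisms of a category. Morphisms which a strict structure forces to be equal
have sources and targets which are equal, but not definitionally so; in `Arr C` they can be compared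
without transport. -/
structure Arr (C : Type u) [Category.{v} C] where
  {dom cod : C}
  hom : dom ⟶ cod

namespace Arr

section Category

variable {C : Type u} [Category.{v} C]

theorem hom_eq {A B : Arr C} (h : A = B) :
    A.hom = eqToHom (by rw [h]) ≫ B.hom ≫ eqToHom (by rw [h]) := by
  subst h; simp

theorem mk_inj {x y : C} {f g : x ⟶ y} (h : mk f = mk g) : f = g := by
  simpa using hom_eq h

/-- The identity of `x` as an element of `Arr C`. -/
def id (x : C) : Arr C := ⟨𝟙 x⟩

@[simp] theorem dom_id (x : C) : (id x).dom = x := (rfl)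
@[simp] theorem cod_id (x : C) : (id x).cod = x := (rfl)

open Classical in
/-- The composite of two morphisms, in diagrammatic order. If they are not composable, it is by
convention the first one, so that `dom_comp` holds without hypothesis. -/
def comp (A B : Arr C) : Arr C :=
  if h : A.cod = B.dom then ⟨A.hom ≫ eqToHom h ≫ B.hom⟩ else A

infixl:65 " ⋆ " => comp

@[simp] theorem mk_comp_mk {x y z : C} (f : x ⟶ y) (g : y ⟶ z) : mk f ⋆ mk g = mk (f ≫ g) := by
  simp [comp]

@[simp] theorem dom_comp (A B : Arr C) : (A ⋆ B).dom = A.dom := by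
  unfold comp; split_ifs <;> rfl

@[simp] theorem cod_comp {A B : Arr C} (h : A.cod = B.dom) : (A ⋆ B).cod = B.cod := by
  simp [comp, h]

theorem comp_assoc {A B D : Arr C} (h : A.cod = B.dom) (h' : B.cod = D.dom) :
    A ⋆ B ⋆ D = A ⋆ (B ⋆ D) := by
  obtain ⟨f⟩ := A
  obtain ⟨g⟩ := B
  obtain ⟨k⟩ := D
  dsimp at h h'
  subst h h'
  simp

@[simp] theorem id_comp {x : C} {A : Arr C} (h : x = A.dom) : id x ⋆ A = A := by
  subst h
  simp [id, comp]

@[simp] theorem comp_id {x : C} {A : Arr C} (h : A.cod = x) : A ⋆ id x = A := by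
  subst h
  simp [id, comp]

@[simp] theorem mk_eqToHom {x y : C} (h : x = y) : mk (eqToHom h) = id x := by subst h; rfl

@[simp] theorem mk_eqToHom_comp {x y z : C} (h : x = y) (f : y ⟶ z) :
    mk (eqToHom h ≫ f) = mk f := by subst h; simp

@[simp] theorem mk_comp_eqToHom {x y z : C} (f : x ⟶ y) (h : y = z) :
    mk (f ≫ eqToHom h) = mk f := by subst h; simp

/-- A morphism between given objects, from an element of `Arr C` with these ends. -/
def toHom (A : Arr C) {x y : C} (hx : A.dom = x) (hy : A.cod = y) : x ⟶ y :=
  eqToHom hx.symm ≫ A.hom ≫ eqToHom hy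

@[simp] theorem mk_toHom (A : Arr C) {x y : C} (hx : A.dom = x) (hy : A.cod = y) :
    mk (A.toHom hx hy) = A := by
  simp [toHom]

end Category

end Arr

namespace CategoryTheory.Functor

variable {C : Type u} [Category.{v} C] {D : Type u'} [Category.{v'} D]

/-- The action of a functor on the set of all morphisms. -/
def arr (F : C ⥤ D) (A : Arr C) : Arr D := ⟨F.map A.hom⟩

variable (F : C ⥤ D)

@[simp] theorem arr_mk {x y : C} (f : x ⟶ y) : F.arr ⟨f⟩ = ⟨F.map f⟩ := rfl
@[simp] theorem dom_arr (A : Arr C) : (F.arr A).dom = F.obj A.dom := (rfl)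
@[simp] theorem cod_arr (A : Arr C) : (F.arr A).cod = F.obj A.cod := (rfl)
@[simp] theorem arr_id (x : C) : F.arr (.id x) = .id (F.obj x) := by simp [Arr.id]

theorem arr_comp {A B : Arr C} (h : A.cod = B.dom) : F.arr (A ⋆ B) = F.arr A ⋆ F.arr B := by
  obtain ⟨f⟩ := A
  obtain ⟨g⟩ := B
  dsimp at h
  subst h
  simp

theorem comp_arr {E : Type u''} [Category.{v''} E] (G : D ⥤ E) (A : Arr C) :
    (F ⋙ G).arr A = G.arr (F.arr A) := rfl

theorem id_arr (A : Arr C) : (𝟭 C).arr A = A := rfl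

theorem ext_arr {F G : C ⥤ D} (h : ∀ A, F.arr A = G.arr A) : F = G :=
  Functor.ext (fun x => congrArg Arr.dom (h (.id x))) fun _ _ f => Arr.hom_eq (h ⟨f⟩)

/-- A functor, from its action on the set of all morphisms. -/
def ofArr (o : C → D) (φ : Arr C → Arr D) (hd : ∀ A, (φ A).dom = o A.dom)
    (hc : ∀ A, (φ A).cod = o A.cod) (hi : ∀ x, φ (.id x) = .id (o x))
    (hm : ∀ A B, A.cod = B.dom → φ (A ⋆ B) = φ A ⋆ φ B) : C ⥤ D where
  obj := o
  map f := (φ ⟨f⟩).toHom (hd _) (hc _)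
  map_id x := Arr.mk_inj ((Arr.mk_toHom _ _ _).trans (hi x))
  map_comp f g := Arr.mk_inj (by
    refine (Arr.mk_toHom _ _ _).trans (Eq.trans ?_ (Arr.mk_comp_mk _ _))
    rw [Arr.mk_toHom, Arr.mk_toHom, ← hm _ _ rfl, Arr.mk_comp_mk])

theorem ofArr_arr (o : C → D) (φ : Arr C → Arr D) (hd hc hi hm) (A : Arr C) :
    (ofArr o φ hd hc hi hm).arr A = φ A := Arr.mk_toHom _ (hd A) (hc A)

end CategoryTheory.Functor

namespace Arr

section Strict

variable {D : Type u} [Category.{v} D] [StrictCoboundaryCategory D]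

/-- The objects of a strict coboundary category form a monoid under the tensor product. -/
scoped instance objMonoid : Monoid D where
  mul x y := x ⊗ y
  one := 𝟙_ D
  mul_assoc := IsStrictMonoidal.tensor_assoc
  one_mul := IsStrictMonoidal.unit_tensor
  mul_one := IsStrictMonoidal.tensor_unit

/-- The morphisms of a strict coboundary category form a monoid under the tensor product. -/
scoped instance arrMonoid : Monoid (Arr D) where
  mul A B := ⟨A.hom ⊗ₘ B.hom⟩
  one := ⟨𝟙 (𝟙_ D)⟩
  mul_assoc A B E := by
    have := congrArg mk (MonoidalCategory.associator_naturality A.hom B.hom E.hom)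
    rwa [IsStrictMonoidal.associator_hom, IsStrictMonoidal.associator_hom, mk_eqToHom_comp,
      mk_comp_eqToHom] at this
  one_mul A := by
    have := congrArg mk (MonoidalCategory.leftUnitor_naturality A.hom)
    rwa [IsStrictMonoidal.leftUnitor_hom, IsStrictMonoidal.leftUnitor_hom, mk_eqToHom_comp,
      mk_comp_eqToHom, ← MonoidalCategory.id_tensorHom] at this
  mul_one A := by
    have := congrArg mk (MonoidalCategory.rightUnitor_naturality A.hom)
    rwa [IsStrictMonoidal.rightUnitor_hom, IsStrictMonoidal.rightUnitor_hom, mk_eqToHom_comp,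
      mk_comp_eqToHom, ← MonoidalCategory.tensorHom_id] at this

theorem mk_mul_mk {x y x' y' : D} (f : x ⟶ y) (g : x' ⟶ y') : mk f * mk g = mk (f ⊗ₘ g) := rfl

@[simp] theorem dom_mul (A B : Arr D) : (A * B).dom = A.dom * B.dom := (rfl)
@[simp] theorem cod_mul (A B : Arr D) : (A * B).cod = A.cod * B.cod := (rfl)
@[simp] theorem id_one : id (1 : D) = 1 := (rfl)

theorem id_mul (x y : D) : id (x * y) = id x * id y :=
  congrArg mk (MonoidalCategory.id_tensorHom_id x y).symm

/-- Taking sources is a homomorphism. -/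
def domHom (D : Type u) [Category.{v} D] [StrictCoboundaryCategory D] : Arr D →* D :=
  ⟨⟨dom, rfl⟩, fun _ _ => rfl⟩

/-- Taking targets is a homomorphism. -/
def codHom (D : Type u) [Category.{v} D] [StrictCoboundaryCategory D] : Arr D →* D :=
  ⟨⟨cod, rfl⟩, fun _ _ => rfl⟩

/-- Taking identities is a homomorphism. -/
def idHom (D : Type u) [Category.{v} D] [StrictCoboundaryCategory D] : D →* Arr D :=
  ⟨⟨id, rfl⟩, id_mul⟩

@[simp] theorem dom_prod (L : List (Arr D)) : L.prod.dom = (L.map dom).prod :=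
  map_list_prod (domHom D) L

@[simp] theorem cod_prod (L : List (Arr D)) : L.prod.cod = (L.map cod).prod :=
  map_list_prod (codHom D) L

theorem id_prod (l : List D) : id l.prod = (l.map id).prod :=
  map_list_prod (idHom D) l

theorem comp_mul_comp {A B A' B' : Arr D} (h : A.cod = B.dom) (h' : A'.cod = B'.dom) :
    (A ⋆ B) * (A' ⋆ B') = (A * A') ⋆ (B * B') := by
  obtain ⟨f⟩ := A
  obtain ⟨g⟩ := B
  obtain ⟨f'⟩ := A'
  obtain ⟨g'⟩ := B'
  dsimp at h h'
  subst h h'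
  simp [mk_mul_mk]

theorem mul_comp_mul {A B A' B' : Arr D} (h : A.cod = B.dom) (h' : A'.cod = B'.dom) :
    A * A' ⋆ B * B' = (A ⋆ B) * (A' ⋆ B') := (comp_mul_comp h h').symm

/-- The commutor as an element of `Arr D`. -/
def σ (x y : D) : Arr D := ⟨(CoboundaryCategory.commutor x y).hom⟩

@[simp] theorem dom_σ (x y : D) : (σ x y).dom = x * y := (rfl)
@[simp] theorem cod_σ (x y : D) : (σ x y).cod = y * x := (rfl)

theorem σ_natural (A B : Arr D) : A * B ⋆ σ A.cod B.cod = σ A.dom B.dom ⋆ B * A := by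
  obtain ⟨f⟩ := A
  obtain ⟨g⟩ := B
  simp only [mk_mul_mk, σ]
  exact (mk_comp_mk _ _).trans
    ((congrArg mk (CoboundaryCategory.commutor_naturality f g)).trans (mk_comp_mk _ _).symm)

theorem σ_σ (x y : D) : σ x y ⋆ σ y x = id (x * y) :=
  (mk_comp_mk _ _).trans (congrArg mk (CoboundaryCategory.commutor_symmetry x y))

theorem σ_cactus (x y z : D) : id x * σ y z ⋆ σ x (z * y) = σ x y * id z ⋆ σ (y * x) z := by
  have h : (α_ z y x).inv = eqToHom (IsStrictMonoidal.tensor_assoc z y x).symm := by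
    rw [← cancel_epi (α_ z y x).hom, Iso.hom_inv_id, IsStrictMonoidal.associator_hom, eqToHom_trans,
      eqToHom_refl]
  have := congrArg mk (CoboundaryCategory.cactus x y z)
  rw [IsStrictMonoidal.associator_hom, mk_eqToHom_comp, ← Category.assoc, h, mk_comp_eqToHom,
    ← mk_comp_mk, ← mk_comp_mk, ← MonoidalCategory.id_tensorHom,
    ← MonoidalCategory.tensorHom_id] at this
  exact this

theorem σ_one_one : σ (1 : D) 1 = 1 :=
  (congrArg mk CoboundaryCategory.commutor_unit).trans
    ((id_mul (1 : D) 1).trans (one_mul (1 : Arr D)))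

/-- The commutor with the unit object is the identity: by the cactus axiom it is idempotent. -/
theorem σ_one (x : D) : σ 1 x = id x := by
  have h := σ_cactus 1 1 x
  rw [σ_one_one] at h
  simp at h
  have h' := congrArg (· ⋆ σ x 1) h
  simpa [comp_assoc, σ_σ] using h'

theorem σ_one_right (x : D) : σ x 1 = id x := by
  have h := σ_σ x 1
  rwa [σ_one, comp_id (by simp), mul_one] at h

end Strict

end Arr

open Arr

/-! ### Strict coboundary functors on the set of morphisms -/

namespace IsStrictCoboundaryFunctor

variable {C : Type u} [Category.{v} C] {D : Type u'} [Category.{v'} D]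
  [StrictCoboundaryCategory C] [StrictCoboundaryCategory D] {F : C ⥤ D}

theorem of_arr (h₁ : F.obj 1 = 1) (h₂ : ∀ A B, F.arr (A * B) = F.arr A * F.arr B)
    (h₃ : ∀ x y, F.arr (σ x y) = σ (F.obj x) (F.obj y)) : IsStrictCoboundaryFunctor F where
  obj_unit := h₁
  obj_tensor x y := congrArg dom (h₂ (id x) (id y))
  map_tensor f g := hom_eq (h₂ ⟨f⟩ ⟨g⟩)
  map_commutor x y := hom_eq (h₃ x y)

theorem arr_mul (hF : IsStrictCoboundaryFunctor F) (A B : Arr C) :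
    F.arr (A * B) = F.arr A * F.arr B := by
  refine (congrArg Arr.mk (hF.map_tensor A.hom B.hom)).trans ?_
  rw [mk_eqToHom_comp, mk_comp_eqToHom]
  rfl

theorem arr_σ (hF : IsStrictCoboundaryFunctor F) (x y : C) :
    F.arr (σ x y) = σ (F.obj x) (F.obj y) := by
  refine (congrArg Arr.mk (hF.map_commutor x y)).trans ?_
  rw [mk_eqToHom_comp, mk_comp_eqToHom]
  rfl

/-- A strict coboundary functor as a homomorphism of monoids of objects. -/
def objHom (hF : IsStrictCoboundaryFunctor F) : C →* D := ⟨⟨F.obj, hF.obj_unit⟩, hF.obj_tensor⟩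

/-- A strict coboundary functor as a homomorphism of monoids of morphisms. -/
def arrHom (hF : IsStrictCoboundaryFunctor F) : Arr C →* Arr D :=
  ⟨⟨F.arr, by rw [← id_one, Functor.arr_id]; exact congrArg Arr.id hF.obj_unit⟩, hF.arr_mul⟩

theorem obj_prod (hF : IsStrictCoboundaryFunctor F) (l : List C) :
    F.obj l.prod = (l.map F.obj).prod := map_list_prod hF.objHom l

theorem arr_prod (hF : IsStrictCoboundaryFunctor F) (l : List (Arr C)) :
    F.arr l.prod = (l.map F.arr).prod := map_list_prod hF.arrHom l

end IsStrictCoboundaryFunctor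

namespace Arr

/-! ### Reversing the factors of a tensor product -/

variable {D : Type u} [Category.{v} D] [StrictCoboundaryCategory D]
  {C : Type u'} [Category.{v'} C] [StrictCoboundaryCategory C]

/-- The morphism `x₁ ⊗ ⋯ ⊗ xₙ ⟶ xₙ ⊗ ⋯ ⊗ x₁` by which `s_{1,n}` acts. -/
def rev : List D → Arr D
  | [] => 1
  | x :: l => id x * rev l ⋆ σ x l.reverse.prod

@[simp] theorem dom_rev (l : List D) : (rev l).dom = l.prod := by
  induction l with
  | nil => rfl
  | cons x l ih => simp [rev, ih]

@[simp] theorem cod_rev (l : List D) : (rev l).cod = l.reverse.prod := by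
  induction l with
  | nil => rfl
  | cons x l ih => simp [rev, ih]

theorem rev_singleton (x : D) : rev [x] = id x := by
  simp [rev, σ_one_right]

/-- The cactus axiom for strings of any length. -/
theorem rev_append (l l' : List D) :
    rev (l ++ l') = rev l * rev l' ⋆ σ l.reverse.prod l'.reverse.prod := by
  induction l with
  | nil => simp [rev, σ_one]
  | cons x l ih =>
    have h : id x * (rev l * rev l' ⋆ σ l.reverse.prod l'.reverse.prod) =
        id x * (rev l * rev l') ⋆ id x * σ l.reverse.prod l'.reverse.prod := by
      rw [← comp_mul_comp (by simp) (by simp), id_comp (by simp)]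
    have h' : (id x * rev l ⋆ σ x l.reverse.prod) * rev l' =
        id x * rev l * rev l' ⋆ σ x l.reverse.prod * id l'.reverse.prod := by
      rw [← comp_mul_comp (by simp) (by simp), comp_id (by simp)]
    simp only [List.cons_append, rev, ih, List.reverse_append, List.prod_append, h, h',
      List.reverse_cons, List.prod_singleton]
    rw [comp_assoc (by simp) (by simp), comp_assoc (by simp) (by simp), σ_cactus, mul_assoc]

theorem rev_rev (l : List D) : rev l ⋆ rev l.reverse = id l.prod := by
  induction l with
  | nil => exact id_comp (x := (1 : D)) rfl
  | cons x l ih =>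
    have h := σ_natural (id x) (rev l.reverse)
    simp only [cod_id, dom_id, cod_rev, dom_rev, List.reverse_reverse] at h
    rw [rev, List.reverse_cons, rev_append, rev_singleton, List.reverse_reverse,
      List.reverse_singleton, List.prod_singleton, comp_assoc (by simp) (by simp),
      ← comp_assoc (B := _ * _) (by simp) (by simp), ← h, comp_assoc (by simp) (by simp), σ_σ,
      comp_id (by simp), ← comp_mul_comp (by simp) (by simp), ih, id_comp (by simp),
      List.prod_cons, id_mul]

theorem rev_natural (L : List (Arr D)) :
    L.prod ⋆ rev (L.map cod) = rev (L.map dom) ⋆ L.reverse.prod := by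
  induction L with
  | nil => exact (id_comp (x := (1 : D)) rfl).trans (comp_id (x := (1 : D)) rfl).symm
  | cons A L ih =>
    have h := σ_natural A L.reverse.prod
    simp only [dom_prod, cod_prod, List.map_reverse] at h
    simp only [List.prod_cons, List.map_cons, rev, List.reverse_cons, List.prod_append,
      List.prod_nil, mul_one]
    rw [← comp_assoc (by simp) (by simp), mul_comp_mul (by simp) (by simp), comp_id (by simp), ih,
      comp_assoc (by simp) (by simp), ← h, ← comp_assoc (by simp) (by simp),
      mul_comp_mul (by simp) (by simp), id_comp (by simp)]

/-- Associativity of the reversal of blocks, for three blocks. -/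
theorem rev_three (a b d : List D) :
    rev (a ++ b ++ d) =
      rev a * rev b * rev d ⋆ rev [a.reverse.prod, b.reverse.prod, d.reverse.prod] := by
  have h : ∀ x y z : D, rev [x, y, z] = σ x y * id z ⋆ σ (y * x) z := fun x y z => by
    rw [show [x, y, z] = [x, y] ++ [z] from rfl, rev_append, show [x, y] = [x] ++ [y] from rfl,
      rev_append]
    simp [rev_singleton, ← id_mul]
  rw [h, rev_append, rev_append, ← comp_assoc (by simp [mul_assoc]) (by simp),
    mul_comp_mul (by simp) (by simp), comp_id (by simp), List.reverse_append, List.prod_append]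

/-- The image of the relation between `s_{p,q}` and `s_{k,l}` for `p ≤ k < l ≤ q`. -/
theorem rev_contains (a b d : List D) :
    id a.prod * rev b * id d.prod ⋆ rev (a ++ b.reverse ++ d) =
      rev (a ++ b ++ d) ⋆ id d.reverse.prod * rev b.reverse * id a.reverse.prod := by
  have h := rev_natural [id a.reverse.prod, rev b.reverse, id d.reverse.prod]
  simp at h
  rw [rev_three, rev_three, comp_assoc (by simp [mul_assoc]) (by simp [mul_assoc])]
  simp only [List.reverse_reverse]
  rw [mul_assoc (id d.reverse.prod), ← h, ← comp_assoc (by simp [mul_assoc]) (by simp [mul_assoc]),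
    ← comp_assoc (by simp [mul_assoc]) (by simp), ← mul_assoc (id _)]
  simp [mul_comp_mul, rev_rev]

theorem _root_.IsStrictCoboundaryFunctor.arr_rev {F : C ⥤ D} (hF : IsStrictCoboundaryFunctor F)
    (l : List C) : F.arr (rev l) = rev (l.map F.obj) := by
  induction l with
  | nil => exact map_one hF.arrHom
  | cons x l ih =>
    rw [rev, F.arr_comp (by simp), hF.arr_mul, ih, hF.arr_σ, hF.obj_prod, F.arr_id,
      List.map_reverse]
    rfl

end Arr

/-! ### The cactus group acts on tensor products -/

/-- The list obtained by reversing the entries with numbers `p, …, q`, counted from one. -/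
def List.flip {α : Type*} (p q : ℕ) (l : List α) : List α :=
  l.take (p - 1) ++ ((l.take q).drop (p - 1)).reverse ++ l.drop q

theorem List.flip_eq {α : Type*} {p q : ℕ} {a b d : List α} (hp : a.length = p - 1)
    (hq : (a ++ b).length = q) : (a ++ b ++ d).flip p q = a ++ b.reverse ++ d := by
  rw [List.flip, List.take_left' hq, List.drop_left' hq, List.drop_left' hp, List.append_assoc a b,
    List.take_left' hp]

theorem List.exists_append {α : Type*} {l : List α} {m : ℕ} (h : m ≤ l.length) :
    ∃ a b, l = a ++ b ∧ a.length = m :=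
  ⟨l.take m, l.drop m, (List.take_append_drop m l).symm, by simpa using h⟩

theorem List.exists_append_append {α : Type*} {l : List α} {p q : ℕ} (hpq : p ≤ q)
    (h : q ≤ l.length) : ∃ a b d, l = a ++ b ++ d ∧ a.length = p ∧ (a ++ b).length = q := by
  obtain ⟨x, d, rfl, hx⟩ := List.exists_append h
  obtain ⟨a, b, rfl, ha⟩ := List.exists_append (l := x) (m := p) (by omega)
  exact ⟨a, b, d, rfl, ha, hx⟩

namespace Cactus

theorem π_s {n p q : ℕ} (hp : 1 ≤ p) (hpq : p < q) (hq : q ≤ n) : π n (s n p q) = sHat n p q := by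
  rw [π, lift_s _ _ _ _ hp hpq hq]

theorem s_inv (n p q : ℕ) : (s n p q)⁻¹ = s n p q := inv_eq_of_mul_eq_one_left (s_mul_self n p q)

theorem sHat_symm {n p q : ℕ} (hp : 1 ≤ p) (hpq : p < q) (hq : q ≤ n) :
    (sHat n p q).symm = sHat n p q := by
  rw [← π_s hp hpq hq, ← Equiv.Perm.inv_def, ← map_inv, s_inv]

theorem ofFn_comp_sHat {α : Type*} {n p q : ℕ} (hp : 1 ≤ p) (hpq : p < q) (hq : q ≤ n)
    (z : Fin n → α) : List.ofFn (z ∘ sHat n p q) = (List.ofFn z).flip p q := by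
  refine List.ext_getElem ?_ fun i h₁ h₂ => ?_
  · simp [List.flip]; omega
  · simp only [List.length_ofFn] at h₁
    simp only [List.getElem_ofFn, Function.comp_apply, List.flip, List.getElem_append,
      List.getElem_reverse, List.getElem_take, List.getElem_drop, List.length_append,
      List.length_take, List.length_reverse, List.length_drop, List.length_ofFn]
    split_ifs <;> refine congrArg z (Fin.ext ?_) <;>
      simp only [sHat_val hp hq, reverse] <;> split_ifs <;> omega

/-- Since the generators are involutions, they generate the cactus group as a monoid. -/
theorem s_induction {n : ℕ} {P : Cactus n → Prop} (h₁ : P 1)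
    (h₂ : ∀ p q g, 1 ≤ p → p < q → q ≤ n → P g → P (s n p q * g)) (g : Cactus n) : P g := by
  let H : Subgroup (Cactus n) :=
    { carrier := {g | (∀ f, P f → P (g * f)) ∧ ∀ f, P f → P (g⁻¹ * f)}
      one_mem' := by simp
      mul_mem' := fun ha hb => ⟨fun f hf => by rw [mul_assoc]; exact ha.1 _ (hb.1 _ hf),
        fun f hf => by rw [mul_inv_rev, mul_assoc]; exact hb.2 _ (ha.2 _ hf)⟩
      inv_mem' := fun ha => ⟨ha.2, by simpa using ha.1⟩ }
  have h : g ∈ H := mem_of_s H (fun p q hp hpq hq => ⟨fun f => h₂ p q f hp hpq hq, by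
    rw [s_inv]; exact fun f => h₂ p q f hp hpq hq⟩) g
  simpa using h.1 1 h₁

end Cactus

namespace Arr

variable {D : Type u} [Category.{v} D] [StrictCoboundaryCategory D]
  {C : Type u'} [Category.{v'} C] [StrictCoboundaryCategory C]

/-- The morphism by which the generator `s_{p,q}` acts: the tensor product of an identity, the
reversal of the factors with numbers `p, …, q`, and an identity. -/
def seg (p q : ℕ) (l : List D) : Arr D :=
  id (l.take (p - 1)).prod * rev ((l.take q).drop (p - 1)) * id (l.drop q).prod

theorem seg_eq {p q : ℕ} {a b d : List D} (hp : a.length = p - 1) (hq : (a ++ b).length = q) :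
    seg p q (a ++ b ++ d) = id a.prod * rev b * id d.prod := by
  rw [seg, List.take_left' hq, List.drop_left' hq, List.drop_left' hp, List.append_assoc a b,
    List.take_left' hp]

theorem dom_seg {p q : ℕ} (hpq : p < q) (l : List D) : (seg p q l).dom = l.prod := by
  simp only [seg, dom_mul, dom_id, dom_rev]
  rw [show l.take (p - 1) = (l.take q).take (p - 1) by rw [List.take_take]; congr 1; omega,
    ← List.prod_append, List.take_append_drop, ← List.prod_append, List.take_append_drop]

theorem cod_seg (p q : ℕ) (l : List D) : (seg p q l).cod = (l.flip p q).prod := by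
  simp [seg, List.flip, mul_assoc]

theorem seg_natural {p q : ℕ} (hpq : p < q) (L : List (Arr D)) :
    L.prod ⋆ seg p q (L.map cod) = seg p q (L.map dom) ⋆ (L.flip p q).prod := by
  have h : L.prod = (L.take (p - 1)).prod * ((L.take q).drop (p - 1)).prod * (L.drop q).prod := by
    rw [show L.take (p - 1) = (L.take q).take (p - 1) by rw [List.take_take]; congr 1; omega,
      ← List.prod_append, List.take_append_drop, ← List.prod_append, List.take_append_drop]
  rw [h, seg, seg, List.flip, List.prod_append, List.prod_append]
  simp only [← List.map_take, ← List.map_drop]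
  rw [mul_comp_mul (by simp) (by simp), mul_comp_mul (by simp) (by simp),
    mul_comp_mul (by simp) (by simp), mul_comp_mul (by simp) (by simp), rev_natural]
  simp

theorem seg_seg {n p q : ℕ} (hpq : p < q) (hq : q ≤ n) {l : List D} (hl : l.length = n) :
    seg p q l ⋆ seg p q (l.flip p q) = id l.prod := by
  obtain ⟨a, b, d, rfl, h₁, h₂⟩ := List.exists_append_append (show p - 1 ≤ q by omega)
    (hl.symm ▸ hq)
  rw [List.flip_eq h₁ h₂, seg_eq h₁ h₂, seg_eq h₁ (by simpa using h₂),
    mul_comp_mul (by simp) (by simp), mul_comp_mul (by simp) (by simp), rev_rev]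
  simp [id_mul, mul_assoc]

theorem seg_comm {n p q k m : ℕ} (hpq : p < q) (hqk : q < k) (hkm : k < m) (hm : m ≤ n)
    {l : List D} (hl : l.length = n) :
    seg k m l ⋆ seg p q (l.flip k m) = seg p q l ⋆ seg k m (l.flip p q) := by
  obtain ⟨x, y, z, rfl, h₁, h₂⟩ := List.exists_append_append (show k - 1 ≤ m by omega)
    (hl.symm ▸ hm)
  obtain ⟨a, b, d, rfl, h₃, h₄⟩ := List.exists_append_append (l := x) (show p - 1 ≤ q by omega)
    (by omega)
  have h₅ : (a ++ b.reverse ++ d).length = k - 1 := by simpa using h₁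
  rw [List.flip_eq h₁ h₂, seg_eq h₁ h₂]
  simp only [List.append_assoc (a ++ b)]
  rw [List.flip_eq h₃ h₄, seg_eq h₃ h₄, seg_eq h₃ h₄]
  simp only [← List.append_assoc (a ++ b.reverse)]
  rw [seg_eq h₅ (by simp at h₂ ⊢; omega)]
  simp only [List.prod_append, id_mul, ← mul_assoc]
  simp [mul_comp_mul]

theorem seg_contains {n p q k m : ℕ} (hp : 1 ≤ p) (hpk : p ≤ k) (hkm : k < m) (hmq : m ≤ q)
    (hq : q ≤ n) {l : List D} (hl : l.length = n) :
    seg k m l ⋆ seg p q (l.flip k m) =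
      seg p q l ⋆ seg (p + q - m) (p + q - k) (l.flip p q) := by
  obtain ⟨x, y, z, rfl, h₁, h₂⟩ := List.exists_append_append (show p - 1 ≤ q by omega)
    (hl.symm ▸ hq)
  obtain ⟨a, b, d, rfl, h₃, h₄⟩ := List.exists_append_append (l := y)
    (show k - p ≤ m + 1 - p by omega) (by simp at h₂; omega)
  have e₁ : (x ++ a).length = k - 1 := by simp at *; omega
  have e₂ : (x ++ a ++ b).length = m := by simp at *; omega
  have e₃ : (x ++ d.reverse).length = p + q - m - 1 := by simp at *; omega
  have e₄ : (x ++ d.reverse ++ b.reverse).length = p + q - k := by simp at *; omega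
  have h₅ : (x ++ (a ++ b.reverse ++ d)).length = q := by simp at *; omega
  rw [List.flip_eq h₁ h₂, seg_eq h₁ h₂,
    show x ++ (a ++ b ++ d) ++ z = x ++ a ++ b ++ (d ++ z) by simp,
    show x ++ (a ++ b ++ d).reverse ++ z =
      x ++ d.reverse ++ b.reverse ++ (a.reverse ++ z) by simp,
    seg_eq e₁ e₂, seg_eq e₃ e₄, List.flip_eq e₁ e₂,
    show x ++ a ++ b.reverse ++ (d ++ z) = x ++ (a ++ b.reverse ++ d) ++ z by simp, seg_eq h₁ h₅]
  have e₅ := rev_contains a b d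
  simp only [List.prod_append, id_mul]
  rw [show id x.prod * id a.prod * rev b * (id d.prod * id z.prod) =
      id x.prod * (id a.prod * rev b * id d.prod) * id z.prod by simp only [mul_assoc],
    show id x.prod * id d.reverse.prod * rev b.reverse * (id a.reverse.prod * id z.prod) =
      id x.prod * (id d.reverse.prod * rev b.reverse * id a.reverse.prod) * id z.prod by
        simp only [mul_assoc],
    mul_comp_mul (by simp [mul_assoc]) (by simp), mul_comp_mul (by simp) (by simp [mul_assoc]),
    mul_comp_mul (by simp [mul_assoc]) (by simp), mul_comp_mul (by simp) (by simp [mul_assoc]), e₅]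

/-- Families of morphisms `z₁ ⊗ ⋯ ⊗ zₙ ⟶ w₁ ⊗ ⋯ ⊗ wₙ`, natural in `z₁, …, zₙ`, where
`w` is the permuted family. -/
@[ext] structure PermTrans (n : ℕ) (D : Type u) [Category.{v} D] [StrictCoboundaryCategory D] where
  perm : Equiv.Perm (Fin n)
  app : (Fin n → D) → Arr D
  dom_app : ∀ z, (app z).dom = (List.ofFn z).prod
  cod_app : ∀ z, (app z).cod = (List.ofFn (z ∘ ⇑perm.symm)).prod
  natural : ∀ A : Fin n → Arr D, (List.ofFn A).prod ⋆ app (cod ∘ A) =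
    app (dom ∘ A) ⋆ (List.ofFn (A ∘ ⇑perm.symm)).prod

namespace PermTrans

variable {n : ℕ}

attribute [simp] dom_app cod_app

instance : Monoid (PermTrans n D) where
  one :=
    { perm := 1
      app := fun z => id (List.ofFn z).prod
      dom_app := fun z => rfl
      cod_app := fun z => rfl
      natural := fun A => by
        rw [comp_id (by simp [List.map_ofFn]), id_comp (by rw [dom_prod, List.map_ofFn]; rfl)]
        rfl }
  mul a b :=
    { perm := a.perm * b.perm
      app := fun z => b.app z ⋆ a.app (z ∘ ⇑b.perm.symm)
      dom_app := fun z => by simp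
      cod_app := fun z => by rw [cod_comp (by simp), cod_app]; rfl
      natural := fun A => by
        have h := a.natural (A ∘ ⇑b.perm.symm)
        simp only [← Function.comp_assoc] at h
        rw [← comp_assoc (by simp [List.map_ofFn]) (by simp), b.natural,
          comp_assoc (by simp [List.map_ofFn, Function.comp_assoc]) (by simp [List.map_ofFn]; rfl), h,
          comp_assoc (by simp) (by simp [List.map_ofFn]; rfl)]
        rfl }
  mul_assoc a b d := PermTrans.ext rfl (funext fun z => by
    exact (comp_assoc (by simp) (by simp)).symm)
  one_mul a := PermTrans.ext rfl (funext fun z => comp_id (cod_app a z))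
  mul_one a := PermTrans.ext rfl (funext fun z => id_comp (dom_app a z).symm)

@[simp] theorem perm_mul (a b : PermTrans n D) : (a * b).perm = a.perm * b.perm := rfl
@[simp] theorem perm_one : (1 : PermTrans n D).perm = 1 := rfl
theorem app_mul (a b : PermTrans n D) (z : Fin n → D) :
    (a * b).app z = b.app z ⋆ a.app (z ∘ ⇑b.perm.symm) := rfl
theorem app_one (z : Fin n → D) : (1 : PermTrans n D).app z = id (List.ofFn z).prod := rfl

/-- The action of `s_{p,q}`. -/
def gen {p q : ℕ} (hp : 1 ≤ p) (hpq : p < q) (hq : q ≤ n) : PermTrans n D where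
  perm := Cactus.sHat n p q
  app z := seg p q (List.ofFn z)
  dom_app z := dom_seg hpq _
  cod_app z := by rw [Cactus.sHat_symm hp hpq hq, Cactus.ofFn_comp_sHat hp hpq hq, cod_seg]
  natural A := by
    have h := seg_natural hpq (List.ofFn A)
    rwa [List.map_ofFn, List.map_ofFn, ← Cactus.ofFn_comp_sHat hp hpq hq,
      ← Cactus.sHat_symm hp hpq hq] at h

theorem gen_mul_self {p q : ℕ} (hp : 1 ≤ p) (hpq : p < q) (hq : q ≤ n) :
    gen (D := D) hp hpq hq * gen hp hpq hq = 1 := by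
  refine PermTrans.ext ?_ (funext fun z => ?_)
  · simp only [perm_mul, gen, perm_one]
    rw [← Cactus.π_s hp hpq hq, ← map_mul, Cactus.s_mul_self, map_one]
  · simp only [app_mul, gen, app_one, Cactus.sHat_symm hp hpq hq, Cactus.ofFn_comp_sHat hp hpq hq]
    exact seg_seg hpq hq (by simp)

/-- The action of `s_{p,q}` as an invertible element, since `PermTrans n D` is only a monoid while
the universal property of the cactus group is about homomorphisms to groups. For other `p` and `q` the
value is irrelevant. -/
def unit (n : ℕ) (D : Type u) [Category.{v} D] [StrictCoboundaryCategory D] (p q : ℕ) :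
    (PermTrans n D)ˣ :=
  if h : 1 ≤ p ∧ p < q ∧ q ≤ n then
    ⟨gen h.1 h.2.1 h.2.2, gen h.1 h.2.1 h.2.2, gen_mul_self _ _ _, gen_mul_self _ _ _⟩
  else 1

theorem val_unit {p q : ℕ} (hp : 1 ≤ p) (hpq : p < q) (hq : q ≤ n) :
    (unit n D p q).val = gen hp hpq hq := by
  rw [unit, dif_pos ⟨hp, hpq, hq⟩]

end PermTrans

/-- The homomorphism by which the cactus group acts on the tensor products of `n` objects. -/
def ρ (n : ℕ) (D : Type u) [Category.{v} D] [StrictCoboundaryCategory D] :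
    Cactus n →* (PermTrans n D)ˣ :=
  Cactus.lift (PermTrans.unit n D)
    (fun p q hp hpq hq => Units.ext (by
      rw [Units.val_mul, PermTrans.val_unit hp hpq hq, PermTrans.gen_mul_self, Units.val_one]))
    (fun p q k l hp hpq hqk hkl hl => Units.ext (by
      rw [Units.val_mul, Units.val_mul, PermTrans.val_unit hp hpq (by omega),
        PermTrans.val_unit (by omega) hkl hl]
      refine PermTrans.ext ?_ (funext fun z => ?_)
      · simp only [PermTrans.perm_mul, PermTrans.gen]
        rw [← Cactus.π_s hp hpq (by omega), ← Cactus.π_s (by omega) hkl hl, ← map_mul, ← map_mul,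
          Cactus.s_comm (.inl hqk)]
      · simp only [PermTrans.app_mul, PermTrans.gen]
        rw [Cactus.sHat_symm hp hpq (by omega), Cactus.ofFn_comp_sHat hp hpq (by omega),
          Cactus.sHat_symm (by omega) hkl hl, Cactus.ofFn_comp_sHat (by omega) hkl hl]
        exact seg_comm hpq hqk hkl hl (by simp)))
    (fun p q k l hp hpk hkl hlq hq => Units.ext (by
      rw [Units.val_mul, Units.val_mul, PermTrans.val_unit hp (by omega) hq,
        PermTrans.val_unit (by omega) hkl (by omega),
        PermTrans.val_unit (by omega) (by omega) (by omega)]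
      refine PermTrans.ext ?_ (funext fun z => ?_)
      · simp only [PermTrans.perm_mul, PermTrans.gen]
        rw [← Cactus.π_s hp (by omega) hq, ← Cactus.π_s (by omega) hkl (by omega),
          ← Cactus.π_s (by omega) (by omega) (by omega), ← map_mul, ← map_mul,
          Cactus.s_contains hp hq hpk hlq]
      · simp only [PermTrans.app_mul, PermTrans.gen]
        rw [Cactus.sHat_symm hp (by omega) hq, Cactus.ofFn_comp_sHat hp (by omega) hq,
          Cactus.sHat_symm (by omega) hkl (by omega), Cactus.ofFn_comp_sHat (by omega) hkl (by omega)]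
        exact seg_contains hp hpk hkl hlq hq (by simp)))

variable {n : ℕ}

theorem perm_ρ (g : Cactus n) : (ρ n D g).val.perm = Cactus.π n g := by
  induction g using Cactus.s_induction with
  | h₁ => simp
  | h₂ p q g hp hpq hq ih =>
    rw [map_mul, map_mul, Units.val_mul, PermTrans.perm_mul, ih, ρ, Cactus.lift_s _ _ _ _ hp hpq hq,
      PermTrans.val_unit hp hpq hq, Cactus.π_s hp hpq hq]
    rfl

/-- The morphism `z₁ ⊗ ⋯ ⊗ zₙ ⟶ w₁ ⊗ ⋯ ⊗ wₙ` given by `g ∈ J_n`, with `w_{π(g)(i)} = zᵢ`. -/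
def act (g : Cactus n) (z : Fin n → D) : Arr D := (ρ n D g).val.app z

@[simp] theorem dom_act (g : Cactus n) (z : Fin n → D) : (act g z).dom = (List.ofFn z).prod :=
  PermTrans.dom_app _ _

@[simp] theorem cod_act (g : Cactus n) (z : Fin n → D) :
    (act g z).cod = (List.ofFn (z ∘ ⇑(Cactus.π n g).symm)).prod := by
  rw [act, PermTrans.cod_app, perm_ρ]

@[simp] theorem act_one (z : Fin n → D) : act 1 z = id (List.ofFn z).prod := by
  rw [act, map_one]; rfl

theorem act_mul (g g' : Cactus n) (z : Fin n → D) :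
    act (g * g') z = act g' z ⋆ act g (z ∘ ⇑(Cactus.π n g').symm) := by
  rw [act, map_mul, Units.val_mul, PermTrans.app_mul, perm_ρ]; rfl

theorem act_s {p q : ℕ} (hp : 1 ≤ p) (hpq : p < q) (hq : q ≤ n) (z : Fin n → D) :
    act (Cactus.s n p q) z = seg p q (List.ofFn z) := by
  rw [act, ρ, Cactus.lift_s _ _ _ _ hp hpq hq, PermTrans.val_unit hp hpq hq]; rfl

theorem act_natural (g : Cactus n) (A : Fin n → Arr D) :
    (List.ofFn A).prod ⋆ act g (cod ∘ A) =
      act g (dom ∘ A) ⋆ (List.ofFn (A ∘ ⇑(Cactus.π n g).symm)).prod := by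
  have h := (ρ n D g).val.natural A
  rwa [perm_ρ] at h

/-- The action is built from tensor products and commutors, so strict coboundary functors preserve
it. -/
theorem _root_.IsStrictCoboundaryFunctor.arr_act {F : C ⥤ D} (hF : IsStrictCoboundaryFunctor F)
    (g : Cactus n) (z : Fin n → C) : F.arr (act g z) = act g (F.obj ∘ z) := by
  induction g using Cactus.s_induction generalizing z with
  | h₁ => rw [act_one, act_one, F.arr_id, hF.obj_prod, List.map_ofFn]
  | h₂ p q g hp hpq hq ih =>
    rw [act_mul, act_mul, F.arr_comp (by simp), ih, act_s hp hpq hq, act_s hp hpq hq, seg, seg,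
      hF.arr_mul, hF.arr_mul, F.arr_id, F.arr_id, hF.arr_rev, hF.obj_prod, hF.obj_prod,
      ← List.map_ofFn, ← List.map_ofFn]
    simp only [List.map_take, List.map_drop, List.map_ofFn, Function.comp_assoc]

end Arr

section

variable {Λ : ℕ → Type} [∀ n, Group (Λ n)] {π : ∀ n, Λ n →* Equiv.Perm (Fin n)}

/-! ### The morphisms of `BΛ` -/

namespace BObj

/-- The element `g` of `Λ(n)` as a morphism of `BΛ`. -/
def ar (π : ∀ n, Λ n →* Equiv.Perm (Fin n)) (n : ℕ) (g : Λ n) : Arr (BObj π) :=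
  ⟨(⟨rfl, g⟩ : Hom (⟨n⟩ : BObj π) ⟨n⟩)⟩

@[simp] theorem dom_ar (n : ℕ) (g : Λ n) : (ar π n g).dom = ⟨n⟩ := (rfl)

theorem mk_eq_ar {a b : BObj π} (F : a ⟶ b) : (⟨F⟩ : Arr (BObj π)) = ar π a.n F.g := by
  obtain ⟨m⟩ := a
  obtain ⟨n⟩ := b
  obtain ⟨h, g⟩ := F
  dsimp at h
  subst h
  rfl

theorem exists_ar (A : Arr (BObj π)) : ∃ n g, A = ar π n g := ⟨_, _, mk_eq_ar A.hom⟩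

theorem ar_inj {n : ℕ} {g g' : Λ n} (h : ar π n g = ar π n g') : g = g' :=
  congrArg Hom.g (mk_inj h)

@[simp] theorem ar_gcast {m n : ℕ} (h : m = n) (g : Λ m) : ar π n (gcast h g) = ar π m g := by
  subst h; rfl

theorem ar_comp {n : ℕ} (g g' : Λ n) : ar π n g ⋆ ar π n g' = ar π n (g' * g) := mk_comp_mk _ _

theorem id_eq_ar (x : BObj π) : Arr.id x = ar π x.n 1 := rfl

variable [G : CoboundaryGroups π]

theorem ar_mul_ar {m n : ℕ} (g : Λ m) (h : Λ n) :
    ar π m g * ar π n h = ar π (m + n) (G.β g h) := rfl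

theorem σ_eq_ar (x y : BObj π) : σ x y = ar π (x.n + y.n) (G.c x.n y.n) :=
  mk_eq_ar (CoboundaryCategory.commutor x y).hom

theorem n_mul (x y : BObj π) : (x * y).n = x.n + y.n := rfl

theorem n_prod (l : List (BObj π)) : l.prod.n = (l.map n).sum := by
  induction l with
  | nil => rfl
  | cons x l ih => rw [List.prod_cons, n_mul, ih, List.map_cons, List.sum_cons]

end BObj

/-! ### The morphisms of `EΛ(X)` -/

namespace EObj

variable {X : Type u}

/-- The string underlying an object as a list. -/
def toList (a : EObj π X) : List X := List.ofFn a.x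

theorem toList_injective {a b : EObj π X} (h : toList a = toList b) : a = b := by
  obtain ⟨m, x⟩ := a
  obtain ⟨n, y⟩ := b
  obtain rfl : m = n := by simpa [toList] using congrArg List.length h
  obtain rfl : x = y := List.ofFn_injective h
  rfl

variable [Category.{v} X]

/-- The morphism of `EΛ(X)` given by `g ∈ Λ(n)` and `n` morphisms of `X`. -/
def ar (π : ∀ n, Λ n →* Equiv.Perm (Fin n)) {n : ℕ} (g : Λ n) (f : Fin n → Arr X) :
    Arr (EObj π X) :=
  ⟨(⟨rfl, g, fun i => (f i).hom ≫ eqToHom (by simp)⟩ :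
    Hom (⟨n, dom ∘ f⟩ : EObj π X) ⟨n, cod ∘ f ∘ ⇑(π n g).symm⟩)⟩

@[simp] theorem dom_ar {n : ℕ} (g : Λ n) (f : Fin n → Arr X) :
    (ar π g f).dom = ⟨n, dom ∘ f⟩ := (rfl)

@[simp] theorem cod_ar {n : ℕ} (g : Λ n) (f : Fin n → Arr X) :
    (ar π g f).cod = ⟨n, cod ∘ f ∘ ⇑(π n g).symm⟩ := (rfl)

theorem mk_congr_cod {n : ℕ} {x y y' : Fin n → X} (h : y' = y) (g : Λ n)
    (f : ∀ i, x i ⟶ y (π n g i)) (h' : ∀ i, y (π n g i) = y' (π n g i)) :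
    (⟨(⟨rfl, g, fun i => f i ≫ eqToHom (h' i)⟩ : Hom (⟨n, x⟩ : EObj π X) ⟨n, y'⟩)⟩ :
      Arr (EObj π X)) = ⟨(⟨rfl, g, f⟩ : Hom (⟨n, x⟩ : EObj π X) ⟨n, y⟩)⟩ := by
  subst h
  simp

theorem mk_eq_ar {a b : EObj π X} (F : a ⟶ b) :
    (⟨F⟩ : Arr (EObj π X)) = ar π (Hom.g F) fun i => ⟨Hom.f F i⟩ := by
  obtain ⟨m, x⟩ := a
  obtain ⟨n, y⟩ := b
  obtain ⟨h, g, f⟩ := F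
  dsimp at h
  subst h
  exact (mk_congr_cod (by simp [Function.comp_def]) g f _).symm

theorem exists_ar (A : Arr (EObj π X)) : ∃ n g f, A = ar π (n := n) g f := ⟨_, _, _, mk_eq_ar A.hom⟩

/-- The functor `EΛ(X) ⥤ BΛ` which forgets the components in `X`. -/
def forget (π : ∀ n, Λ n →* Equiv.Perm (Fin n)) (X : Type u) [Category.{v} X] :
    EObj π X ⥤ BObj π where
  obj a := ⟨a.n⟩
  map F := (⟨Hom.len F, Hom.g F⟩ : BObj.Hom _ _)

theorem Hom.Comp.mk_eq {a b : EObj π X} {F : a ⟶ b} {i : Fin a.n} {j : Fin b.n}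
    {φ : a.x i ⟶ b.x j} (h : Hom.Comp F i j φ) : (⟨Hom.f F i⟩ : Arr X) = ⟨φ⟩ := by
  obtain ⟨rfl, rfl⟩ := h
  exact (mk_comp_eqToHom _ _).symm

/-- The components in `X` of a morphism of `EΛ(X)`. -/
def cmp (A : Arr (EObj π X)) : Fin A.dom.n → Arr X := fun i => ⟨Hom.f A.hom i⟩

/-- The list of components in `X` of a morphism of `EΛ(X)`. -/
def comps (A : Arr (EObj π X)) : List (Arr X) := List.ofFn (cmp A)

@[simp] theorem forget_ar {n : ℕ} (g : Λ n) (f : Fin n → Arr X) :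
    (forget π X).arr (ar π g f) = BObj.ar π n g := rfl

theorem cmp_ar {n : ℕ} (g : Λ n) (f : Fin n → Arr X) : cmp (ar π g f) = f :=
  funext fun _ => mk_comp_eqToHom _ _

@[simp] theorem comps_ar {n : ℕ} (g : Λ n) (f : Fin n → Arr X) : comps (ar π g f) = List.ofFn f :=
  congrArg List.ofFn (cmp_ar g f)

/-- A morphism of `EΛ(X)` is determined by an element of some `Λ(n)` and its components. -/
theorem arr_ext {A B : Arr (EObj π X)} (h : (forget π X).arr A = (forget π X).arr B)
    (h' : comps A = comps B) : A = B := by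
  obtain ⟨m, g, f, rfl⟩ := exists_ar A
  obtain ⟨n, g', f', rfl⟩ := exists_ar B
  simp only [forget_ar, comps_ar] at h h'
  obtain rfl : m = n := congrArg (fun A => A.dom.n) h
  rw [BObj.ar_inj h, List.ofFn_injective h']

@[simp] theorem comps_id (a : EObj π X) : comps (Arr.id a) = (toList a).map Arr.id := by
  rw [comps, toList, List.map_ofFn]
  exact congrArg List.ofFn (funext fun i => (comp_id' a i).mk_eq)

theorem id_eq_ar {n : ℕ} (x : Fin n → X) : Arr.id (⟨n, x⟩ : EObj π X) = ar π 1 (Arr.id ∘ x) :=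
  arr_ext rfl (by simp [toList, List.map_ofFn])

theorem ar_comp {n : ℕ} (g g' : Λ n) (f f' : Fin n → Arr X)
    (h : ∀ i, (f i).cod = (f' (π n g i)).dom) :
    ar π g f ⋆ ar π g' f' = ar π (g' * g) fun i => f i ⋆ f' (π n g i) := by
  have e : (ar π g f).cod = (ar π g' f').dom := congrArg (EObj.mk n) (funext fun i => by
    simpa using h ((π n g).symm i))
  have h₁ : ar π g f = ⟨(⟨rfl, g, fun i => (f i).hom ≫ eqToHom (h i)⟩ :
      Hom (⟨n, dom ∘ f⟩ : EObj π X) ⟨n, dom ∘ f'⟩)⟩ := by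
    refine (mk_eq_ar (a := ⟨n, dom ∘ f⟩) (b := ⟨n, dom ∘ f'⟩)
      ⟨rfl, g, fun i => (f i).hom ≫ eqToHom (h i)⟩).symm ▸ ?_
    simp
  rw [h₁, ar]
  refine (mk_comp_mk _ _).trans ((mk_eq_ar _).trans (congrArg (ar π _) (funext fun i => ?_)))
  refine (Hom.Comp.comp ⟨rfl, Category.comp_id _⟩ ⟨rfl, Category.comp_id _⟩).mk_eq.trans ?_
  rw [← Category.assoc, mk_comp_eqToHom, Category.assoc, Arr.comp, dif_pos (h i)]
  rfl

variable [G : CoboundaryGroups π]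

theorem forget_strict : IsStrictCoboundaryFunctor (forget π X) :=
  .of_arr rfl (fun _ _ => rfl) fun _ _ => rfl

theorem toList_mul (a b : EObj π X) : toList (a * b) = toList a ++ toList b :=
  List.ofFn_fin_append _ _

theorem toList_prod (l : List (EObj π X)) : toList l.prod = (l.map toList).flatten := by
  induction l with
  | nil => rfl
  | cons a l ih => rw [List.prod_cons, toList_mul, ih, List.map_cons, List.flatten_cons]

theorem comps_mul (A B : Arr (EObj π X)) : comps (A * B) = comps A ++ comps B := by
  obtain ⟨F⟩ := A
  obtain ⟨F'⟩ := B
  rename_i a b a' b'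
  refine List.ofFn_add.trans (congrArg₂ _ ?_ ?_) <;>
    refine congrArg List.ofFn (funext fun i => ?_)
  · obtain ⟨j, φ, h⟩ := comp_self F i
    exact (h.tensor_left F').mk_eq.trans (Eq.trans (by simp) h.mk_eq.symm)
  · obtain ⟨j, φ, h⟩ := comp_self F' i
    exact (h.tensor_right F).mk_eq.trans (Eq.trans (by simp) h.mk_eq.symm)

theorem comps_σ (a b : EObj π X) : comps (σ a b) = (toList (a * b)).map Arr.id := by
  rw [toList_mul, List.map_append, toList, toList, List.map_ofFn, List.map_ofFn]
  refine List.ofFn_add.trans (congrArg₂ _ ?_ ?_) <;>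
    refine congrArg List.ofFn (funext fun i => ?_)
  · obtain ⟨h, h'⟩ := swap_left a b i
    exact h'.mk_eq.trans (by simp)
  · obtain ⟨h, h'⟩ := swap_right a b i
    exact h'.mk_eq.trans (by simp)

theorem comps_prod (L : List (Arr (EObj π X))) : comps L.prod = (L.map comps).flatten := by
  induction L with
  | nil => rfl
  | cons A L ih => rw [List.prod_cons, comps_mul, ih, List.map_cons, List.flatten_cons]

end EObj

end

/-! ### Block sums and commutors act by tensor products and commutors -/

theorem List.prod_ofFn_append {M : Type*} [Monoid M] {m n : ℕ} (z : Fin m → M) (w : Fin n → M) :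
    (List.ofFn (Fin.append z w)).prod = (List.ofFn z).prod * (List.ofFn w).prod := by
  rw [List.ofFn_fin_append, List.prod_append]

theorem CoboundaryGroups.append_comp_π_β_symm {Λ : ℕ → Type} [∀ n, Group (Λ n)]
    {π : ∀ n, Λ n →* Equiv.Perm (Fin n)} [G : CoboundaryGroups π] {α : Type*} {m n : ℕ}
    (g : Λ m) (h : Λ n) (z : Fin m → α) (w : Fin n → α) :
    Fin.append z w ∘ ⇑(π _ (G.β g h)).symm =
      Fin.append (z ∘ ⇑(π m g).symm) (w ∘ ⇑(π n h).symm) := by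
  refine ((Equiv.comp_symm_eq _ _ _).2 (funext fun i => ?_))
  induction i using Fin.addCases with
  | left i => simp [G.π_β_left]
  | right i => simp [G.π_β_right]

namespace Cactus

theorem β_one_s {m n p q : ℕ} (hp : 1 ≤ p) (hq : q ≤ n) :
    β (1 : Cactus m) (s n p q) = s (m + n) (p + m) (q + m) := by
  rw [β, map_one, one_mul, shift_s _ _ hp hq]

theorem β_s_one {m n p q : ℕ} (hp : 1 ≤ p) (hq : q ≤ m) :
    β (s m p q) (1 : Cactus n) = s (m + n) p q := by
  rw [β, map_one, mul_one, shift_s _ _ hp hq]; rfl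

theorem c_eq (m n : ℕ) : c m n = s (m + n) 1 (m + n) * β (s m 1 m) (s n 1 n) := by
  rw [c, β, shift_s _ _ le_rfl le_rfl, shift_s _ _ le_rfl le_rfl, mul_assoc, Nat.add_comm n,
    Nat.add_comm 1 m]
  rfl

theorem ofFn_comp_π_s {α : Type*} (n : ℕ) (z : Fin n → α) :
    List.ofFn (z ∘ ⇑(π n (s n 1 n)).symm) = (List.ofFn z).reverse := by
  refine List.ext_getElem (by simp) fun i h₁ h₂ => ?_
  simp only [List.length_ofFn] at h₁
  rw [List.getElem_reverse, List.getElem_ofFn, List.getElem_ofFn, Function.comp_apply]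
  refine congrArg z (Fin.ext ?_)
  have e : (π n (s n 1 n)).symm = π n (s n 1 n) := by
    rw [← Equiv.Perm.inv_def, ← map_inv, s_inv]
  refine (congrArg (fun σ : Equiv.Perm (Fin n) => (σ ⟨i, h₁⟩ : ℕ)) e).trans ?_
  rw [π_s_val le_rfl le_rfl]
  simp only [reverse, List.length_ofFn]
  split_ifs <;> omega

theorem append_comp_β {α : Type*} {m n : ℕ} (g : Cactus m) (h : Cactus n) (z : Fin m → α)
    (w : Fin n → α) : Fin.append z w ∘ ⇑(π _ (β g h)).symm =
      Fin.append (z ∘ ⇑(π m g).symm) (w ∘ ⇑(π n h).symm) :=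
  CoboundaryGroups.append_comp_π_β_symm (π := π) g h z w

theorem β_mul_β {m n : ℕ} (f f' : Cactus m) (g g' : Cactus n) :
    β f g * β f' g' = β (f * f') (g * g') := (CoboundaryGroups.β_mul (π := π) f f' g g').symm

end Cactus

namespace Arr

variable {D : Type u} [Category.{v} D] [StrictCoboundaryCategory D]

theorem act_s_self (n : ℕ) (z : Fin n → D) : act (Cactus.s n 1 n) z = rev (List.ofFn z) := by
  rcases Nat.lt_or_ge 1 n with h | h
  · rw [act_s le_rfl h le_rfl]
    simpa using seg_eq (D := D) (p := 1) (q := n) (a := []) (b := List.ofFn z) (d := []) rfl (by simp)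
  · rw [Cactus.s_of_ge h, act_one]
    interval_cases n
    · simp [rev]
    · simp [rev_singleton]

theorem seg_append_left {p q : ℕ} {l l' : List D} (hpq : p < q) (hq : q ≤ l.length) :
    seg p q (l ++ l') = seg p q l * id l'.prod := by
  obtain ⟨a, b, d, rfl, h₁, h₂⟩ := List.exists_append_append (show p - 1 ≤ q by omega) hq
  rw [List.append_assoc, seg_eq h₁ h₂, seg_eq h₁ h₂, List.prod_append, id_mul, mul_assoc, mul_assoc,
    mul_assoc]

theorem seg_append_right {p q : ℕ} {l l' : List D} (hp : 1 ≤ p) (hpq : p < q) (hq : q ≤ l'.length) :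
    seg (p + l.length) (q + l.length) (l ++ l') = id l.prod * seg p q l' := by
  obtain ⟨a, b, d, rfl, h₁, h₂⟩ := List.exists_append_append (show p - 1 ≤ q by omega) hq
  have h₃ : (l ++ a).length = p + l.length - 1 := by simp; omega
  rw [show l ++ (a ++ b ++ d) = l ++ a ++ b ++ d by simp, seg_eq h₃ (by simp at *; omega),
    seg_eq h₁ h₂, List.prod_append, id_mul, mul_assoc, mul_assoc, mul_assoc]

theorem act_β_left {m n : ℕ} (g : Cactus m) (z : Fin m → D) (w : Fin n → D) :
    act (Cactus.β g (1 : Cactus n)) (Fin.append z w) = act g z * id (List.ofFn w).prod := by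
  induction g using Cactus.s_induction with
  | h₁ =>
    rw [show Cactus.β (1 : Cactus m) (1 : Cactus n) = 1 by simp [Cactus.β], act_one,
      act_one, List.prod_ofFn_append, id_mul]
  | h₂ p q g hp hpq hq ih =>
    rw [← one_mul (1 : Cactus n), ← Cactus.β_mul_β, act_mul, act_mul, ih, Cactus.append_comp_β,
      Cactus.β_s_one hp hq, act_s hp hpq hq, act_s hp hpq (by omega), List.ofFn_fin_append,
      seg_append_left hpq (by simpa using hq), map_one,
      mul_comp_mul (by simp [dom_seg hpq]) (by simp; rfl)]
    exact congrArg _ (id_comp rfl)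

theorem act_β_right {m n : ℕ} (h : Cactus n) (z : Fin m → D) (w : Fin n → D) :
    act (Cactus.β (1 : Cactus m) h) (Fin.append z w) = id (List.ofFn z).prod * act h w := by
  induction h using Cactus.s_induction with
  | h₁ =>
    rw [show Cactus.β (1 : Cactus m) (1 : Cactus n) = 1 by simp [Cactus.β], act_one,
      act_one, List.prod_ofFn_append, id_mul]
  | h₂ p q g hp hpq hq ih =>
    have h := seg_append_right (l := List.ofFn z) (l' := List.ofFn (w ∘ ⇑(Cactus.π n g).symm)) hp hpq
      (by simpa using hq)
    rw [List.length_ofFn] at h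
    rw [← one_mul (1 : Cactus m), ← Cactus.β_mul_β, act_mul, act_mul, ih, Cactus.append_comp_β,
      Cactus.β_one_s hp hq, act_s hp hpq hq, act_s (by omega) (by omega) (by omega),
      List.ofFn_fin_append, map_one]
    refine (congrArg _ h).trans ?_
    rw [mul_comp_mul (by simp) (by simp [dom_seg hpq]), id_comp (by simp)]

theorem act_β {m n : ℕ} (g : Cactus m) (h : Cactus n) (z : Fin m → D) (w : Fin n → D) :
    act (Cactus.β g h) (Fin.append z w) = act g z * act h w := by
  have e : Cactus.β g h = Cactus.β g 1 * Cactus.β 1 h := by simp [Cactus.β]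
  rw [e, act_mul, act_β_right, Cactus.append_comp_β, act_β_left,
    mul_comp_mul (by simp; rfl) (by simp), comp_id (by simp), map_one]
  exact congrArg (· * _) (id_comp (dom_act _ _).symm)

theorem act_c {m n : ℕ} (z : Fin m → D) (w : Fin n → D) :
    act (Cactus.c m n) (Fin.append z w) = σ (List.ofFn z).prod (List.ofFn w).prod := by
  rw [Cactus.c_eq, act_mul, act_β, act_s_self, act_s_self, act_s_self,
    Cactus.append_comp_β, List.ofFn_fin_append, Cactus.ofFn_comp_π_s, Cactus.ofFn_comp_π_s, rev_append,
    ← comp_assoc (by simp) (by simp), mul_comp_mul (by simp) (by simp), rev_rev, rev_rev,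
    List.reverse_reverse, List.reverse_reverse, ← id_mul, id_comp (by simp)]

end Arr

/-! ### The cactus groups from the free strict coboundary category on one object -/

namespace BObj

open Cactus

/-- Reversing a string of natural numbers in `BJ`: each block is reversed, and then everything. -/
theorem rev_eq (l : List (BObj Cactus.π)) :
    rev l = (l.map fun a => ar Cactus.π a.n (s a.n 1 a.n)).prod ⋆
      ar Cactus.π l.prod.n (s l.prod.n 1 l.prod.n) := by
  induction l with
  | nil => exact (id_comp (x := (1 : BObj Cactus.π)) rfl).symm
  | cons a l ih =>
    have hr : l.reverse.prod = l.prod := ext_n (by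
      rw [n_prod, n_prod, List.map_reverse, List.sum_reverse])
    have h : Arr.id a * ar Cactus.π l.prod.n (s l.prod.n 1 l.prod.n) ⋆ σ a l.prod =
        ar Cactus.π a.n (s a.n 1 a.n) * Arr.id l.prod ⋆
          ar Cactus.π (a.n + l.prod.n) (s (a.n + l.prod.n) 1 (a.n + l.prod.n)) := by
      rw [σ_eq_ar, id_eq_ar, id_eq_ar, ar_mul_ar, ar_mul_ar, ar_comp, ar_comp]
      refine congrArg (ar Cactus.π _) ?_
      change Cactus.c _ _ * Cactus.β 1 _ = _ * Cactus.β _ 1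
      rw [c_eq, mul_assoc, β_mul_β, mul_one, s_mul_self]
    have hd : ((l.map fun a => ar Cactus.π a.n (s a.n 1 a.n)).prod).cod = l.prod := by
      rw [cod_prod, List.map_map]; exact congrArg _ (List.map_id l)
    rw [rev, ih, hr, ← id_comp (x := a) (A := Arr.id a) rfl,
      ← mul_comp_mul (by rfl) (by rw [hd]; rfl),
      comp_assoc (by simp [hd]) (by rfl), h, ← comp_assoc (by simp [hd]) (by rfl),
      mul_comp_mul (by rfl) (by rw [hd]; rfl), comp_id hd, id_comp (by rfl)]
    rfl

/-- Tensoring with identities shifts the generator `s_{1,k}`. -/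
theorem id_mul_ar_s_mul_id (x y : BObj Cactus.π) (k N : ℕ) (h : x.n + k + y.n = N) :
    Arr.id x * ar Cactus.π k (s k 1 k) * Arr.id y = ar Cactus.π N (s N (x.n + 1) (x.n + k)) := by
  subst h
  rw [id_eq_ar, id_eq_ar, ar_mul_ar, ar_mul_ar]
  refine congrArg (ar Cactus.π _) ?_
  change Cactus.β (Cactus.β 1 _) 1 = _
  rw [β_one_s le_rfl le_rfl, β_s_one (by omega) (by omega), Nat.add_comm 1, Nat.add_comm k]

/-- On the `n`-th power of the object `1` of `BJ`, an element of `J_n` acts by itself. -/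
theorem act_one_eq_ar {n : ℕ} (g : Cactus n) :
    act g (fun _ => (⟨1⟩ : BObj Cactus.π)) = ar Cactus.π n g := by
  have h₀ : ∀ k, ((List.replicate k (⟨1⟩ : BObj Cactus.π)).prod).n = k := fun k => by
    rw [n_prod, List.map_replicate, List.sum_replicate]
    simp
  have h₁ : ∀ k, (List.replicate k (⟨1⟩ : BObj Cactus.π)).prod = ⟨k⟩ := fun k => ext_n (h₀ k)
  induction g using Cactus.s_induction with
  | h₁ => rw [act_one, List.ofFn_const, h₁]; rfl
  | h₂ p q g hp hpq hq ih =>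
    rw [act_mul, ih, show (fun _ => (⟨1⟩ : BObj Cactus.π)) ∘ ⇑(π n g).symm = fun _ => ⟨1⟩ from rfl,
      act_s hp hpq hq, ← ar_comp, List.ofFn_const, seg, List.take_replicate, List.take_replicate,
      List.drop_replicate, List.drop_replicate, rev_eq, h₁, h₁, h₁, List.map_replicate,
      s_of_ge (p := 1) le_rfl, ← id_eq_ar ⟨1⟩, ← List.map_replicate, ← id_prod, h₁,
      id_comp (by rfl), id_mul_ar_s_mul_id _ _ _ n (by simp; omega)]
    dsimp only
    rw [show min (p - 1) n + 1 = p by omega,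
      show min (p - 1) n + (min q n - (p - 1)) = q by omega]

end BObj

/-! ### Freeness -/

namespace IsMonoidalTransformation

variable {C : Type u} [Category.{v} C] {D : Type u'} [Category.{v'} D]
  [StrictCoboundaryCategory C] [StrictCoboundaryCategory D] {F G : C ⥤ D}
  {hF : IsStrictCoboundaryFunctor F} {hG : IsStrictCoboundaryFunctor G} {θ : F ⟶ G}

theorem of_mk (h₁ : (⟨θ.app 1⟩ : Arr D) = 1)
    (h₂ : ∀ x y, (⟨θ.app (x * y)⟩ : Arr D) = ⟨θ.app x⟩ * ⟨θ.app y⟩) :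
    IsMonoidalTransformation hF hG θ where
  app_unit := by
    refine (hom_eq h₁).trans ?_
    change _ ≫ 𝟙 _ ≫ _ = _
    rw [Category.id_comp, eqToHom_trans]
  app_tensor x y := hom_eq (h₂ x y)

theorem mk_one (h : IsMonoidalTransformation hF hG θ) : (⟨θ.app 1⟩ : Arr D) = 1 :=
  (congrArg Arr.mk h.app_unit).trans ((mk_eqToHom _).trans (congrArg Arr.id hF.obj_unit))

theorem mk_mul (h : IsMonoidalTransformation hF hG θ) (x y : C) :
    (⟨θ.app (x * y)⟩ : Arr D) = ⟨θ.app x⟩ * ⟨θ.app y⟩ :=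
  (congrArg Arr.mk (h.app_tensor x y)).trans
    ((mk_eqToHom_comp _ _).trans (mk_comp_eqToHom _ _))

theorem mk_prod (h : IsMonoidalTransformation hF hG θ) (l : List C) :
    (⟨θ.app l.prod⟩ : Arr D) = (l.map fun x => (⟨θ.app x⟩ : Arr D)).prod :=
  map_list_prod (⟨⟨fun x => ⟨θ.app x⟩, h.mk_one⟩, h.mk_mul⟩ : C →* Arr D) l

end IsMonoidalTransformation

theorem CategoryTheory.NatTrans.exists_of_arr {C : Type u} [Category.{v} C] {D : Type u'}
    [Category.{v'} D] {F G : C ⥤ D} (T : C → Arr D) (hd : ∀ x, (T x).dom = F.obj x)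
    (hc : ∀ x, (T x).cod = G.obj x) (h : ∀ A : Arr C, F.arr A ⋆ T A.cod = T A.dom ⋆ G.arr A) :
    ∃ α : F ⟶ G, ∀ x, (⟨α.app x⟩ : Arr D) = T x :=
  ⟨{ app x := (T x).toHom (hd x) (hc x)
     naturality x y f := mk_inj (by
      rw [← mk_comp_mk, ← mk_comp_mk, mk_toHom, mk_toHom]
      exact h ⟨f⟩) }, fun x => mk_toHom _ (hd x) (hc x)⟩

/-- Functoriality of the `n`-fold tensor product. -/
theorem List.prod_ofFn_comp {D : Type u} [Category.{v} D] [StrictCoboundaryCategory D] {n : ℕ}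
    {A B : Fin n → Arr D} (h : ∀ i, (A i).cod = (B i).dom) :
    (List.ofFn A).prod ⋆ (List.ofFn B).prod = (List.ofFn fun i => A i ⋆ B i).prod := by
  induction n with
  | zero => exact Arr.id_comp (x := (1 : D)) rfl
  | succ n ih =>
    rw [List.ofFn_succ, List.ofFn_succ, List.ofFn_succ, List.prod_cons, List.prod_cons,
      List.prod_cons, ← ih fun i => h i.succ, mul_comp_mul (h 0)]
    simp only [cod_prod, dom_prod, List.map_ofFn]
    exact congrArg (fun l => (List.ofFn l).prod) (funext fun i => h i.succ)

namespace Arr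

theorem dom_prod_ofFn {D : Type u} [Category.{v} D] [StrictCoboundaryCategory D] {n : ℕ}
    (A : Fin n → Arr D) : (List.ofFn A).prod.dom = (List.ofFn (dom ∘ A)).prod := by
  rw [dom_prod, List.map_ofFn]

theorem cod_prod_ofFn {D : Type u} [Category.{v} D] [StrictCoboundaryCategory D] {n : ℕ}
    (A : Fin n → Arr D) : (List.ofFn A).prod.cod = (List.ofFn (cod ∘ A)).prod := by
  rw [cod_prod, List.map_ofFn]

/-- Exchanging the two middle factors in a composite of four morphisms. -/
theorem comp_exchange {D : Type u} [Category.{v} D] {P Q P' a a' b : Arr D}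
    (h : Q ⋆ a' = a ⋆ P') (h₁ : P.cod = Q.dom) (h₂ : Q.cod = a'.dom) (h₃ : a'.cod = b.dom)
    (h₄ : a.cod = P'.dom) : P ⋆ Q ⋆ (a' ⋆ b) = P ⋆ a ⋆ (P' ⋆ b) := by
  have hd : Q.dom = a.dom := by simpa using congrArg dom h
  have hc : a'.cod = P'.cod := by simpa [h₂, h₄] using congrArg cod h
  rw [comp_assoc h₁ (by simp [h₂]), ← comp_assoc h₂ h₃, h, comp_assoc (h₁.trans hd) (by simp [h₄]),
    comp_assoc h₄ (hc.symm.trans h₃)]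

end Arr

namespace EObj

variable {X : Type u} [Category.{v} X] {D : Type u'} [Category.{v'} D] [StrictCoboundaryCategory D]

/-- A morphism `(g; f₁, …, fₙ)` of `EJ(X)` acts in `D` by the tensor product of the images of the
`fᵢ`, followed by the action of `g`. -/
def ev (K : X ⥤ D) (A : Arr (EObj Cactus.π X)) : Arr D :=
  (List.ofFn (K.arr ∘ cmp A)).prod ⋆ act (Hom.g A.hom) (K.obj ∘ cod ∘ cmp A)

theorem ev_ar (K : X ⥤ D) {n : ℕ} (g : Cactus n) (f : Fin n → Arr X) :
    ev K (ar Cactus.π g f) = (List.ofFn (K.arr ∘ f)).prod ⋆ act g (K.obj ∘ cod ∘ f) := by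
  have h := cmp_ar (π := Cactus.π) g f
  unfold ev
  rw [h]
  rfl

theorem dom_ev (K : X ⥤ D) (A : Arr (EObj Cactus.π X)) :
    (ev K A).dom = (List.ofFn (K.obj ∘ A.dom.x)).prod := by
  obtain ⟨n, g, f, rfl⟩ := exists_ar A
  rw [ev_ar, dom_comp, dom_prod, List.map_ofFn]
  rfl

theorem cod_ev (K : X ⥤ D) (A : Arr (EObj Cactus.π X)) :
    (ev K A).cod = (List.ofFn (K.obj ∘ A.cod.x)).prod := by
  obtain ⟨n, g, f, rfl⟩ := exists_ar A
  rw [ev_ar, cod_comp (by rw [cod_prod, List.map_ofFn, dom_act]; rfl), cod_act]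
  rfl

theorem ev_comp (K : X ⥤ D) (A B : Arr (EObj Cactus.π X)) (h : A.cod = B.dom) :
    ev K (A ⋆ B) = ev K A ⋆ ev K B := by
  obtain ⟨m, g, f, rfl⟩ := exists_ar A
  obtain ⟨n, g', f', rfl⟩ := exists_ar B
  obtain rfl : m = n := congrArg EObj.n h
  have h₀ : cod ∘ f ∘ ⇑(Cactus.π m g).symm = dom ∘ f' := by
    simpa using h
  obtain ⟨e, rfl⟩ : ∃ e : Fin m → Arr X, f' = e ∘ ⇑(Cactus.π m g).symm :=
    ⟨f' ∘ ⇑(Cactus.π m g), by funext i; simp⟩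
  have h₁ : ∀ i, (f i).cod = (e i).dom := fun i => by simpa using congrFun h₀ (Cactus.π m g i)
  have h₂ : cod ∘ f = dom ∘ e := funext h₁
  have h₃ : (List.ofFn (K.arr ∘ f)).prod ⋆ (List.ofFn (K.arr ∘ e)).prod =
      (List.ofFn (K.arr ∘ fun i => f i ⋆ e i)).prod :=
    (List.prod_ofFn_comp fun i => congrArg K.obj (h₁ i)).trans
      (congrArg (fun l => (List.ofFn l).prod) (funext fun i => (K.arr_comp (h₁ i)).symm))
  have h₄ : cod ∘ (fun i => f i ⋆ e i) = cod ∘ e := funext fun i => cod_comp (h₁ i)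
  have h₅ : (fun i => f i ⋆ (e ∘ ⇑(Cactus.π m g).symm) (Cactus.π m g i)) = fun i => f i ⋆ e i := by
    simp
  rw [ar_comp _ _ _ _ (by simpa using h₁), ev_ar, ev_ar, ev_ar, act_mul, h₅, h₄, ← h₃, h₂]
  refine comp_exchange (act_natural g (K.arr ∘ e)) ?_ ?_ ?_ ?_
  · rw [cod_prod_ofFn, dom_prod_ofFn]
    exact congrArg (fun z => (List.ofFn (K.obj ∘ z)).prod) h₂
  · rw [cod_prod_ofFn, dom_act]; rfl
  · rw [cod_act, dom_act]
  · rw [cod_act, dom_prod_ofFn]; rfl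

/-- The strict coboundary functor `EJ(X) ⥤ D` extending a functor `X ⥤ D`. -/
def lift (K : X ⥤ D) : EObj Cactus.π X ⥤ D :=
  Functor.ofArr (fun a => (List.ofFn (K.obj ∘ a.x)).prod) (ev K) (dom_ev K) (cod_ev K)
    (fun a => by
      have h := ev_ar K 1 (Arr.id ∘ a.x)
      rw [← id_eq_ar, act_one] at h
      refine h.trans ?_
      rw [comp_id (by rw [cod_prod_ofFn]; rfl), id_prod, List.map_ofFn]
      exact congrArg (fun z => (List.ofFn z).prod) (funext fun i => K.arr_id _))
    (ev_comp K)

theorem lift_arr (K : X ⥤ D) (A : Arr (EObj Cactus.π X)) : (lift K).arr A = ev K A :=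
  Functor.ofArr_arr _ _ _ _ _ _ _

theorem ar_mul_ar {Λ : ℕ → Type} [∀ n, Group (Λ n)] {π : ∀ n, Λ n →* Equiv.Perm (Fin n)}
    [G : CoboundaryGroups π] {m n : ℕ} (g : Λ m) (h : Λ n) (f : Fin m → Arr X) (f' : Fin n → Arr X) :
    ar π g f * ar π h f' = ar π (G.β g h) (Fin.append f f') :=
  arr_ext rfl (by rw [comps_mul, comps_ar, comps_ar, comps_ar, List.ofFn_fin_append])

theorem σ_eq_ar {Λ : ℕ → Type} [∀ n, Group (Λ n)] {π : ∀ n, Λ n →* Equiv.Perm (Fin n)}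
    [G : CoboundaryGroups π] (a b : EObj π X) :
    σ a b = ar π (G.c a.n b.n) (Arr.id ∘ Fin.append a.x b.x) :=
  arr_ext (BObj.σ_eq_ar (⟨a.n⟩ : BObj π) ⟨b.n⟩) (by
    rw [comps_σ, comps_ar, toList, List.map_ofFn]; rfl)

theorem comp_append {α β : Type*} (φ : α → β) {m n : ℕ} (z : Fin m → α) (w : Fin n → α) :
    φ ∘ Fin.append z w = Fin.append (φ ∘ z) (φ ∘ w) := by
  funext i
  induction i using Fin.addCases <;> simp

theorem lift_strict (K : X ⥤ D) : IsStrictCoboundaryFunctor (lift K) := by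
  refine .of_arr rfl (fun A B => ?_) fun a b => ?_
  · obtain ⟨m, g, f, rfl⟩ := exists_ar A
    obtain ⟨n, g', f', rfl⟩ := exists_ar B
    rw [ar_mul_ar, lift_arr, lift_arr, lift_arr, ev_ar, ev_ar, ev_ar, comp_append, comp_append,
      comp_append, List.prod_ofFn_append,
      show CoboundaryGroups.β (π := Cactus.π) g g' = Cactus.β g g' from rfl, act_β,
      mul_comp_mul (by rw [cod_prod_ofFn, dom_act]; rfl) (by rw [cod_prod_ofFn, dom_act]; rfl)]
  · rw [lift_arr, σ_eq_ar, ev_ar,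
      show CoboundaryGroups.c (π := Cactus.π) a.n b.n = Cactus.c a.n b.n from rfl,
      show K.obj ∘ cod ∘ Arr.id ∘ Fin.append a.x b.x = K.obj ∘ Fin.append a.x b.x from rfl,
      comp_append K.obj, act_c,
      show K.arr ∘ Arr.id ∘ Fin.append a.x b.x = Arr.id ∘ K.obj ∘ Fin.append a.x b.x from
        funext fun i => K.arr_id _, ← List.map_ofFn, ← id_prod, comp_append K.obj, List.prod_ofFn_append,
      id_comp (by simp)]
    rfl

theorem unit_arr {Λ : ℕ → Type} [∀ n, Group (Λ n)] {π : ∀ n, Λ n →* Equiv.Perm (Fin n)}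
    (A : Arr X) : (unit π X).arr A = ar π (1 : Λ 1) fun _ => A :=
  arr_ext rfl (by rw [comps_ar]; rfl)

theorem unit_lift (K : X ⥤ D) : unit Cactus.π X ⋙ lift K = K :=
  Functor.ext_arr fun A => by
    rw [Functor.comp_arr, lift_arr, unit_arr, ev_ar, act_one, comp_id (by rw [cod_prod_ofFn]; rfl)]
    simp

/-! ### Morphisms with trivial components -/

section Pure

variable {Λ : ℕ → Type} [∀ n, Group (Λ n)] {π : ∀ n, Λ n →* Equiv.Perm (Fin n)}

/-- A morphism of `EΛ(X)` all of whose components in `X` are identities. -/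
def Pure (A : Arr (EObj π X)) : Prop := comps A = (toList A.dom).map Arr.id

/-- Composing with a morphism whose components are identities, such as one built from commutors, does
not change the components. -/
theorem comps_comp_of_pure {A B : Arr (EObj π X)} (h : A.cod = B.dom) (hB : Pure B) :
    comps (A ⋆ B) = comps A := by
  obtain ⟨m, g, f, rfl⟩ := exists_ar A
  obtain ⟨n, g', f', rfl⟩ := exists_ar B
  obtain rfl : m = n := congrArg EObj.n h
  have h₀ : cod ∘ f ∘ ⇑(π m g).symm = dom ∘ f' := by simpa using h
  have h₁ : ∀ i, (f i).cod = (f' (π m g i)).dom := fun i => by simpa using congrFun h₀ (π m g i)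
  have h₂ : f' = Arr.id ∘ dom ∘ f' := List.ofFn_injective (by
    rwa [Pure, comps_ar, dom_ar, toList, List.map_ofFn] at hB)
  rw [ar_comp _ _ _ _ h₁, comps_ar, comps_ar]
  refine congrArg List.ofFn (funext fun i => ?_)
  rw [h₂]
  exact comp_id (h₁ i)

theorem Pure.comp {A B : Arr (EObj π X)} (h : A.cod = B.dom) (hA : Pure A) (hB : Pure B) :
    Pure (A ⋆ B) := by
  rw [Pure, comps_comp_of_pure h hB, dom_comp]; exact hA

theorem pure_id (a : EObj π X) : Pure (Arr.id a) := comps_id a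

variable [G : CoboundaryGroups π]

theorem Pure.mul {A B : Arr (EObj π X)} (hA : Pure A) (hB : Pure B) : Pure (A * B) := by
  rw [Pure, comps_mul, hA, hB, dom_mul, toList_mul, List.map_append]

theorem pure_σ (a b : EObj π X) : Pure (σ a b) := comps_σ a b

theorem pure_rev (l : List (EObj π X)) : Pure (rev l) := by
  induction l with
  | nil => rfl
  | cons a l ih => exact ((pure_id a).mul ih).comp (by simp) (pure_σ _ _)

/-- The action on objects of `EΛ(X)` only permutes their entries. -/
theorem pure_act {n : ℕ} (g : Cactus n) (z : Fin n → EObj π X) : Pure (act g z) := by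
  induction g using Cactus.s_induction with
  | h₁ => rw [act_one]; exact pure_id _
  | h₂ p q g hp hpq hq ih =>
    rw [act_mul, act_s hp hpq hq, seg]
    refine ih.comp ?_ (((pure_id _).mul (pure_rev _)).mul (pure_id _))
    exact (cod_act _ _).trans (dom_seg hpq _).symm

end Pure

theorem flatten_ofFn_singleton {α : Type*} {n : ℕ} (x : Fin n → α) :
    (List.ofFn fun i => [x i]).flatten = List.ofFn x := by
  induction n with
  | zero => rfl
  | succ n ih => rw [List.ofFn_succ, List.ofFn_succ, List.flatten_cons, ih]; rfl

theorem prod_single (n : ℕ) (x : Fin n → X) :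
    (List.ofFn fun i => single Cactus.π (x i)).prod = ⟨n, x⟩ := by
  refine toList_injective ?_
  rw [toList_prod, List.map_ofFn]
  exact flatten_ofFn_singleton x

/-- Every morphism of `EJ(X)` is obtained from its components by the tensor product and the action of
the cactus group. -/
theorem ar_eq_prod_comp_act {n : ℕ} (g : Cactus n) (f : Fin n → Arr X) :
    ar Cactus.π g f = (List.ofFn ((unit Cactus.π X).arr ∘ f)).prod ⋆
      act g ((unit Cactus.π X).obj ∘ cod ∘ f) := by
  have hd : ((List.ofFn ((unit Cactus.π X).arr ∘ f)).prod).cod =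
      (act g ((unit Cactus.π X).obj ∘ cod ∘ f)).dom := by
    rw [cod_prod_ofFn, dom_act]; rfl
  refine arr_ext ?_ ?_
  · have h : ((List.ofFn ((unit Cactus.π X).arr ∘ f)).map (forget Cactus.π X).arr) =
        (List.ofFn fun _ : Fin n => (⟨1⟩ : BObj Cactus.π)).map Arr.id := by
      rw [List.map_ofFn, List.map_ofFn]; rfl
    rw [Functor.arr_comp _ hd, forget_strict.arr_act, forget_strict.arr_prod, h, ← id_prod]
    exact (BObj.act_one_eq_ar g).symm.trans (id_comp (dom_act _ _).symm).symm
  · rw [comps_comp_of_pure hd (pure_act _ _), comps_prod, comps_ar, List.map_ofFn]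
    exact (flatten_ofFn_singleton f).symm

end EObj

namespace IsStrictCoboundaryFunctor

open EObj

variable {X : Type u} [Category.{v} X] {D : Type u'} [Category.{v'} D] [StrictCoboundaryCategory D]
  {F : EObj Cactus.π X ⥤ D}

theorem obj_eq (hF : IsStrictCoboundaryFunctor F) (a : EObj Cactus.π X) :
    F.obj a = (List.ofFn fun i => (unit Cactus.π X ⋙ F).obj (a.x i)).prod := by
  refine (congrArg F.obj (prod_single a.n a.x).symm).trans ?_
  rw [hF.obj_prod, List.map_ofFn]
  rfl

theorem arr_ar (hF : IsStrictCoboundaryFunctor F) {n : ℕ} (g : Cactus n) (f : Fin n → Arr X) :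
    F.arr (ar Cactus.π g f) = (List.ofFn ((unit Cactus.π X ⋙ F).arr ∘ f)).prod ⋆
      act g ((unit Cactus.π X ⋙ F).obj ∘ cod ∘ f) := by
  rw [ar_eq_prod_comp_act, F.arr_comp (by rw [cod_prod_ofFn, dom_act]; rfl), hF.arr_prod,
    hF.arr_act, List.map_ofFn]
  rfl

/-- Uniqueness in the freeness of `EJ(X)`. -/
theorem eq_lift (hF : IsStrictCoboundaryFunctor F) : F = lift (unit Cactus.π X ⋙ F) :=
  Functor.ext_arr fun A => by
    obtain ⟨n, g, f, rfl⟩ := exists_ar A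
    rw [lift_arr, ev_ar, hF.arr_ar]

end IsStrictCoboundaryFunctor

namespace EObj

theorem isFreeOnCategory (X : Type u) [Category.{v} X] :
    IsFreeOnCategory.{v, u, v', u'} (unit Cactus.π X) where
  functor {D} _ _ K := ⟨lift K, ⟨lift_strict K, unit_lift K⟩, by
    rintro F ⟨hF, rfl⟩
    exact hF.eq_lift⟩
  transformation {D} _ _ F G hF hG θ := by
    -- The extension of `θ` to a string is the tensor product of its components.
    let Θ : X → Arr D := fun x => ⟨θ.app x⟩
    obtain ⟨α, hα⟩ := NatTrans.exists_of_arr (F := F) (G := G) (fun a => (List.ofFn (Θ ∘ a.x)).prod)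
      (fun a => by rw [dom_prod_ofFn, hF.obj_eq]; rfl)
      (fun a => by rw [cod_prod_ofFn, hG.obj_eq]; rfl) (fun A => by
        obtain ⟨n, g, f, rfl⟩ := exists_ar A
        have h : ∀ A : Arr X, (unit Cactus.π X ⋙ F).arr A ⋆ Θ A.cod =
            Θ A.dom ⋆ (unit Cactus.π X ⋙ G).arr A := fun A =>
          (mk_comp_mk _ _).trans ((congrArg Arr.mk (θ.naturality A.hom)).trans (mk_comp_mk _ _).symm)
        have h' := act_natural g (Θ ∘ cod ∘ f)
        rw [hF.arr_ar, hG.arr_ar, comp_assoc (by rw [cod_prod_ofFn, dom_act]; rfl)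
          (by rw [cod_act, dom_prod_ofFn]; rfl)]
        refine (congrArg _ h'.symm).trans ?_
        change _ = (List.ofFn (Θ ∘ dom ∘ f)).prod ⋆ _
        rw [← comp_assoc (by rw [cod_prod_ofFn, dom_prod_ofFn]; rfl)
            (by rw [cod_prod_ofFn, dom_act]),
          ← comp_assoc (by rw [cod_prod_ofFn, dom_prod_ofFn]; rfl)
            (by rw [cod_prod_ofFn, dom_act]; rfl),
          List.prod_ofFn_comp (fun i => rfl), List.prod_ofFn_comp (fun i => rfl)]
        exact congrArg (fun l => (List.ofFn l).prod ⋆ _) (funext fun i => h (f i)))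
    refine ⟨α, ⟨.of_mk (hα 1) fun x y => ?_, ?_⟩, ?_⟩
    · rw [hα, hα, hα, ← List.prod_ofFn_append, ← comp_append]
      rfl
    · ext x
      refine mk_inj ((hα _).trans ?_)
      exact mul_one (Θ x)
    · rintro β ⟨hβ, rfl⟩
      ext a
      refine mk_inj (Eq.trans ?_ (hα a).symm)
      have h := hβ.mk_prod (List.ofFn fun i => single Cactus.π (a.x i))
      rw [prod_single, List.map_ofFn] at h
      exact h

end EObj

namespace BObj

variable {D : Type u} [Category.{v} D] [StrictCoboundaryCategory D]

/-- The strict coboundary functor `BJ ⥤ D` sending `1` to `x`. -/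
def lift (x : D) : BObj Cactus.π ⥤ D :=
  Functor.ofArr (fun a => (List.ofFn fun _ : Fin a.n => x).prod)
    (fun A => act (Hom.g A.hom) fun _ => x) (fun A => dom_act _ _)
    (fun A => by
      obtain ⟨n, g, rfl⟩ := exists_ar A
      exact cod_act _ _)
    (fun a => act_one _) (fun A B h => by
      obtain ⟨m, g, rfl⟩ := exists_ar A
      obtain ⟨n, g', rfl⟩ := exists_ar B
      obtain rfl : m = n := congrArg BObj.n h
      rw [ar_comp]
      exact act_mul g' g _)

theorem lift_ar (x : D) {n : ℕ} (g : Cactus n) :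
    (lift x).arr (ar Cactus.π n g) = act g fun _ => x := Functor.ofArr_arr _ _ _ _ _ _ _

theorem append_const {α : Type*} (x : α) (m n : ℕ) :
    (fun _ : Fin (m + n) => x) = Fin.append (fun _ => x) fun _ => x := by
  funext i
  induction i using Fin.addCases <;> simp

theorem lift_strict (x : D) : IsStrictCoboundaryFunctor (lift x) := by
  refine .of_arr rfl (fun A B => ?_) fun a b => ?_
  · obtain ⟨m, g, rfl⟩ := exists_ar A
    obtain ⟨n, g', rfl⟩ := exists_ar B
    rw [ar_mul_ar, lift_ar, lift_ar, lift_ar, append_const]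
    exact act_β _ _ _ _
  · rw [σ_eq_ar, lift_ar, append_const]
    exact act_c _ _

theorem prod_one (n : ℕ) : (List.ofFn fun _ : Fin n => (⟨1⟩ : BObj Cactus.π)).prod = ⟨n⟩ :=
  ext_n (by rw [n_prod, List.map_ofFn, List.sum_ofFn]; simp)

/-- The group `J_n` is generated by commutors and tensor products, so that a strict coboundary
functor on `BJ` is determined by its value at `1`. -/
theorem arr_ar_eq {F : BObj Cactus.π ⥤ D} (hF : IsStrictCoboundaryFunctor F) {n : ℕ}
    (g : Cactus n) : F.arr (ar Cactus.π n g) = act g fun _ => F.obj ⟨1⟩ := by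
  rw [← act_one_eq_ar, hF.arr_act]
  rfl

theorem isFreeOnObject : IsFreeOnObject.{0, 0, v', u'} (⟨1⟩ : BObj Cactus.π) where
  functor {D} _ _ x := ⟨lift x, ⟨lift_strict x, mul_one x⟩, by
    rintro F ⟨hF, rfl⟩
    refine Functor.ext_arr fun A => ?_
    obtain ⟨n, g, rfl⟩ := exists_ar A
    rw [arr_ar_eq hF, lift_ar]⟩
  transformation {D} _ _ F G hF hG f := by
    have h : ∀ {F : BObj Cactus.π ⥤ D} (_ : IsStrictCoboundaryFunctor F) (a : BObj Cactus.π),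
        (List.ofFn fun _ : Fin a.n => F.obj ⟨1⟩).prod = F.obj a := fun {F} hF a => by
      refine Eq.trans ?_ (congrArg F.obj (prod_one a.n))
      rw [hF.obj_prod, List.map_ofFn]
      rfl
    obtain ⟨α, hα⟩ := NatTrans.exists_of_arr (F := F) (G := G)
      (fun a => (List.ofFn fun _ : Fin a.n => (⟨f⟩ : Arr D)).prod)
      (fun a => by rw [dom_prod_ofFn]; exact h hF a)
      (fun a => by rw [cod_prod_ofFn]; exact h hG a) (fun A => by
        obtain ⟨n, g, rfl⟩ := exists_ar A
        rw [arr_ar_eq hF, arr_ar_eq hG]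
        exact (act_natural g fun _ => ⟨f⟩).symm)
    refine ⟨α, ⟨.of_mk (hα 1) fun x y => ?_, ?_⟩, ?_⟩
    · rw [hα, hα, hα, ← List.prod_ofFn_append, ← append_const]
      rfl
    · exact mk_inj ((hα _).trans (mul_one _))
    · rintro β ⟨hβ, rfl⟩
      ext a
      refine mk_inj (Eq.trans ?_ (hα a).symm)
      have h := hβ.mk_prod (List.ofFn fun _ : Fin a.n => (⟨1⟩ : BObj Cactus.π))
      rw [prod_one, List.map_ofFn] at h
      exact h

end BObj

/-! ### The operadic composition of the cactus groups -/

theorem Cactus.partialSum_eq {n : ℕ} (k : Fin n → ℕ) (m : ℕ) :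
    partialSum k m = ((List.ofFn k).take m).sum := by
  rw [List.sum_take_ofFn, partialSum, Finset.sum_filter]

theorem List.getElem_flatten_ofFn {α : Type*} {n : ℕ} {k : Fin n → ℕ} (f : ∀ i, Fin (k i) → α)
    (i : Fin n) (j : Fin (k i)) :
    ((List.ofFn fun i => List.ofFn (f i)).flatten)[partialSum k i + j]? = some (f i j) := by
  induction n with
  | zero => exact i.elim0
  | succ n ih =>
    rw [List.ofFn_succ, List.flatten_cons]
    induction i using Fin.cases with
    | zero =>
      have h : partialSum k (0 : Fin (n + 1)) = 0 := by simp [partialSum]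
      rw [h, Nat.zero_add, List.getElem?_append_left (by simp)]
      simp
    | succ i =>
      have h : partialSum k i.succ = k 0 + partialSum (fun i => k i.succ) i := by
        simp [partialSum, Fin.sum_univ_succ]
      rw [h, List.getElem?_append_right (by rw [List.length_ofFn]; omega), List.length_ofFn,
        show k 0 + partialSum (fun i => k i.succ) i + j - k 0 =
          partialSum (fun i => k i.succ) i + j by omega]
      exact ih (fun i => f i.succ) i j

theorem Cactus.val_finSigmaFinEquiv {n : ℕ} {k : Fin n → ℕ} (i : Fin n) (j : Fin (k i)) :
    (finSigmaFinEquiv ⟨i, j⟩ : ℕ) = partialSum k i + j := by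
  rw [finSigmaFinEquiv_apply, Cactus.partialSum_eq, ← Fin.ofFn_take_eq_take_ofFn i.2.le,
    List.sum_ofFn]
  rfl

/-- Enumerating the pairs `(i, j)` by `finSigmaFinEquiv` is concatenating lists. -/
theorem List.flatten_ofFn_ofFn {α : Type*} {n : ℕ} {k : Fin n → ℕ} (f : ∀ i, Fin (k i) → α) :
    (List.ofFn fun i => List.ofFn (f i)).flatten =
      List.ofFn fun t => f (finSigmaFinEquiv.symm t).1 (finSigmaFinEquiv.symm t).2 := by
  have hlen : ((List.ofFn fun i => List.ofFn (f i)).flatten).length = ∑ i, k i := by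
    simp [List.length_flatten, List.map_ofFn, List.sum_ofFn]
  refine List.ext_getElem (by simpa using hlen) fun t h₁ h₂ => ?_
  rw [hlen] at h₁
  obtain ⟨⟨i, j⟩, h⟩ := finSigmaFinEquiv.surjective (⟨t, h₁⟩ : Fin (∑ i, k i))
  obtain rfl : t = partialSum k i + j := by
    rw [← Cactus.val_finSigmaFinEquiv, h]
  rw [← Option.some_inj, List.getElem_ofFn, ← List.getElem?_eq_getElem, List.getElem_flatten_ofFn]
  have e : ∀ s, s = finSigmaFinEquiv ⟨i, j⟩ →
      f i j = f (finSigmaFinEquiv.symm s).1 (finSigmaFinEquiv.symm s).2 := by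
    rintro _ rfl; rw [Equiv.symm_apply_apply]
  exact congrArg some (e _ h.symm)

namespace Cactus

variable {n : ℕ} {k : Fin n → ℕ}

theorem dom_prod_comp_act (g : Cactus n) (f : ∀ i, Cactus (k i)) :
    ((List.ofFn fun i => BObj.ar π (k i) (f i)).prod ⋆ act g fun i => (⟨k i⟩ : BObj π)).dom.n =
      ∑ i, k i := by
  rw [dom_comp, dom_prod_ofFn, BObj.n_prod, List.map_ofFn, List.sum_ofFn]
  rfl

/-- The operadic composite `μ(g; f₁, …, fₙ)`: the tensor product of `f₁, …, fₙ` in `BJ`, followed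
by the action of `g`. -/
def μ (g : Cactus n) (f : ∀ i, Cactus (k i)) : Cactus (∑ i, k i) :=
  gcast (dom_prod_comp_act g f) (BObj.Hom.g
    ((List.ofFn fun i => BObj.ar π (k i) (f i)).prod ⋆ act g fun i => (⟨k i⟩ : BObj π)).hom)

theorem ar_μ (g : Cactus n) (f : ∀ i, Cactus (k i)) :
    BObj.ar π _ (μ g f) =
      (List.ofFn fun i => BObj.ar π (k i) (f i)).prod ⋆ act g fun i => (⟨k i⟩ : BObj π) := by
  rw [μ, BObj.ar_gcast]
  exact (BObj.mk_eq_ar _).symm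

/-- The composite `μ(g; f₁, …, fₙ)` computed with components in a category `X`, so that the effect of
its permutation on strings can be seen. -/
theorem _root_.EObj.ar_μ {X : Type u} [Category.{v} X] (g : Cactus n) (f : ∀ i, Cactus (k i))
    (e : ∀ i, Fin (k i) → Arr X) :
    EObj.ar π (μ g f) (fun t => e (finSigmaFinEquiv.symm t).1 (finSigmaFinEquiv.symm t).2) =
      (List.ofFn fun i => EObj.ar π (f i) (e i)).prod ⋆
        act g fun i => (⟨k i, cod ∘ e i ∘ ⇑(π _ (f i)).symm⟩ : EObj π X) := by
  have h : ((List.ofFn fun i => EObj.ar π (f i) (e i)).prod).cod =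
      (act g fun i => (⟨k i, cod ∘ e i ∘ ⇑(π _ (f i)).symm⟩ : EObj π X)).dom := by
    rw [cod_prod_ofFn, dom_act]; rfl
  refine EObj.arr_ext ?_ ?_
  · rw [EObj.forget_ar, Cactus.ar_μ, Functor.arr_comp _ h, EObj.forget_strict.arr_prod,
      EObj.forget_strict.arr_act, List.map_ofFn]
    rfl
  · rw [EObj.comps_comp_of_pure h (EObj.pure_act _ _), EObj.comps_prod, EObj.comps_ar, List.map_ofFn,
      ← List.flatten_ofFn_ofFn]
    refine congrArg (fun l => (List.ofFn l).flatten) (funext fun i => ?_)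
    exact (EObj.comps_ar _ _).symm

/-- The composite `μ(g; f₁, …, fₙ)` acts by the actions of the `fᵢ`, followed by that of `g`. It
suffices to apply the strict coboundary functor `EJ(D) ⥤ D` extending the identity to `EObj.ar_μ`. -/
theorem act_μ {D : Type u} [Category.{v} D] [StrictCoboundaryCategory D] (g : Cactus n)
    (f : ∀ i, Cactus (k i)) (z : ∀ i, Fin (k i) → D) :
    act (μ g f) (fun t => z (finSigmaFinEquiv.symm t).1 (finSigmaFinEquiv.symm t).2) =
      (List.ofFn fun i => act (f i) (z i)).prod ⋆
        act g fun i => (List.ofFn (z i ∘ ⇑(π _ (f i)).symm)).prod := by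
  have hl := EObj.lift_strict (𝟭 D)
  have hev : ∀ {m : ℕ} (g : Cactus m) (z : Fin m → D),
      (EObj.lift (𝟭 D)).arr (EObj.ar π g (Arr.id ∘ z)) = act g z := fun g z => by
    have e : (𝟭 D).arr ∘ Arr.id ∘ z = Arr.id ∘ z := rfl
    rw [EObj.lift_arr, EObj.ev_ar, e, ← List.map_ofFn, ← id_prod]
    exact id_comp (dom_act _ _).symm
  have h := congrArg (EObj.lift (𝟭 D)).arr (EObj.ar_μ g f fun i => Arr.id ∘ z i)
  rw [Functor.arr_comp _ (by rw [cod_prod_ofFn, dom_act]; rfl), hl.arr_prod, hl.arr_act,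
    List.map_ofFn] at h
  refine ((hev _ _).symm.trans h).trans ?_
  exact congrArg (fun l => (List.ofFn l).prod ⋆ _) (funext fun i => hev _ _)

theorem id_eq_prod_ofFn (k : Fin n → ℕ) :
    Arr.id (List.ofFn fun i => (⟨k i⟩ : BObj π)).prod =
      (List.ofFn fun i => BObj.ar π (k i) 1).prod := by
  rw [id_prod, List.map_ofFn]; rfl

theorem ar_μ_one (g : Cactus n) :
    BObj.ar π _ (μ g fun i => (1 : Cactus (k i))) = act g fun i => ⟨k i⟩ := by
  rw [ar_μ, ← id_eq_prod_ofFn]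
  exact id_comp (dom_act _ _).symm

theorem μ_assoc {p : ∀ i, Fin (k i) → ℕ} (f : Cactus n) (g : ∀ i, Cactus (k i))
    (h : ∀ i j, Cactus (p i j)) :
    gcast (sum_finSigmaFinEquiv_symm p)
      (μ (k := fun a => p (finSigmaFinEquiv.symm a).1 (finSigmaFinEquiv.symm a).2) (μ f g)
        fun a => h (finSigmaFinEquiv.symm a).1 (finSigmaFinEquiv.symm a).2) =
      μ f fun i => μ (g i) (h i) := by
  refine BObj.ar_inj (π := π) ?_
  have e : ∀ i, (List.ofFn ((fun j => (⟨p i j⟩ : BObj π)) ∘ ⇑(π _ (g i)).symm)).prod =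
      ⟨∑ j, p i j⟩ := fun i => BObj.ext_n (by
    rw [BObj.n_prod, List.map_ofFn, List.sum_ofFn]
    exact Equiv.sum_comp (π _ (g i)).symm (p i))
  have e' : ∀ i, (List.ofFn fun j => BObj.ar π _ (h i j)).prod.cod =
      (act (g i) fun j => (⟨p i j⟩ : BObj π)).dom := fun i => by
    rw [cod_prod_ofFn, dom_act]; rfl
  have e'' : (List.ofFn fun t => BObj.ar π _
        (h (finSigmaFinEquiv.symm t).1 (finSigmaFinEquiv.symm t).2)).prod =
      (List.ofFn fun i => (List.ofFn fun j => BObj.ar π _ (h i j)).prod).prod := by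
    rw [← List.flatten_ofFn_ofFn fun i j => BObj.ar π _ (h i j), List.prod_flatten, List.map_ofFn]
    rfl
  rw [BObj.ar_gcast, ar_μ, ar_μ, act_μ f g fun i j => (⟨p i j⟩ : BObj π), e'']
  simp only [ar_μ, e]
  rw [← List.prod_ofFn_comp e', comp_assoc]
  · rw [cod_prod_ofFn, dom_prod_ofFn]
    exact congrArg (fun l => (List.ofFn l).prod) (funext e')
  · rw [cod_prod_ofFn, dom_act]
    exact congrArg (fun l => (List.ofFn l).prod) (funext fun i => (cod_act _ _).trans (e i))

theorem μ_mul_μ (g g' : Cactus n) (f : ∀ i, Cactus (k ((π n g')⁻¹ i))) (f' : ∀ i, Cactus (k i)) :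
    gcast (Equiv.sum_comp (π n g')⁻¹ k) (μ g f) * μ g' f' =
      μ (g * g') fun i => gcast (by simp) (f (π n g' i)) * f' i := by
  refine BObj.ar_inj (π := π) ?_
  let A : Fin n → Arr (BObj π) := fun i => BObj.ar π _ (f (π n g' i))
  have h := act_natural g' A
  have hA : dom ∘ A = fun i => ⟨k i⟩ := funext fun i =>
    BObj.ext_n (congrArg k ((π n g').symm_apply_apply i))
  have hA' : A ∘ ⇑(π n g').symm = fun i => BObj.ar π _ (f i) := funext fun i =>
    congrArg (fun i => BObj.ar π _ (f i)) ((π n g').apply_symm_apply i)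
  rw [show cod ∘ A = dom ∘ A from rfl, hA, hA'] at h
  have h' : ∀ i, BObj.ar π (k i) (gcast (by simp) (f (π n g' i)) * f' i) =
      BObj.ar π (k i) (f' i) ⋆ A i := fun i => by
    rw [← BObj.ar_comp, BObj.ar_gcast]
  rw [← BObj.ar_comp, BObj.ar_gcast, ar_μ, ar_μ, ar_μ, act_mul]
  simp only [h']
  rw [← List.prod_ofFn_comp fun i => (congrFun hA i).symm]
  -- The middle factors of `f' ⋆ act g' ⋆ f ⋆ act g` are exchanged by naturality of `act g'`.
  refine comp_exchange h.symm ?_ ?_ ?_ ?_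
  · rw [cod_prod_ofFn, dom_act]; rfl
  · rw [cod_act, dom_prod_ofFn]; rfl
  · rw [cod_prod_ofFn, dom_act]; rfl
  · rw [cod_prod_ofFn, dom_act]
    exact congrArg (fun l => (List.ofFn l).prod) hA

theorem π_μ (g : Cactus n) (f : ∀ i, Cactus (k i)) (i : Fin n) (j : Fin (k i)) :
    π _ (μ g f) (finSigmaFinEquiv ⟨i, j⟩) =
      Fin.cast (Equiv.sum_comp (π n g)⁻¹ k)
        (finSigmaFinEquiv (n := fun i' => k ((π n g)⁻¹ i'))
          ⟨π n g i, Fin.cast (by simp) (π _ (f i) j)⟩) := by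
  -- The permutation is read off from its effect on a string of `∑ i, k i` different objects.
  let e : ∀ i, Fin (k i) → Arr (Discrete (Fin (∑ i, k i))) := fun i j =>
    Arr.id ⟨finSigmaFinEquiv ⟨i, j⟩⟩
  have h := congrArg (fun A => (EObj.toList A.cod).map Discrete.as) (EObj.ar_μ g f e)
  rw [cod_comp (by rw [cod_prod_ofFn, dom_act]; rfl), cod_act, EObj.toList_prod, List.map_ofFn,
    EObj.cod_ar, List.map_flatten, List.map_ofFn, EObj.toList, List.map_ofFn] at h
  have h' : List.ofFn (π _ (μ g f)).symm = (List.ofFn fun i' => List.ofFn fun j' =>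
      finSigmaFinEquiv ⟨(π n g).symm i', (π _ (f _)).symm j'⟩).flatten := by
    refine Eq.trans ?_ (h.trans ?_)
    · exact congrArg List.ofFn (funext fun t => (finSigmaFinEquiv.apply_symm_apply _).symm)
    · refine congrArg (fun l => (List.ofFn l).flatten) (funext fun i' => ?_)
      exact List.map_ofFn
  have hs : ∀ i' (hi : i' = i) (h : k i = k i'),
      finSigmaFinEquiv ⟨i', (π _ (f i')).symm (Fin.cast h (π _ (f i) j))⟩ =
        finSigmaFinEquiv ⟨i, j⟩ := by
    rintro _ rfl _
    simp
  have hg := List.getElem_flatten_ofFn (k := fun i' => k ((π n g).symm i'))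
    (fun i' j' => finSigmaFinEquiv (n := k) ⟨(π n g).symm i', (π _ (f _)).symm j'⟩) (π n g i)
    (Fin.cast (by simp) (π _ (f i) j))
  rw [← val_finSigmaFinEquiv, ← h', hs _ ((π n g).symm_apply_apply i),
    List.getElem?_eq_getElem (by
      rw [List.length_ofFn, ← Equiv.sum_comp (π n g)⁻¹ k]; exact Fin.is_lt _),
    List.getElem_ofFn, Option.some_inj, Equiv.symm_apply_eq] at hg
  exact hg.symm

theorem ar_blocks (h : ∀ i, Cactus (k i)) :
    BObj.ar π _ (blocks h) = (List.ofFn fun i => BObj.ar π (k i) (h i)).prod := by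
  induction n with
  | zero => simp [blocks]; rfl
  | succ n ih =>
    have e : blocks h = gcast (Fin.sum_univ_succ k).symm (β (h 0) (blocks fun i => h i.succ)) := by
      have e₀ : partialSum k (0 : Fin (n + 1)) = 0 := by simp [partialSum]
      have e₁ : ∀ i : Fin n, partialSum (fun i => k i.succ) i + k 0 = partialSum k i.succ :=
        fun i => by simp [partialSum, Fin.sum_univ_succ, Nat.add_comm]
      rw [blocks, List.ofFn_succ, List.prod_cons, β, map_mul, gcast_shift, shift_congr e₀, blocks,
        map_list_prod, map_list_prod, List.map_map, List.map_ofFn]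
      congr 3
      funext i
      rw [Function.comp_apply, Function.comp_apply, shift_shift, gcast_shift, shift_congr (e₁ i)]
    rw [e, BObj.ar_gcast, List.ofFn_succ, List.prod_cons, ← ih]
    rfl

theorem _root_.List.ofFn_ite {α γ : Type*} {z : Fin n → α} {a b d : List α} {p q : ℕ} (hp : 1 ≤ p)
    (h : List.ofFn z = a ++ b ++ d) (h₁ : a.length = p - 1) (h₂ : (a ++ b).length = q)
    (φ ψ : α → γ) :
    (List.ofFn fun i => if p ≤ (i : ℕ) + 1 ∧ (i : ℕ) + 1 ≤ q then φ (z i) else ψ (z i)) =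
      a.map ψ ++ b.map φ ++ d.map ψ := by
  have hn : n = (a ++ b ++ d).length := by rw [← h, List.length_ofFn]
  have hz : ∀ i : Fin n, z i = (a ++ b ++ d)[(i : ℕ)]'(by rw [← hn]; exact i.2) := fun i => by
    simp only [← h, List.getElem_ofFn]
  refine List.ext_getElem (by simp [hn]) fun i h₃ h₄ => ?_
  rw [List.length_append] at h₂
  simp only [List.getElem_ofFn, hz, List.getElem_append, List.length_append, List.length_map,
    List.getElem_map]
  split_ifs <;> first | rfl | omega

theorem μ_s {p q : ℕ} (hp : 1 ≤ p) (hpq : p < q) (hq : q ≤ n) :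
    μ (s n p q) (fun i => (1 : Cactus (k i))) =
      s (∑ i, k i) (partialSum k (p - 1) + 1) (partialSum k q) *
        blocks fun i => if p ≤ (i : ℕ) + 1 ∧ (i : ℕ) + 1 ≤ q then s (k i) 1 (k i) else 1 := by
  refine BObj.ar_inj (π := π) ?_
  obtain ⟨a, b, d, hl, h₁, h₂⟩ := List.exists_append_append
    (l := List.ofFn fun i => (⟨k i⟩ : BObj π)) (show p - 1 ≤ q by omega) (by simpa using hq)
  have hk : List.ofFn k = (a ++ b ++ d).map BObj.n := by rw [← hl, List.map_ofFn]; rfl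
  have hs : a.prod.n + b.prod.n + d.prod.n = ∑ i, k i := by
    rw [← List.sum_ofFn, hk]; simp [BObj.n_prod, Nat.add_assoc]
  have ha : partialSum k (p - 1) = a.prod.n := by
    rw [partialSum_eq, hk, ← List.map_take, List.append_assoc, List.take_left' h₁, BObj.n_prod]
  have hb : partialSum k q = a.prod.n + b.prod.n := by
    rw [partialSum_eq, hk, ← List.map_take, List.take_left' h₂, List.map_append, List.sum_append,
      BObj.n_prod, BObj.n_prod]
  have h : (List.ofFn fun i => BObj.ar π (k i)
      (if p ≤ (i : ℕ) + 1 ∧ (i : ℕ) + 1 ≤ q then s (k i) 1 (k i) else 1)) =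
      a.map Arr.id ++ b.map (fun x => BObj.ar π x.n (s x.n 1 x.n)) ++ d.map Arr.id := by
    rw [← List.ofFn_ite hp hl h₁ h₂]
    refine congrArg List.ofFn (funext fun i => ?_)
    split_ifs <;> rfl
  have hc : (b.map fun x => BObj.ar π x.n (s x.n 1 x.n)).prod.cod = b.prod := by
    rw [cod_prod, List.map_map]; exact congrArg _ (List.map_id b)
  rw [ar_μ_one, act_s hp hpq hq, hl, seg_eq h₁ h₂, BObj.rev_eq, ← BObj.ar_comp, ar_blocks, h,
    List.prod_append, List.prod_append, ← id_prod, ← id_prod, ha, hb,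
    ← BObj.id_mul_ar_s_mul_id _ _ _ _ hs, mul_comp_mul (by simp [hc]) (by simp),
    mul_comp_mul (by simp) (by rw [hc]; rfl), id_comp (by simp), id_comp (by simp)]

/-- The action operad of the cactus groups. -/
def operad : ActionOperad π where
  μ := μ
  one := 1
  one_μ {m} g := BObj.ar_inj (by
    rw [BObj.ar_gcast, ar_μ, act_one, comp_id (by rw [cod_prod_ofFn]; rfl)]
    simp)
  μ_one {n} g := BObj.ar_inj (by
    rw [BObj.ar_gcast, ar_μ_one, BObj.act_one_eq_ar])
  assoc := μ_assoc
  π_μ := π_μ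
  μ_mul_μ := μ_mul_μ

theorem isOperad : IsOperad operad where
  μ_one_left {n k} h := BObj.ar_inj (π := π) (by
    refine (ar_μ 1 h).trans ?_
    rw [act_one, comp_id (by rw [cod_prod_ofFn]; rfl), ar_blocks])
  μ_s _ _ := μ_s

end Cactus

/-! ### The 2-monad `EΛ` on the sets of all morphisms -/

section

variable {Λ : ℕ → Type} [∀ n, Group (Λ n)] {π : ∀ n, Λ n →* Equiv.Perm (Fin n)}

theorem CoboundaryGroups.π_β [G : CoboundaryGroups π] {m n : ℕ} (f : Λ m) (g : Λ n) :
    π _ (G.β f g) = blockSum (π m f) (π n g) :=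
  Equiv.ext fun i => by
    induction i using Fin.addCases with
    | left i => rw [G.π_β_left, blockSum_castAdd]
    | right i => rw [G.π_β_right, blockSum_natAdd]

theorem CoboundaryGroups.π_c [G : CoboundaryGroups π] (m n : ℕ) :
    π _ (G.c m n) = blockSwap m n :=
  Equiv.ext fun i => by
    induction i using Fin.addCases with
    | left i => rw [G.π_c_left, blockSwap_castAdd]
    | right i => rw [G.π_c_right, blockSwap_natAdd]

namespace EObj

variable {X : Type u} [Category.{v} X] {Y : Type u'} [Category.{v'} Y]

theorem comps_map (H : X ⥤ Y) (A : Arr (EObj π X)) :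
    comps ((map π H).arr A) = (comps A).map H.arr := by
  rw [comps, comps, List.map_ofFn]; rfl

theorem map_ar (H : X ⥤ Y) {n : ℕ} (g : Λ n) (f : Fin n → Arr X) :
    (map π H).arr (ar π g f) = ar π g (H.arr ∘ f) :=
  arr_ext rfl (by rw [comps_map, comps_ar, comps_ar, List.map_ofFn])

theorem toSymmetric_ar {n : ℕ} (g : Λ n) (f : Fin n → Arr X) :
    (toSymmetric π X).arr (ar π g f) = ar symmetricπ (π n g) f := rfl

theorem unit_map (H : X ⥤ Y) : unit π X ⋙ map π H = H ⋙ unit π Y :=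
  Functor.ext_arr fun A => by
    rw [Functor.comp_arr, Functor.comp_arr, unit_arr, map_ar, unit_arr]; rfl

theorem unit_toSymmetric : unit π X ⋙ toSymmetric π X = unit symmetricπ X :=
  Functor.ext_arr fun A => by
    rw [Functor.comp_arr, unit_arr, unit_arr, toSymmetric_ar, map_one]

theorem mk_mapNat {H H' : X ⥤ Y} (α : H ⟶ H') (a : EObj π X) :
    (⟨(mapNat π α).app a⟩ : Arr (EObj π Y)) = ar π 1 fun i => ⟨α.app (a.x i)⟩ :=
  (mk_eq_ar _).trans (congrArg (ar π _) (funext fun i => (mapNatApp_comp α a i).mk_eq))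

theorem mapNat_single {H H' : X ⥤ Y} (α : H ⟶ H') (x : X) :
    (mapNat π α).app (single π x) = (unit π Y).map (α.app x) :=
  mk_inj ((mk_mapNat _ _).trans (unit_arr (π := π) ⟨α.app x⟩).symm)

section Strict

variable [G : CoboundaryGroups π]

theorem map_strict (H : X ⥤ Y) : IsStrictCoboundaryFunctor (map π H) := by
  refine .of_arr (toList_injective rfl) (fun A B => ?_) fun a b => ?_
  · refine arr_ext rfl ?_
    rw [comps_map, comps_mul, comps_mul, comps_map, comps_map, List.map_append]
  · refine arr_ext rfl ?_
    rw [comps_map, comps_σ, comps_σ, toList_mul, toList_mul, List.map_append, List.map_append,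
      List.map_append]
    simp only [toList, List.map_ofFn]
    exact congrArg₂ _ (congrArg List.ofFn (funext fun _ => H.arr_id _))
      (congrArg List.ofFn (funext fun _ => H.arr_id _))

theorem toSymmetric_strict : IsStrictCoboundaryFunctor (toSymmetric π X) := by
  refine .of_arr rfl (fun A B => ?_) fun a b => ?_
  · obtain ⟨m, g, f, rfl⟩ := exists_ar A
    obtain ⟨n, g', f', rfl⟩ := exists_ar B
    rw [ar_mul_ar, toSymmetric_ar, toSymmetric_ar, toSymmetric_ar, ar_mul_ar, G.π_β]
    rfl
  · rw [σ_eq_ar, toSymmetric_ar, σ_eq_ar, G.π_c]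
    rfl

theorem mapNat_monoidal {H H' : X ⥤ Y} (α : H ⟶ H') :
    IsMonoidalTransformation (map_strict H) (map_strict H') (mapNat π α) :=
  .of_mk ((mk_mapNat _ _).trans (arr_ext rfl (comps_ar _ _))) fun a b => by
    rw [mk_mapNat, mk_mapNat, mk_mapNat, ar_mul_ar, G.β_one_one]
    exact congrArg (ar π 1) (comp_append (fun x => (⟨α.app x⟩ : Arr Y)) a.x b.x)

end Strict

variable (O : ActionOperad π)

theorem comps_mult (A : Arr (EObj π (EObj π X))) :
    comps ((mult O X).arr A) = ((comps A).map comps).flatten := by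
  refine Eq.trans ?_ (congrArg List.flatten List.map_ofFn).symm
  refine Eq.trans ?_ (List.flatten_ofFn_ofFn fun i => cmp (cmp A i)).symm
  exact congrArg List.ofFn (funext fun t => mk_comp_eqToHom _ _)

theorem mult_ar {n : ℕ} {k : Fin n → ℕ} (g : Λ n) (f : ∀ i, Λ (k i)) (e : ∀ i, Fin (k i) → Arr X) :
    (mult O X).arr (ar π g fun i => ar π (f i) (e i)) =
      ar π (O.μ g f) fun t => e (finSigmaFinEquiv.symm t).1 (finSigmaFinEquiv.symm t).2 := by
  have h := cmp_ar (π := π) g fun i => ar π (f i) (e i)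
  refine arr_ext ?_ ?_
  · exact (BObj.mk_eq_ar _).trans (congrArg (fun E : Fin n → Arr (EObj π X) =>
      BObj.ar π _ (O.μ g fun i => Hom.g (E i).hom)) h)
  · rw [comps_mult, comps_ar, comps_ar, List.map_ofFn, ← List.flatten_ofFn_ofFn]
    exact congrArg (fun l => (List.ofFn l).flatten) (funext fun i => comps_ar _ _)

end EObj

end

/-- The multiplication of `EJ` is the strict coboundary functor which extends the identity, because
both are given by `EObj.ar_μ`. -/
theorem Cactus.mult_eq_lift (X : Type u) [Category.{v} X] :
    EObj.mult Cactus.operad X = EObj.lift (𝟭 (EObj Cactus.π X)) := by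
  refine Functor.ext_arr fun A => ?_
  obtain ⟨n, g, f, rfl⟩ := EObj.exists_ar A
  choose k h e he using fun i => EObj.exists_ar (f i)
  obtain rfl : f = fun i => EObj.ar Cactus.π (h i) (e i) := funext he
  rw [EObj.mult_ar, EObj.lift_arr, EObj.ev_ar]
  exact EObj.ar_μ g h e

/-! ### Pullbacks of categories -/

/-- A commutative square of functors is a pullback of categories if it is one on the sets of all
morphisms. -/
theorem CategoryTheory.Cat.isPullback_of_arr {A B C D : Type u} [Category.{v} A] [Category.{v} B]
    [Category.{v} C] [Category.{v} D] {F : A ⥤ B} {F' : A ⥤ C} {G : B ⥤ D} {G' : C ⥤ D}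
    (w : F ⋙ G = F' ⋙ G') (inj : ∀ a a', F.arr a = F.arr a' → F'.arr a = F'.arr a' → a = a')
    (ex : ∀ b c, G.arr b = G'.arr c → ∃ a, F.arr a = b ∧ F'.arr a = c) :
    IsPullback F.toCatHom F'.toCatHom G.toCatHom G'.toCatHom := by
  have injo : ∀ x x', F.obj x = F.obj x' → F'.obj x = F'.obj x' → x = x' := fun x x' h h' =>
    congrArg dom (inj (.id x) (.id x') (by simp [h]) (by simp [h']))
  have hl : ∀ {W : Type u} [Category.{v} W] (P : W ⥤ B) (Q : W ⥤ C), P ⋙ G = Q ⋙ G' →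
      ∃ K : W ⥤ A, K ⋙ F = P ∧ K ⋙ F' = Q := by
    intro W _ P Q h
    choose φ h₁ h₂ using fun U : Arr W => ex (P.arr U) (Q.arr U) (by
      rw [← Functor.comp_arr, h, Functor.comp_arr])
    have hd : ∀ U, (φ U).dom = (φ (.id U.dom)).dom := fun U => injo _ _
      (by rw [← F.dom_arr, ← F.dom_arr, h₁, h₁]; rfl)
      (by rw [← F'.dom_arr, ← F'.dom_arr, h₂, h₂]; rfl)
    have hc : ∀ U, (φ U).cod = (φ (.id U.cod)).dom := fun U => injo _ _
      (by rw [← F.dom_arr, ← F.cod_arr, h₁, h₁]; rfl)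
      (by rw [← F'.dom_arr, ← F'.cod_arr, h₂, h₂]; rfl)
    refine ⟨Functor.ofArr (fun x => (φ (.id x)).dom) φ hd hc (fun x => ?_) fun U V hUV => ?_,
      Functor.ext_arr fun U => ?_, Functor.ext_arr fun U => ?_⟩
    · refine inj _ _ ?_ ?_
      · rw [F.arr_id, ← F.dom_arr, h₁, P.arr_id, dom_id]
      · rw [F'.arr_id, ← F'.dom_arr, h₂, Q.arr_id, dom_id]
    · have e : (φ U).cod = (φ V).dom := by rw [hc, hUV]; exact (hd V).symm
      refine inj _ _ ?_ ?_
      · rw [F.arr_comp e, h₁, h₁, h₁, P.arr_comp hUV]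
      · rw [F'.arr_comp e, h₂, h₂, h₂, Q.arr_comp hUV]
    · rw [Functor.comp_arr, Functor.ofArr_arr, h₁]
    · rw [Functor.comp_arr, Functor.ofArr_arr, h₂]
  choose K hK hK' using fun s : Limits.PullbackCone G.toCatHom G'.toCatHom =>
    hl s.fst.toFunctor s.snd.toFunctor (congrArg Cat.Hom.toFunctor s.condition)
  have hu : ∀ {W : Type u} [Category.{v} W] (K K' : W ⥤ A), K ⋙ F = K' ⋙ F → K ⋙ F' = K' ⋙ F' →
      K = K' := fun K K' h h' => Functor.ext_arr fun U => inj _ _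
    (by rw [← Functor.comp_arr, h, Functor.comp_arr])
    (by rw [← Functor.comp_arr, h', Functor.comp_arr])
  exact ⟨⟨Cat.ext w⟩, ⟨Limits.PullbackCone.IsLimit.mk _ (fun s => (K s).toCatHom)
    (fun s => Cat.ext (hK s)) (fun s => Cat.ext (hK' s)) fun s m h h' => Cat.ext <|
      hu m.toFunctor (K s) ((congrArg Cat.Hom.toFunctor h).trans (hK s).symm)
        ((congrArg Cat.Hom.toFunctor h').trans (hK' s).symm)⟩⟩

theorem EObj.toSymmetric_cartesian {Λ : ℕ → Type} [∀ n, Group (Λ n)]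
    {π : ∀ n, Λ n →* Equiv.Perm (Fin n)} {X Y : Type u} [Category.{v} X] [Category.{v} Y]
    (H : X ⥤ Y) : IsPullback (map π H).toCatHom (toSymmetric π X).toCatHom
      (toSymmetric π Y).toCatHom (map symmetricπ H).toCatHom := by
  refine Cat.isPullback_of_arr (Functor.ext_arr fun A => ?_) (fun A A' h h' => ?_)
    fun B E h => ?_
  · obtain ⟨n, g, f, rfl⟩ := exists_ar A
    rw [Functor.comp_arr, Functor.comp_arr, map_ar, toSymmetric_ar, toSymmetric_ar, map_ar]
  · exact arr_ext (congrArg (forget π Y).arr h) (congrArg (comps (π := symmetricπ)) h')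
  · obtain ⟨m, g, f, rfl⟩ := exists_ar B
    obtain ⟨n, τ, e, rfl⟩ := exists_ar E
    rw [toSymmetric_ar, map_ar] at h
    obtain rfl : m = n := congrArg (fun A => A.dom.n) h
    obtain rfl : π m g = τ := BObj.ar_inj (congrArg (forget symmetricπ Y).arr h)
    obtain rfl : f = H.arr ∘ e := List.ofFn_injective (by simpa using congrArg comps h)
    exact ⟨ar π g e, map_ar _ _ _, toSymmetric_ar _ _⟩

/-! ### Transport of strict coboundary structures -/

namespace StrictCoboundaryCategory

variable {D : Type u} [Category.{v} D]

/-- A strict coboundary structure, from a tensor product of objects, a tensor product on the set of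
all morphisms, and a commutor with values in this set. -/
@[reducible] def ofArr (o : D → D → D) (e : D) (m : Arr D → Arr D → Arr D) (τ : D → D → Arr D)
    (hd : ∀ A B, (m A B).dom = o A.dom B.dom) (hc : ∀ A B, (m A B).cod = o A.cod B.cod)
    (assoc : ∀ A B E, m (m A B) E = m A (m B E)) (one_m : ∀ A, m (.id e) A = A)
    (m_one : ∀ A, m A (.id e) = A) (m_id : ∀ x y, m (.id x) (.id y) = .id (o x y))
    (m_comp : ∀ A B A' B', A.cod = B.dom → A'.cod = B'.dom →
      m (A ⋆ B) (A' ⋆ B') = m A A' ⋆ m B B')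
    (τd : ∀ x y, (τ x y).dom = o x y) (τc : ∀ x y, (τ x y).cod = o y x)
    (τ_natural : ∀ A B, m A B ⋆ τ A.cod B.cod = τ A.dom B.dom ⋆ m B A)
    (τ_τ : ∀ x y, τ x y ⋆ τ y x = .id (o x y))
    (cactus : ∀ x y z, m (.id x) (τ y z) ⋆ τ x (o z y) = m (τ x y) (.id z) ⋆ τ (o y x) z)
    (τ_one : τ e e = .id (o e e)) : StrictCoboundaryCategory D :=
  have o_assoc (x y z : D) : o (o x y) z = o x (o y z) := by
    simpa [m_id] using congrArg dom (assoc (.id x) (.id y) (.id z))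
  have one_o (x : D) : o e x = x := by simpa [m_id] using congrArg dom (one_m (.id x))
  have o_one (x : D) : o x e = x := by simpa [m_id] using congrArg dom (m_one (.id x))
  let t {x y x' y' : D} (f : x ⟶ y) (g : x' ⟶ y') : o x x' ⟶ o y y' :=
    (m ⟨f⟩ ⟨g⟩).toHom (hd _ _) (hc _ _)
  have mk_t {x y x' y' : D} (f : x ⟶ y) (g : x' ⟶ y') : Arr.mk (t f g) = m ⟨f⟩ ⟨g⟩ := mk_toHom _ _ _
  have mk_t_eqToHom {x y x' y' : D} (h : x = y) (g : x' ⟶ y') :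
      Arr.mk (t (eqToHom h) g) = m (.id x) ⟨g⟩ :=
    (mk_t _ _).trans (congrArg (m · _) (mk_eqToHom h))
  have mk_t_eqToHom' {x y x' y' : D} (g : x' ⟶ y') (h : x = y) :
      Arr.mk (t g (eqToHom h)) = m ⟨g⟩ (.id x) :=
    (mk_t _ _).trans (congrArg (m _) (mk_eqToHom h))
  have τ_symm (x y : D) : (τ x y).toHom (τd x y) (τc x y) ≫ (τ y x).toHom (τd y x) (τc y x) =
      𝟙 (o x y) := mk_inj (by rw [← mk_comp_mk, mk_toHom, mk_toHom, τ_τ]; rfl)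
  letI : MonoidalCategoryStruct D :=
    { tensorObj := o
      tensorHom := t
      whiskerLeft := fun x _ _ f => t (𝟙 x) f
      whiskerRight := fun f x => t f (𝟙 x)
      tensorUnit := e
      associator := fun x y z => eqToIso (o_assoc x y z)
      leftUnitor := fun x => eqToIso (one_o x)
      rightUnitor := fun x => eqToIso (o_one x) }
  letI : MonoidalCategory D := .ofTensorHom
    (id_tensorHom_id := fun x y => mk_inj ((mk_t _ _).trans (m_id x y)))
    (id_tensorHom := fun _ _ _ _ => rfl)
    (tensorHom_id := fun _ _ => rfl)
    (tensorHom_comp_tensorHom := fun f₁ f₂ g₁ g₂ => mk_inj (by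
      refine (mk_comp_mk _ _).symm.trans ((congrArg₂ _ (mk_t _ _) (mk_t _ _)).trans ?_)
      refine Eq.trans ?_ (mk_t _ _).symm
      rw [← mk_comp_mk, ← mk_comp_mk, m_comp _ _ _ _ rfl rfl]))
    (associator_naturality := fun f g h => mk_inj (by
      refine (mk_comp_eqToHom _ (o_assoc _ _ _)).trans
        (Eq.trans ?_ (mk_eqToHom_comp (o_assoc _ _ _) _).symm)
      exact (mk_t _ _).trans ((congrArg (m · _) (mk_t f g)).trans ((assoc _ _ _).trans
        ((congrArg (m _) (mk_t g h)).symm.trans (mk_t _ _).symm)))))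
    (leftUnitor_naturality := fun f => mk_inj (by
      refine (mk_comp_eqToHom _ (one_o _)).trans (Eq.trans ?_ (mk_eqToHom_comp (one_o _) _).symm)
      exact (mk_t _ _).trans (one_m _)))
    (rightUnitor_naturality := fun f => mk_inj (by
      refine (mk_comp_eqToHom _ (o_one _)).trans (Eq.trans ?_ (mk_eqToHom_comp (o_one _) _).symm)
      exact (mk_t _ _).trans (m_one _)))
    -- In the pentagon and in the triangle, both sides are identities in `Arr D`.
    (pentagon := fun w x y z => mk_inj (by
      refine (mk_comp_mk _ _).symm.trans ((congrArg₂ _ (mk_t_eqToHom (o_assoc w x y) (𝟙 z))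
        ((mk_eqToHom_comp (o_assoc _ _ _) _).trans (mk_t_eqToHom' (𝟙 w) (o_assoc x y z)))).trans ?_)
      refine Eq.trans ?_ ((mk_eqToHom_comp (o_assoc _ _ _) _).trans (mk_eqToHom (o_assoc _ _ _))).symm
      refine (congrArg₂ _ (m_id _ _) (m_id _ _)).trans ((comp_id ?_).trans ?_)
      all_goals simp only [o_assoc, cod_id]))
    (triangle := fun x y => mk_inj (by
      refine (mk_eqToHom_comp (o_assoc _ _ _) _).trans ((mk_t_eqToHom' (𝟙 x) (one_o y)).trans
        (Eq.trans ?_ (mk_t_eqToHom (o_one x) (𝟙 y)).symm))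
      refine (m_id _ _).trans (Eq.trans ?_ (m_id _ _).symm)
      simp only [one_o, o_one]))
  { tensor_assoc := o_assoc
    unit_tensor := one_o
    tensor_unit := o_one
    associator_hom := fun _ _ _ => rfl
    leftUnitor_hom := fun _ => rfl
    rightUnitor_hom := fun _ => rfl
    commutor := fun x y =>
      { hom := (τ x y).toHom (τd x y) (τc x y)
        inv := (τ y x).toHom (τd y x) (τc y x)
        hom_inv_id := τ_symm x y
        inv_hom_id := τ_symm y x }
    commutor_naturality := fun {x x' y y'} f g => mk_inj (by
      refine (mk_comp_mk _ _).symm.trans (Eq.trans ?_ (mk_comp_mk _ _))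
      refine (congrArg₂ _ (mk_t _ _) (mk_toHom _ (τd _ _) (τc _ _))).trans
        (Eq.trans ?_ (congrArg₂ _ (mk_toHom _ (τd _ _) (τc _ _)) (mk_t _ _)).symm)
      exact τ_natural ⟨f⟩ ⟨g⟩)
    commutor_symmetry := τ_symm
    cactus := fun x y z => mk_inj (by
      refine (mk_eqToHom_comp (o_assoc _ _ _) _).trans ?_
      refine Eq.trans ?_ (congrArg Arr.mk (Category.assoc _ _ _))
      refine Eq.trans ?_ (mk_comp_eqToHom _ (o_assoc _ _ _).symm).symm
      refine (mk_comp_mk _ _).symm.trans (Eq.trans ?_ (mk_comp_mk _ _))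
      refine (congrArg₂ _ ((mk_t _ _).trans (congrArg (m _) (mk_toHom _ (τd _ _) (τc _ _))))
        (mk_toHom _ (τd _ _) (τc _ _))).trans (Eq.trans ?_ (congrArg₂ _
          ((mk_t _ _).trans (congrArg (m · _) (mk_toHom _ (τd _ _) (τc _ _))))
            (mk_toHom _ (τd _ _) (τc _ _))).symm)
      exact cactus x y z)
    commutor_unit := mk_inj ((mk_toHom _ (τd _ _) (τc _ _)).trans τ_one) }

theorem monoidalCategoryStruct_ext {M M' : MonoidalCategoryStruct D}
    (ho : M.tensorObj = M'.tensorObj) (he : M.tensorUnit = M'.tensorUnit)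
    (ht : ∀ {x y x' y' : D} (f : x ⟶ y) (g : x' ⟶ y'),
      Arr.mk (M.tensorHom f g) = Arr.mk (M'.tensorHom f g))
    (hwl : ∀ (x : D) {y z : D} (f : y ⟶ z),
      Arr.mk (M.whiskerLeft x f) = Arr.mk (M'.whiskerLeft x f))
    (hwr : ∀ {y z : D} (f : y ⟶ z) (x : D),
      Arr.mk (M.whiskerRight f x) = Arr.mk (M'.whiskerRight f x))
    (ha : ∀ x y z : D, Arr.mk (M.associator x y z).hom = Arr.mk (M'.associator x y z).hom)
    (hl : ∀ x : D, Arr.mk (M.leftUnitor x).hom = Arr.mk (M'.leftUnitor x).hom)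
    (hr : ∀ x : D, Arr.mk (M.rightUnitor x).hom = Arr.mk (M'.rightUnitor x).hom) : M = M' := by
  obtain ⟨o, wl, wr, t, e, α, l, r⟩ := M
  obtain ⟨o', wl', wr', t', e', α', l', r'⟩ := M'
  dsimp only at ho he
  subst ho he
  obtain rfl : @wl = @wl' := by funext x _ _ f; exact mk_inj (hwl x f)
  obtain rfl : @wr = @wr' := by funext _ _ f x; exact mk_inj (hwr f x)
  obtain rfl : @t = @t' := by funext _ _ _ _ f g; exact mk_inj (ht f g)
  obtain rfl : α = α' := by funext x y z; exact Iso.ext (mk_inj (ha x y z))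
  obtain rfl : l = l' := by funext x; exact Iso.ext (mk_inj (hl x))
  obtain rfl : r = r' := by funext x; exact Iso.ext (mk_inj (hr x))
  rfl

theorem monoidalCategory_ext {M M' : MonoidalCategory D} (s : @IsStrictMonoidal D _ M)
    (s' : @IsStrictMonoidal D _ M') (ho : M.tensorObj = M'.tensorObj)
    (he : M.tensorUnit = M'.tensorUnit)
    (ht : ∀ {x y x' y' : D} (f : x ⟶ y) (g : x' ⟶ y'),
      Arr.mk (M.tensorHom f g) = Arr.mk (M'.tensorHom f g)) : M = M' := by
  have h : M.toMonoidalCategoryStruct = M'.toMonoidalCategoryStruct := by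
    refine monoidalCategoryStruct_ext ho he ht (fun x y z f => ?_) (fun f x => ?_)
      (fun x y z => ?_) (fun x => ?_) fun x => ?_
    · rw [← @id_tensorHom D _ M, ← @id_tensorHom D _ M']; exact ht _ _
    · rw [← @tensorHom_id D _ M, ← @tensorHom_id D _ M']; exact ht _ _
    · rw [s.associator_hom, s'.associator_hom, mk_eqToHom, mk_eqToHom, ho]
    · rw [s.leftUnitor_hom, s'.leftUnitor_hom, mk_eqToHom, mk_eqToHom, ho, he]
    · rw [s.rightUnitor_hom, s'.rightUnitor_hom, mk_eqToHom, mk_eqToHom, ho, he]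
  cases M
  cases M'
  cases h
  rfl

/-- A strict coboundary structure is determined by the tensor product of morphisms, the unit object
and the commutor. -/
theorem eq_of_arr {S S' : StrictCoboundaryCategory D}
    (h : ∀ A B, (@arrMonoid D _ S).mul A B = (@arrMonoid D _ S').mul A B)
    (he : S.tensorUnit = S'.tensorUnit) (hσ : ∀ x y, @σ D _ S x y = @σ D _ S' x y) : S = S' := by
  have hM : S.toMonoidalCategory = S'.toMonoidalCategory :=
    monoidalCategory_ext S.toIsStrictMonoidal S'.toIsStrictMonoidal
      (funext₂ fun x y => congrArg dom (h (.id x) (.id y))) he fun f g => h ⟨f⟩ ⟨g⟩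
  obtain @⟨M, _, C⟩ := S
  obtain @⟨M', _, C'⟩ := S'
  obtain rfl : M = M' := hM
  obtain rfl : C = C' := by
    obtain ⟨c⟩ := C
    obtain ⟨c'⟩ := C'
    obtain rfl : c = c' := funext₂ fun x y => Iso.ext (mk_inj (hσ x y))
    rfl
  rfl

/-- Two strict coboundary structures agree if the same functor, surjective on morphisms, is strict
for both. -/
theorem eq_of_isStrictCoboundaryFunctor {T : Type u'} [Category.{v'} T]
    [StrictCoboundaryCategory T] {a : T ⥤ D} (surj : ∀ A, ∃ U, A = a.arr U) :
    ∀ {S S' : StrictCoboundaryCategory D} (_ : @IsStrictCoboundaryFunctor T D _ _ _ S a)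
      (_ : @IsStrictCoboundaryFunctor T D _ _ _ S' a), S = S' := by
  have surjo : ∀ x, ∃ y, x = a.obj y := fun x =>
    let ⟨U, hU⟩ := surj (.id x)
    ⟨U.dom, congrArg dom hU⟩
  have key : ∀ {S : StrictCoboundaryCategory D} (_ : IsStrictCoboundaryFunctor a),
      a.obj 1 = S.tensorUnit ∧ (∀ U V, a.arr (U * V) = a.arr U * a.arr V) ∧
        ∀ x y, a.arr (σ x y) = σ (a.obj x) (a.obj y) := fun h => ⟨h.obj_unit, h.arr_mul, h.arr_σ⟩
  intro S S' h h'
  obtain ⟨h₁, h₂, h₃⟩ := key (S := S) h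
  obtain ⟨h₁', h₂', h₃'⟩ := key (S := S') h'
  refine eq_of_arr (fun A B => ?_) (h₁.symm.trans h₁') fun x y => ?_
  · obtain ⟨U, rfl⟩ := surj A
    obtain ⟨V, rfl⟩ := surj B
    exact (h₂ U V).symm.trans (h₂' U V)
  · obtain ⟨x, rfl⟩ := surjo x
    obtain ⟨y, rfl⟩ := surjo y
    exact (h₃ x y).symm.trans (h₃' x y)

/-- Let `s` be a section of the functor `a` on a strict coboundary category, such that the images
of tensor products and of commutors depend on the images of their arguments only. Then the target
has exactly one strict coboundary structure for which `a` is strict. -/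
theorem existsUnique_of_section {T : Type u'} [Category.{v'} T] [StrictCoboundaryCategory T]
    (a : T ⥤ D) (s : D ⥤ T) (h : s ⋙ a = 𝟭 D)
    (hm : ∀ U V, a.arr (U * V) = a.arr (s.arr (a.arr U) * s.arr (a.arr V)))
    (hσ : ∀ x y, a.arr (σ x y) = a.arr (σ (s.obj (a.obj x)) (s.obj (a.obj y)))) :
    ∃! _S : StrictCoboundaryCategory D, IsStrictCoboundaryFunctor a := by
  have hs : ∀ A, a.arr (s.arr A) = A := fun A => by rw [← Functor.comp_arr, h, Functor.id_arr]
  have hso : ∀ x, a.obj (s.obj x) = x := fun x => congrArg dom (hs (.id x))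
  have surj : ∀ A, ∃ U, A = a.arr U := fun A => ⟨_, (hs A).symm⟩
  have surjo : ∀ x, ∃ y, x = a.obj y := fun x => ⟨_, (hso x).symm⟩
  have hm' : ∀ x y, a.obj (x * y) = a.obj (s.obj (a.obj x) * s.obj (a.obj y)) := fun x y => by
    simpa using congrArg dom (hm (.id x) (.id y))
  have m_id : ∀ x y, a.arr (s.arr (.id x) * s.arr (.id y)) = .id (a.obj (s.obj x * s.obj y)) :=
    fun x y => by rw [s.arr_id, s.arr_id, ← id_mul, a.arr_id]
  refine ⟨ofArr (fun x y => a.obj (s.obj x * s.obj y)) (a.obj 1)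
    (fun A B => a.arr (s.arr A * s.arr B)) (fun x y => a.arr (σ (s.obj x) (s.obj y)))
    (fun _ _ => rfl) (fun _ _ => rfl) (fun A B E => ?_) (fun A => ?_) (fun A => ?_) m_id
    (fun A B A' B' hA hB => ?_) (fun _ _ => rfl) (fun _ _ => rfl) (fun A B => ?_) (fun x y => ?_)
    (fun x y z => ?_) ?_, ?strict, fun S hS => eq_of_isStrictCoboundaryFunctor surj hS ?strict⟩
  case strict =>
    exact @IsStrictCoboundaryFunctor.of_arr T _ D _ _ (_) a rfl
      (fun U V => (hm U V).trans (mk_toHom _ rfl rfl).symm)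
      fun x y => (hσ x y).trans (mk_toHom _ rfl rfl).symm
  · obtain ⟨U, rfl⟩ := surj A
    obtain ⟨V, rfl⟩ := surj B
    obtain ⟨W, rfl⟩ := surj E
    rw [← hm U V, ← hm V W, ← hm, ← hm, mul_assoc]
  · obtain ⟨U, rfl⟩ := surj A
    rw [← a.arr_id, ← hm, id_one, one_mul]
  · obtain ⟨U, rfl⟩ := surj A
    rw [← a.arr_id, ← hm, id_one, mul_one]
  · rw [s.arr_comp hA, s.arr_comp hB, ← mul_comp_mul (by simp [hA]) (by simp [hB]),
      a.arr_comp (by simp [hA, hB])]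
  · have := congrArg a.arr (σ_natural (s.arr A) (s.arr B))
    rwa [a.arr_comp (by simp), a.arr_comp (by simp)] at this
  · rw [← a.arr_comp (by simp), σ_σ, a.arr_id]
  · obtain ⟨x, rfl⟩ := surjo x
    obtain ⟨y, rfl⟩ := surjo y
    obtain ⟨z, rfl⟩ := surjo z
    rw [← hσ y z, ← hσ x y, ← a.arr_id, ← a.arr_id, ← hm, ← hm, ← hm', ← hm', ← hσ, ← hσ,
      ← a.arr_comp (by simp), ← a.arr_comp (by simp), σ_cactus]
  · rw [← hσ, ← hm', σ_one, mul_one, a.arr_id]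

end StrictCoboundaryCategory

/-! ### The 2-monad for strict coboundary categories -/

namespace EObj

open Cactus

theorem mult_strict (X : Type u) [Category.{v} X] : IsStrictCoboundaryFunctor (mult operad X) := by
  rw [mult_eq_lift]; exact lift_strict _

theorem unit_mult (X : Type u) [Category.{v} X] :
    unit π (EObj π X) ⋙ mult operad X = 𝟭 (EObj π X) := by
  rw [mult_eq_lift]; exact unit_lift _

/-- The associativity law of an algebra `a : EJ(D) ⥤ D`, evaluated at `η(U) ⊗ η(V)`, says that
`a(U ⊗ V)` depends on `a(U)` and `a(V)` only, and similarly for the commutor. -/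
theorem algebra (D : Type u) [Category.{v} D] (a : EObj π D ⥤ D) (h₁ : unit π D ⋙ a = 𝟭 D)
    (h₂ : mult operad D ⋙ a = map π a ⋙ a) :
    ∃! _S : StrictCoboundaryCategory D, IsStrictCoboundaryFunctor a := by
  have hm := mult_strict D
  have hu : ∀ U, (mult operad D).arr ((unit π (EObj π D)).arr U) = U := fun U => by
    rw [← Functor.comp_arr, unit_mult, Functor.id_arr]
  have hu' : ∀ U, (map π a).arr ((unit π (EObj π D)).arr U) = (unit π D).arr (a.arr U) := fun U => by
    rw [← Functor.comp_arr, unit_map, Functor.comp_arr]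
  have h : ∀ W, a.arr ((mult operad D).arr W) = a.arr ((map π a).arr W) := fun W => by
    rw [← Functor.comp_arr, h₂, Functor.comp_arr]
  refine StrictCoboundaryCategory.existsUnique_of_section a (unit π D) h₁ (fun U V => ?_)
    fun x y => ?_
  · have := h ((unit π (EObj π D)).arr U * (unit π (EObj π D)).arr V)
    rwa [hm.arr_mul, (map_strict a).arr_mul, hu, hu, hu', hu'] at this
  · have := h (σ ((unit π (EObj π D)).obj x) ((unit π (EObj π D)).obj y))
    have e : ∀ x, (mult operad D).obj ((unit π (EObj π D)).obj x) = x := fun x =>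
      congrArg dom (hu (.id x))
    rwa [hm.arr_σ, (map_strict a).arr_σ, e, e] at this

theorem isCoboundaryMonad : IsCoboundaryMonad.{v, u, v', u'} operad where
  free := isFreeOnCategory
  map_strict := map_strict
  unit_map := unit_map
  mapNat_monoidal := mapNat_monoidal
  mapNat_single := mapNat_single
  mult_strict := mult_strict
  unit_mult := unit_mult
  algebra := algebra
  toSymmetric_strict _ := toSymmetric_strict
  unit_toSymmetric _ := unit_toSymmetric
  toSymmetric_cartesian := toSymmetric_cartesian

end EObj

end

theorem mainTheorem5 :
    ((∀ {a b a' b' : BObj Cactus.π} (F : a ⟶ b) (F' : a' ⟶ b'), (F ⊗ₘ F').g =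
        Cactus.shift 0 (by simp) F.g * Cactus.shift a.n le_rfl F'.g) ∧
      (∀ a b : BObj Cactus.π, (a ⊗ b).n = a.n + b.n ∧
        (CoboundaryCategory.commutor a b).hom.g =
          Cactus.s (a.n + b.n) 1 (a.n + b.n) * Cactus.s (a.n + b.n) 1 a.n *
            Cactus.s (a.n + b.n) (a.n + 1) (a.n + b.n)) ∧
      IsFreeOnObject.{0, 0, v', u'} (⟨1⟩ : BObj Cactus.π)) ∧
    ∃ O : ActionOperad Cactus.π, Cactus.IsOperad O ∧ EObj.IsCoboundaryMonad.{v, u, v', u'} O :=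
  ⟨⟨fun _ _ => rfl, fun _ _ => ⟨rfl, rfl⟩, BObj.isFreeOnObject⟩,
    Cactus.operad, Cactus.isOperad, EObj.isCoboundaryMonad⟩
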